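/- Let $d$ be an even natural number, $\tilde\Omega>0$, and let $\Theta\in M_d(\mathbb R)$ be skew-symmetric and invertible. Let $\mathcal H=L^2(\mathbb R^d)\otimes\bigwedge(\mathbb C^d)$. On $\mathcal S(\mathbb R^d)\otimes\bigwedge(\mathbb C^d)$ put $a_\mu=\partial_\mu+\tilde\Omega x_\mu$ and $a_\mu^*=-\partial_\mu+\tilde\Omega x_\mu$ for $\mu=1,\dots,d$; let $b_\mu^*=e_\mu\wedge\cdot$ be the fermionic creation operators on $\bigwedge(\mathbb C^d)$ and $b_\mu$ their adjoints. Set $Q_1=\sum_\mu a_\mu\otimes b_\mu^*$, $Q_1^*=\sum_\mu a_\mu^*\otimes b_\mu$, $Q_2=\sum_\mu a_\mu\otimes b_\mu$, $Q_2^*=\sum_\mu a_\mu^*\otimes b_\mu^*$, and let $\mathcal D_1$ and $\mathcal D_2$ be the closures in $\mathcal H$ of $Q_1+Q_1^*$ and of $iQ_2-iQ_2^*$, defined on $\mathcal S(\mathbb R^d)\otimes\bigwedge(\mathbb C^d)$. For $f\in\mathcal A_\star=\mathcal S(\mathbb R^d)$ (complex-valued Schwartz functions) let $L_\star(f)$ be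 the bounded operator $\psi\mapsto f\star\psi$ on $\mathcal H$ of componentwise left Moyal multiplication, where $$f\star g(x)=(2\pi)^{-d}\int_{\mathbb R^d}dy\int_{\mathbb R^d}dk\; f\big(x+\tfrac12\Theta k\big)\,g(x+y)\,e^{i\langle k,y\rangle}.$$ Then $\mathcal D_1$ and $\mathcal D_2$ are self-adjoint, and for every $f\in\mathcal A_\star$ there is a finite constant $C(f)$ (which may depend also on $d,\tilde\Omega,\Theta$) such that for $\bullet=1,2$ and all $t>0$ the operator $L_\star(f)e^{-t\mathcal D_\bullet^2}$ is of trace class, and its trace norm satisfies $$\big\|L_\star(f)\,e^{-t\mathcal D_\bullet^2}\big\|_1\le C(f)\,\max\big(t^{-d/2},t^{d/2}\big).$$ -/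

import Mathlib

open MeasureTheory SchwartzMap
open scoped ENNReal InnerProductSpace LineDeriv

noncomputable section

namespace MoyalOscillator

/-! ### Generalities on operators in a complex Hilbert space -/

section Hilbert

variable {H : Type*} [NormedAddCommGroup H] [InnerProductSpace ℂ H] [CompleteSpace H]

/-- The trace norm `‖T‖₁ = Tr |T|`, with values in `[0, ∞]`, where `|T| = (T* T)^{1/2}`. The trace of
the positive operator `|T|` is `∑ᵢ ⟨eᵢ, |T| eᵢ⟩` in any orthonormal basis `(eᵢ)`; the value does not
depend on the basis, and the supremum is taken over all of them. `T` is of trace class if and only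
if this number is finite. -/
def traceNorm (T : H →L[ℂ] H) : ℝ≥0∞ :=
  ⨆ (w : Set H) (e : HilbertBasis w ℂ H),
    ∑' i, ENNReal.ofReal (RCLike.re ⟪e i, CFC.abs T (e i)⟫_ℂ)

/-- `R = (1 + D²)⁻¹` for an unbounded operator `D`: one has `R x = y` if and only if `y` lies in the
domain of `D² = D ∘ D` and `D² y + y = x`. -/
def IsResolventSq (D : H →ₗ.[ℂ] H) (R : H →L[ℂ] H) : Prop :=
  ∀ x y : H, R x = y ↔
    ∃ (hy : y ∈ D.domain) (hDy : D ⟨y, hy⟩ ∈ D.domain), D ⟨D ⟨y, hy⟩, hDy⟩ + y = x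

theorem inner_symm_of_isSelfAdjoint {D : H →ₗ.[ℂ] H} (hD : IsSelfAdjoint D) (x y : D.domain) :
    ⟪D x, (y : H)⟫_ℂ = ⟪(x : H), D y⟫_ℂ := by
  have h := LinearPMap.adjoint_isFormalAdjoint (T := D) hD.dense_domain
  rw [LinearPMap.isSelfAdjoint_def.1 hD] at h
  exact h x y

theorem norm_sq_shift {D : H →ₗ.[ℂ] H} (hD : IsSelfAdjoint D) (c : ℝ) (x : D.domain) :
    ‖D x + (Complex.I * c) • (x : H)‖ ^ 2 = ‖D x‖ ^ 2 + c ^ 2 * ‖(x : H)‖ ^ 2 := by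
  have h1 : (⟪D x, (x : H)⟫_ℂ).im = 0 := by
    have h2 := inner_conj_symm (𝕜 := ℂ) (D x) (x : H)
    rw [← inner_symm_of_isSelfAdjoint hD] at h2
    exact Complex.conj_eq_iff_im.1 h2
  rw [@norm_add_sq ℂ, inner_smul_right, norm_smul, mul_pow]
  simp [h1]

theorem surj_shift {D : H →ₗ.[ℂ] H} (hD : IsSelfAdjoint D) (c : ℝ) (hc : c ^ 2 = 1) (z : H) :
    ∃ x : D.domain, D x + (Complex.I * c) • (x : H) = z := by
  let S : D.domain →ₗ[ℂ] H := D.toFun + (Complex.I * c) • D.domain.subtype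
  have hS : ∀ x, S x = D x + (Complex.I * c) • (x : H) := fun x => rfl
  have hnorm : ∀ x, ‖S x‖ ^ 2 = ‖D x‖ ^ 2 + ‖(x : H)‖ ^ 2 := fun x => by
    rw [hS, norm_sq_shift hD, hc, one_mul]
  have hle : ∀ x : D.domain, ‖x‖ ≤ ‖S x‖ := fun x => by
    have h := hnorm x
    refine le_of_sq_le_sq ?_ (norm_nonneg _)
    rw [h, Submodule.coe_norm]
    nlinarith [sq_nonneg ‖D x‖]
  have hclosed : IsClosed (LinearMap.range S : Set H) := by
    refine isClosed_of_closure_subset fun w hw => ?_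
    obtain ⟨u, hu, hlim⟩ := mem_closure_iff_seq_limit.1 hw
    choose v hv using hu
    have hcau : CauchySeq (fun n => (v n : H)) := by
      have h1 : CauchySeq (fun n => S (v n)) := by
        simp only [hv]; exact hlim.cauchySeq
      rw [Metric.cauchySeq_iff'] at h1 ⊢
      intro ε hε
      obtain ⟨N, hN⟩ := h1 ε hε
      refine ⟨N, fun n hn => lt_of_le_of_lt ?_ (hN n hn)⟩
      rw [dist_eq_norm, dist_eq_norm, ← map_sub]
      exact hle (v n - v N)
    obtain ⟨a, ha⟩ := cauchySeq_tendsto_of_complete hcau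
    have hDv : Filter.Tendsto (fun n => D (v n)) Filter.atTop (nhds (w - (Complex.I * c) • a)) := by
      have : (fun n => D (v n)) = fun n => u n - (Complex.I * c) • (v n : H) := by
        funext n; rw [← hv n, hS]; simp
      rw [this]
      exact hlim.sub (ha.const_smul _)
    have hg : (a, w - (Complex.I * c) • a) ∈ D.graph :=
      hD.isClosed.mem_of_tendsto (ha.prodMk_nhds hDv)
        (Filter.Eventually.of_forall fun n => D.mem_graph (v n))
    obtain ⟨b, hb1, hb2⟩ := (LinearPMap.mem_graph_iff D).1 hg
    refine ⟨b, ?_⟩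
    rw [hS, hb2]
    simp only at hb1 ⊢
    rw [hb1]; simp
  have hperp : (LinearMap.range S)ᗮ = ⊥ := by
    rw [Submodule.eq_bot_iff]
    intro y hy
    have hy' : ∀ x : D.domain, ⟪y, S x⟫_ℂ = 0 := fun x =>
      (Submodule.mem_orthogonal' _ _).1 hy _ ⟨x, rfl⟩
    have hmem : y ∈ D.domain := by
      have : y ∈ (LinearPMap.adjoint D).domain := by
        refine LinearPMap.mem_adjoint_domain_of_exists _
          ⟨(Complex.I * c) • y, fun x => ?_⟩
        have := hy' x
        rw [hS, inner_add_right, inner_smul_right] at this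
        rw [inner_smul_left]
        simp only [map_mul, Complex.conj_I, Complex.conj_ofReal]
        linear_combination -this
      rwa [LinearPMap.isSelfAdjoint_def.1 hD] at this
    have h0 := hy' ⟨y, hmem⟩
    have h1 : (⟪y, D ⟨y, hmem⟩⟫_ℂ).im = 0 := by
      have h2 := inner_conj_symm (𝕜 := ℂ) y (D ⟨y, hmem⟩)
      have h3 := inner_symm_of_isSelfAdjoint hD ⟨y, hmem⟩ ⟨y, hmem⟩
      simp only at h3
      rw [h3] at h2
      exact Complex.conj_eq_iff_im.1 h2
    rw [hS, inner_add_right, inner_smul_right, inner_self_eq_norm_sq_to_K] at h0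
    have h4 := congrArg Complex.im h0
    simp only [Complex.add_im, h1] at h4
    have h5 : c * ‖y‖ ^ 2 = 0 := by
      have : ((Complex.I * (c : ℂ)) * ((‖y‖ : ℂ)) ^ 2).im = c * ‖y‖ ^ 2 := by
        rw [mul_assoc, Complex.I_mul_im]; norm_cast
      rw [← this]; simpa using h4
    have hc0 : c ≠ 0 := by rintro rfl; norm_num at hc
    simpa [hc0] using h5
  have htop : LinearMap.range S = ⊤ := by
    have : CompleteSpace (LinearMap.range S) := hclosed.completeSpace_coe
    exact (Submodule.orthogonal_eq_bot_iff).1 hperp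
  obtain ⟨x, hx⟩ := LinearMap.range_eq_top.1 htop z
  exact ⟨x, hx⟩

/-- The operator `(1 + D²)⁻¹` exists for every self-adjoint `D`. -/
theorem exists_isResolventSq {D : H →ₗ.[ℂ] H} (hD : IsSelfAdjoint D) :
    ∃ R : H →L[ℂ] H, IsResolventSq D R := by
  let P : H → H → Prop := fun x y =>
    ∃ (hy : y ∈ D.domain) (hDy : D ⟨y, hy⟩ ∈ D.domain), D ⟨D ⟨y, hy⟩, hDy⟩ + y = x
  have hadd : ∀ (a : ℂ) (x y x' y' : H), P x y → P x' y' → P (x + a • x') (y + a • y') := by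
    rintro a x y x' y' ⟨h1, h2, h3⟩ ⟨h1', h2', h3'⟩
    have e1 : D ⟨y + a • y', D.domain.add_mem h1 (D.domain.smul_mem a h1')⟩ =
        D ⟨y, h1⟩ + a • D ⟨y', h1'⟩ := by
      rw [← LinearPMap.map_smul, ← LinearPMap.map_add]; rfl
    have m2 : D ⟨y, h1⟩ + a • D ⟨y', h1'⟩ ∈ D.domain :=
      D.domain.add_mem h2 (D.domain.smul_mem a h2')
    have e2 : D ⟨D ⟨y, h1⟩ + a • D ⟨y', h1'⟩, m2⟩ =
        D ⟨_, h2⟩ + a • D ⟨_, h2'⟩ := by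
      have h := D.map_add ⟨_, h2⟩ (a • ⟨_, h2'⟩)
      rw [LinearPMap.map_smul] at h
      exact h
    refine ⟨D.domain.add_mem h1 (D.domain.smul_mem a h1'), by rw [e1]; exact m2, ?_⟩
    simp only [e1]
    rw [e2, ← h3, ← h3', smul_add]
    abel
  have hbd : ∀ x y, P x y → ‖y‖ ≤ ‖x‖ := by
    rintro x y ⟨h1, h2, h3⟩
    have h4 : ⟪y, x⟫_ℂ = ((‖D ⟨y, h1⟩‖ ^ 2 + ‖y‖ ^ 2 : ℝ) : ℂ) := by
      rw [← h3, inner_add_right]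
      have h5 := inner_symm_of_isSelfAdjoint hD ⟨y, h1⟩ ⟨_, h2⟩
      simp only at h5
      rw [← h5, inner_self_eq_norm_sq_to_K, inner_self_eq_norm_sq_to_K]
      push_cast; rfl
    have h5 := norm_inner_le_norm (𝕜 := ℂ) y x
    rw [h4, Complex.norm_real, Real.norm_of_nonneg (by positivity)] at h5
    by_cases hy : ‖y‖ = 0
    · rw [hy]; exact norm_nonneg _
    · have : 0 < ‖y‖ := lt_of_le_of_ne (norm_nonneg _) (Ne.symm hy)
      nlinarith [sq_nonneg ‖D ⟨y, h1⟩‖]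
  have hex : ∀ x, ∃ y, P x y := by
    intro x
    obtain ⟨v, hv⟩ := surj_shift hD (-1) (by norm_num) x
    obtain ⟨u, hu⟩ := surj_shift hD 1 (by norm_num) (v : H)
    have hDu : D u = v - Complex.I • (u : H) := by
      rw [← hu]; simp
    have hm : D u ∈ D.domain := by
      rw [hDu]; exact D.domain.sub_mem v.2 (D.domain.smul_mem _ u.2)
    refine ⟨u, u.2, hm, ?_⟩
    have : (⟨D u, hm⟩ : D.domain) = v - Complex.I • u := Subtype.ext hDu
    rw [show D ⟨D ⟨(u : H), u.2⟩, hm⟩ = D (v - Complex.I • u) from congrArg D this,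
      LinearPMap.map_sub, LinearPMap.map_smul, hDu, ← hv, smul_sub, smul_smul, Complex.I_mul_I]
    simp
    abel
  have huniq : ∀ x y y', P x y → P x y' → y = y' := by
    intro x y y' h h'
    have h1 := hbd _ _ (hadd (-1) _ _ _ _ h h')
    have h2 : ‖y + (-1 : ℂ) • y'‖ ≤ 0 := by simpa using h1
    have h3 := norm_le_zero_iff.1 h2
    rw [neg_one_smul] at h3
    exact add_neg_eq_zero.1 h3
  choose r hr using hex
  have hzero : P 0 0 := ⟨D.domain.zero_mem, by
    rw [show D ⟨0, D.domain.zero_mem⟩ = 0 from D.map_zero]; exact D.domain.zero_mem, by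
    have e : (⟨D ⟨0, D.domain.zero_mem⟩, by
      rw [show D ⟨0, D.domain.zero_mem⟩ = 0 from D.map_zero]; exact D.domain.zero_mem⟩ :
        D.domain) = 0 := Subtype.ext D.map_zero
    rw [e, D.map_zero, add_zero]⟩
  let L : H →ₗ[ℂ] H :=
    { toFun := r
      map_add' := fun x x' => by
        have := hadd 1 _ _ _ _ (hr x) (hr x')
        rw [one_smul, one_smul] at this
        exact huniq _ _ _ (hr _) this
      map_smul' := fun a x => by
        have := hadd a _ _ _ _ hzero (hr x)
        rw [zero_add, zero_add] at this
        exact huniq _ _ _ (hr _) this }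
  refine ⟨L.mkContinuous 1 fun x => by rw [one_mul]; exact hbd _ _ (hr x), fun x y => ?_⟩
  constructor
  · rintro rfl; exact hr x
  · intro h; exact huniq _ _ _ (hr x) h

open scoped Classical in
/-- The bounded operator `(1 + D²)⁻¹`. It exists for every self-adjoint `D`, see
`exists_isResolventSq`; the other branch is a default value. -/
def resolventSq (D : H →ₗ.[ℂ] H) : H →L[ℂ] H :=
  if h : ∃ R : H →L[ℂ] H, IsResolventSq D R then h.choose else 0

/-- The function `r ↦ exp (-t (1/r - 1))` on `(0, ∞)`, extended by `0`. It is continuous on `ℝ` for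
`t > 0`, and maps `1 / (1 + s)` to `exp (-t s)` for `s ≥ 0`. -/
def heatFun (t r : ℝ) : ℝ := if 0 < r then Real.exp (-t * (1 / r - 1)) else 0

/-- The heat operator `exp (-t D²)`, `t > 0`, of a self-adjoint operator `D`, by functional calculus:
`exp (-t D²) = φ ((1 + D²)⁻¹)` with `φ (1 / (1 + s)) = exp (-t s)`. -/
def heat (D : H →ₗ.[ℂ] H) (t : ℝ) : H →L[ℂ] H := cfc (heatFun t) (resolventSq D)

end Hilbert

/-! ### The Hilbert space and the Dirac operators -/

/-- `ℝ^d` with its Euclidean structure. -/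
abbrev Space (d : ℕ) : Type := EuclideanSpace ℝ (Fin d)

/-- The exterior algebra of `ℂ^d` as a Hilbert space: `S = {μ₁ < ⋯ < μₖ}` labels the element
`e_{μ₁} ∧ ⋯ ∧ e_{μₖ}` of its standard orthonormal basis, so the dimension is `2^d`. -/
abbrev Fock (d : ℕ) : Type := EuclideanSpace ℂ (Finset (Fin d))

/-- `L²(ℝ^d) ⊗ Λ(ℂ^d)`, as the space of square integrable functions with values in `Λ(ℂ^d)`. -/
abbrev Hilb (d : ℕ) : Type := Lp (Fock d) 2 (volume : Measure (Space d))

/-- The fermionic creation operator `b_μ*`, that is `e_μ ∧ ·`: it maps `e_T` to `0` if `μ ∈ T`, and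
to `± e_{T ∪ {μ}}` otherwise, the sign being the parity of the number of `ν ∈ T` with `ν < μ`. -/
def bStar {d : ℕ} (μ : Fin d) : Fock d →L[ℂ] Fock d :=
  Matrix.toEuclideanCLM (𝕜 := ℂ) (Matrix.of fun S T : Finset (Fin d) =>
    if μ ∉ T ∧ S = insert μ T then (-1 : ℂ) ^ (T.filter (· < μ)).card else 0)

/-- The fermionic annihilation operator `b_μ`, the adjoint of `b_μ*`. -/
def bAnn {d : ℕ} (μ : Fin d) : Fock d →L[ℂ] Fock d := ContinuousLinearMap.adjoint (bStar μ)

/-- The operator of multiplication by `Ω x_μ` on Schwartz functions. -/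
def mulCoord {d : ℕ} (Ω : ℝ) (μ : Fin d) : 𝓢(Space d, Fock d) →L[ℂ] 𝓢(Space d, Fock d) :=
  smulLeftCLM (Fock d) (fun x : Space d => ((Ω * x μ : ℝ) : ℂ))

theorem mulCoord_apply {d : ℕ} (Ω : ℝ) (μ : Fin d) (ψ : 𝓢(Space d, Fock d)) (x : Space d) :
    mulCoord Ω μ ψ x = ((Ω * x μ : ℝ) : ℂ) • ψ x := by
  have h : (fun x : Space d => ((Ω * x μ : ℝ) : ℂ)).HasTemperateGrowth := by
    have := (Complex.ofRealCLM ∘L (Ω • EuclideanSpace.proj (𝕜 := ℝ) μ :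
      Space d →L[ℝ] ℝ)).hasTemperateGrowth
    exact this
  exact smulLeftCLM_apply_apply h ψ x

/-- The bosonic annihilation operator `a_μ = ∂_μ + Ω x_μ` on `𝓢(ℝ^d) ⊗ Λ(ℂ^d)`. -/
def aAnn {d : ℕ} (Ω : ℝ) (μ : Fin d) : 𝓢(Space d, Fock d) →L[ℂ] 𝓢(Space d, Fock d) :=
  LineDeriv.lineDerivOpCLM ℂ 𝓢(Space d, Fock d) (EuclideanSpace.single μ (1 : ℝ)) + mulCoord Ω μ

/-- The bosonic creation operator `a_μ* = -∂_μ + Ω x_μ` on `𝓢(ℝ^d) ⊗ Λ(ℂ^d)`. -/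
def aStar {d : ℕ} (Ω : ℝ) (μ : Fin d) : 𝓢(Space d, Fock d) →L[ℂ] 𝓢(Space d, Fock d) :=
  -LineDeriv.lineDerivOpCLM ℂ 𝓢(Space d, Fock d) (EuclideanSpace.single μ (1 : ℝ)) + mulCoord Ω μ

/-- The operator `1 ⊗ b` on `𝓢(ℝ^d) ⊗ Λ(ℂ^d)`. -/
def onFock {d : ℕ} (b : Fock d →L[ℂ] Fock d) : 𝓢(Space d, Fock d) →L[ℂ] 𝓢(Space d, Fock d) :=
  postcompCLM b

/-- The supercharge `Q₁ = ∑_μ a_μ ⊗ b_μ*`. -/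
def charge₁ (d : ℕ) (Ω : ℝ) : 𝓢(Space d, Fock d) →L[ℂ] 𝓢(Space d, Fock d) :=
  ∑ μ, aAnn Ω μ ∘L onFock (bStar μ)

/-- The formal adjoint `Q₁* = ∑_μ a_μ* ⊗ b_μ`. -/
def chargeStar₁ (d : ℕ) (Ω : ℝ) : 𝓢(Space d, Fock d) →L[ℂ] 𝓢(Space d, Fock d) :=
  ∑ μ, aStar Ω μ ∘L onFock (bAnn μ)

/-- The supercharge `Q₂ = ∑_μ a_μ ⊗ b_μ`. -/
def charge₂ (d : ℕ) (Ω : ℝ) : 𝓢(Space d, Fock d) →L[ℂ] 𝓢(Space d, Fock d) :=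
  ∑ μ, aAnn Ω μ ∘L onFock (bAnn μ)

/-- The formal adjoint `Q₂* = ∑_μ a_μ* ⊗ b_μ*`. -/
def chargeStar₂ (d : ℕ) (Ω : ℝ) : 𝓢(Space d, Fock d) →L[ℂ] 𝓢(Space d, Fock d) :=
  ∑ μ, aStar Ω μ ∘L onFock (bStar μ)

/-- The two Dirac operators on Schwartz functions: `Q₁ + Q₁*` and `i Q₂ - i Q₂*` (the values at `0`
and at `1`). -/
def diracSchwartz (d : ℕ) (Ω : ℝ) : Fin 2 → (𝓢(Space d, Fock d) →L[ℂ] 𝓢(Space d, Fock d)) :=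
  ![charge₁ d Ω + chargeStar₁ d Ω, Complex.I • charge₂ d Ω - Complex.I • chargeStar₂ d Ω]

/-- The embedding of the Schwartz functions into `L²(ℝ^d) ⊗ Λ(ℂ^d)`. -/
def embed (d : ℕ) : 𝓢(Space d, Fock d) →ₗ[ℂ] Hilb d :=
  (toLpCLM ℂ (Fock d) 2 (volume : Measure (Space d))).toLinearMap

theorem embed_injective (d : ℕ) : Function.Injective (embed d) :=
  injective_toLp 2 (volume : Measure (Space d))

/-- The Dirac operators as unbounded operators in `L²(ℝ^d) ⊗ Λ(ℂ^d)` with domain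
`𝓢(ℝ^d) ⊗ Λ(ℂ^d)`. -/
def diracCore (d : ℕ) (Ω : ℝ) (j : Fin 2) : Hilb d →ₗ.[ℂ] Hilb d where
  domain := LinearMap.range (embed d)
  toFun := embed d ∘ₗ (diracSchwartz d Ω j).toLinearMap ∘ₗ
    (LinearEquiv.ofInjective (embed d) (embed_injective d)).symm.toLinearMap

/-- The Dirac operators `D₁` (for `j = 0`) and `D₂` (for `j = 1`): the closures of the operators on
Schwartz functions. -/
def dirac (d : ℕ) (Ω : ℝ) (j : Fin 2) : Hilb d →ₗ.[ℂ] Hilb d := (diracCore d Ω j).closure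

/-! ### The Moyal product -/

/-- The Moyal product
`f ⋆ g (x) = (2π)^{-d} ∫ dy ∫ dk f (x + ½ Θ k) g (x + y) exp (i ⟨k, y⟩)`. -/
def moyal {d : ℕ} {F : Type*} [NormedAddCommGroup F] [NormedSpace ℂ F]
    (Θ : Matrix (Fin d) (Fin d) ℝ) (f : Space d → ℂ) (g : Space d → F) (x : Space d) : F :=
  ((2 * Real.pi : ℂ) ^ d)⁻¹ • ∫ y : Space d, ∫ k : Space d,
    (f (x + (1 / 2 : ℝ) • Matrix.toEuclideanLin Θ k) * Complex.exp (Complex.I * (⟪k, y⟫_ℝ : ℝ))) •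
      g (x + y)

/-- `T` is the bounded operator `ψ ↦ f ⋆ ψ` on `L²(ℝ^d) ⊗ Λ(ℂ^d)`. -/
def IsLeftMoyal {d : ℕ} (Θ : Matrix (Fin d) (Fin d) ℝ) (f : 𝓢(Space d, ℂ))
    (T : Hilb d →L[ℂ] Hilb d) : Prop :=
  ∀ ψ : Hilb d, T ψ =ᵐ[volume] moyal Θ f ψ

theorem moyal_eq {d : ℕ} {Θ : Matrix (Fin d) (Fin d) ℝ} (hΘ : IsUnit Θ.det) (f : 𝓢(Space d, ℂ)) :
    ∃ (G : 𝓢(Space d, ℂ)) (B : Space d →L[ℝ] Space d), ∀ (ψ : Space d → Fock d) (x : Space d),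
      moyal Θ f ψ x =
        ∫ y, (Complex.exp (-(Complex.I * (⟪B x, y⟫_ℝ : ℝ))) * G y) • ψ (x + y) := by
  have hc : (2 * Real.pi)⁻¹ ≠ 0 := by positivity
  let A₀ : Space d ≃ₗ[ℝ] Space d := LinearEquiv.ofLinearMap
    ((1 / 2 : ℝ) • Matrix.toEuclideanLin Θ) ((2 : ℝ) • Matrix.toEuclideanLin Θ⁻¹)
    (by ext x i
        simp [Matrix.toLpLin_apply, Matrix.mulVec_mulVec,
          Matrix.mul_nonsing_inv _ hΘ])
    (by ext x i
        simp [Matrix.toLpLin_apply, Matrix.mulVec_mulVec,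
          Matrix.nonsing_inv_mul _ hΘ])
  let A : Space d ≃L[ℝ] Space d := A₀.toContinuousLinearEquiv
  have hA : ∀ k, (1 / 2 : ℝ) • Matrix.toEuclideanLin Θ k = A k := fun k => rfl
  let fA : 𝓢(Space d, ℂ) := compCLMOfContinuousLinearEquiv ℂ A f
  let sc : Space d ≃L[ℝ] Space d :=
    ContinuousLinearEquiv.smulLeft (Units.mk0 ((2 * Real.pi)⁻¹ : ℝ) hc)
  let G₀ : 𝓢(Space d, ℂ) := compCLMOfContinuousLinearEquiv ℂ sc (FourierTransformInv.fourierInv fA)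
  refine ⟨((2 * Real.pi : ℂ) ^ d)⁻¹ • G₀, (A.symm : Space d →L[ℝ] Space d), fun ψ x => ?_⟩
  rw [moyal, ← integral_smul]
  congr 1
  funext y
  rw [integral_smul_const, smul_smul]
  congr 1
  have h1 : G₀ y = ∫ k : Space d, f (A k) * Complex.exp (Complex.I * (⟪k, y⟫_ℝ : ℝ)) := by
    have : G₀ y = FourierTransformInv.fourierInv (fA : Space d → ℂ) ((2 * Real.pi)⁻¹ • y) := by
      rw [← fourierInv_coe]; rfl
    rw [this, Real.fourierInv_eq']
    congr 1
    funext k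
    have e : 2 * Real.pi * ⟪k, (2 * Real.pi)⁻¹ • y⟫_ℝ = ⟪k, y⟫_ℝ := by
      rw [inner_smul_right]; field_simp
    rw [e, smul_eq_mul, mul_comm, mul_comm Complex.I]
    rfl
  have h2 : (∫ k : Space d, f (x + (1 / 2 : ℝ) • Matrix.toEuclideanLin Θ k) *
        Complex.exp (Complex.I * (⟪k, y⟫_ℝ : ℝ))) =
      Complex.exp (-(Complex.I * (⟪A.symm x, y⟫_ℝ : ℝ))) * G₀ y := by
    rw [h1, ← integral_const_mul,
      ← integral_add_right_eq_self (μ := (volume : Measure (Space d))) (fun k =>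
        Complex.exp (-(Complex.I * (⟪A.symm x, y⟫_ℝ : ℝ))) *
          (f (A k) * Complex.exp (Complex.I * (⟪k, y⟫_ℝ : ℝ)))) (A.symm x)]
    congr 1
    funext k
    rw [hA, map_add A, A.apply_symm_apply, add_comm (A k) x, inner_add_left, Complex.ofReal_add,
      mul_add, Complex.exp_add, Complex.exp_neg]
    field_simp
  rw [h2]
  change _ = Complex.exp (-(Complex.I * (⟪A.symm x, y⟫_ℝ : ℝ))) *
    (((2 * Real.pi : ℂ) ^ d)⁻¹ * G₀ y)
  ring


theorem lintegral_sq_le {α : Type*} [MeasurableSpace α] (μ : Measure α) {u v : α → ℝ≥0∞}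
    (hu : Measurable u) (hv : Measurable v) :
    (∫⁻ y, u y * v y ∂μ) ^ (2 : ℝ) ≤ (∫⁻ y, u y ∂μ) * ∫⁻ y, u y * v y ^ (2 : ℝ) ∂μ := by
  have h := ENNReal.lintegral_mul_le_Lp_mul_Lq μ (p := 2) (q := 2) Real.HolderConjugate.two_two
    (f := fun y => u y ^ (1 / 2 : ℝ)) (g := fun y => u y ^ (1 / 2 : ℝ) * v y)
    (by fun_prop) (by fun_prop)
  have e1 : ∀ z : ℝ≥0∞, (z ^ (1 / 2 : ℝ)) ^ (2 : ℝ) = z := fun z => by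
    rw [← ENNReal.rpow_mul]; norm_num
  have e2 : ∀ z : ℝ≥0∞, z ^ (1 / 2 : ℝ) * z ^ (1 / 2 : ℝ) = z := fun z => by
    rw [← ENNReal.rpow_add_of_nonneg _ _ (by norm_num) (by norm_num)]; norm_num
  simp only [Pi.mul_apply, ← mul_assoc, e2, ENNReal.mul_rpow_of_nonneg _ _ (zero_le_two (α := ℝ)),
    e1] at h
  calc _ ≤ _ := ENNReal.rpow_le_rpow h (zero_le_two (α := ℝ))
    _ = _ := by rw [ENNReal.mul_rpow_of_nonneg _ _ (zero_le_two (α := ℝ)), e1, e1]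

theorem kernel_bound {d : ℕ} (G : 𝓢(Space d, ℂ)) (B : Space d →L[ℝ] Space d)
    {ψ : Space d → Fock d} (hψ : StronglyMeasurable ψ) :
    eLpNorm (fun x => ∫ y, (Complex.exp (-(Complex.I * (⟪B x, y⟫_ℝ : ℝ))) * G y) • ψ (x + y)) 2
      (volume : Measure (Space d)) ≤ (∫⁻ y, ‖G y‖ₑ) * eLpNorm ψ 2 (volume : Measure (Space d)) := by
  have hG : Measurable fun y => ‖G y‖ₑ := by fun_prop
  have hψm : Measurable fun y => ‖ψ y‖ₑ := hψ.enorm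
  have hF : Measurable (Function.uncurry fun x y : Space d => ‖G y‖ₑ * ‖ψ (x + y)‖ₑ ^ (2 : ℝ)) :=
    (hG.comp measurable_snd).mul
      ((hψm.comp (measurable_fst.add measurable_snd)).pow_const (2 : ℝ))
  have h1 : ∀ x, ‖∫ y, (Complex.exp (-(Complex.I * (⟪B x, y⟫_ℝ : ℝ))) * G y) • ψ (x + y)‖ₑ ≤
      ∫⁻ y, ‖G y‖ₑ * ‖ψ (x + y)‖ₑ := fun x => by
    refine (enorm_integral_le_lintegral_enorm _).trans (le_of_eq ?_)
    congr 1
    funext y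
    have : ‖Complex.exp (-(Complex.I * (⟪B x, y⟫_ℝ : ℝ)))‖ₑ = 1 := by
      rw [← ofReal_norm, Complex.norm_exp]; simp
    rw [enorm_smul, enorm_mul, this, one_mul]
  rw [eLpNorm_eq_lintegral_rpow_enorm_toReal (by norm_num) (by norm_num),
    eLpNorm_eq_lintegral_rpow_enorm_toReal (by norm_num) (by norm_num)]
  simp only [ENNReal.toReal_ofNat]
  set c := ∫⁻ y, ‖G y‖ₑ
  have h2 : ∫⁻ x : Space d, (∫⁻ y : Space d, ‖G y‖ₑ * ‖ψ (x + y)‖ₑ) ^ (2 : ℝ) ≤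
      c ^ (2 : ℝ) * ∫⁻ x, ‖ψ x‖ₑ ^ (2 : ℝ) := by
    calc _ ≤ ∫⁻ x : Space d, c * ∫⁻ y : Space d, ‖G y‖ₑ * ‖ψ (x + y)‖ₑ ^ (2 : ℝ) :=
          lintegral_mono fun x => lintegral_sq_le _ hG (by fun_prop)
      _ = c * ∫⁻ x : Space d, ∫⁻ y : Space d, ‖G y‖ₑ * ‖ψ (x + y)‖ₑ ^ (2 : ℝ) :=
          lintegral_const_mul _ (Measurable.lintegral_prod_right hF)
      _ = c * ∫⁻ y : Space d, ∫⁻ x : Space d, ‖G y‖ₑ * ‖ψ (x + y)‖ₑ ^ (2 : ℝ) := by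
          rw [lintegral_lintegral_swap]
          exact hF.aemeasurable
      _ = c * ∫⁻ y : Space d, ‖G y‖ₑ * ∫⁻ x : Space d, ‖ψ x‖ₑ ^ (2 : ℝ) := by
          congr 2
          funext y
          rw [lintegral_const_mul _ (by fun_prop),
            lintegral_add_right_eq_self (fun x => ‖ψ x‖ₑ ^ (2 : ℝ)) y]
      _ = _ := by
          rw [lintegral_mul_const _ hG, ← mul_assoc, ENNReal.rpow_two, sq]
  calc _ ≤ (∫⁻ x : Space d, (∫⁻ y : Space d, ‖G y‖ₑ * ‖ψ (x + y)‖ₑ) ^ (2 : ℝ)) ^ (1 / 2 : ℝ) := by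
        gcongr with x
        exact h1 x
    _ ≤ (c ^ (2 : ℝ) * ∫⁻ x, ‖ψ x‖ₑ ^ (2 : ℝ)) ^ (1 / 2 : ℝ) := by gcongr
    _ = _ := by
        rw [ENNReal.mul_rpow_of_nonneg _ _ (by norm_num), ← ENNReal.rpow_mul]; norm_num

/-- The bounded operator `L_⋆(f)` exists for invertible `Θ`. -/
theorem exists_isLeftMoyal {d : ℕ} {Θ : Matrix (Fin d) (Fin d) ℝ} (hΘ : IsUnit Θ.det)
    (f : 𝓢(Space d, ℂ)) : ∃ T : Hilb d →L[ℂ] Hilb d, IsLeftMoyal Θ f T := by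
  obtain ⟨G, B, hGB⟩ := moyal_eq hΘ f
  let m : Space d → Space d → ℂ := fun x y => Complex.exp (-(Complex.I * (⟪B x, y⟫_ℝ : ℝ))) * G y
  have hm : Continuous (Function.uncurry m) := by
    have : Continuous fun p : Space d × Space d => G p.2 := G.continuous.comp continuous_snd
    simp only [m, Function.uncurry_def]
    fun_prop
  have hmx : ∀ x, MemLp (m x) 2 (volume : Measure (Space d)) := fun x => by
    refine (G.memLp 2 volume).of_le
      (hm.comp (by fun_prop : Continuous fun y => (x, y))).aestronglyMeasurable
      (Filter.Eventually.of_forall fun y => ?_)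
    simp [m, Complex.norm_exp]
  have hG1 : ∫⁻ y, ‖G y‖ₑ ≠ ∞ := (G.integrable (μ := volume)).2.ne
  have hmeas : ∀ ψ : Hilb d, StronglyMeasurable (moyal Θ f ψ) := fun ψ => by
    have : (moyal Θ f ψ) = fun x => ∫ y, m x y • ψ (x + y) := funext fun x => hGB ψ x
    rw [this]
    refine StronglyMeasurable.integral_prod_right ?_
    exact hm.stronglyMeasurable.smul
      ((Lp.stronglyMeasurable ψ).comp_measurable (measurable_fst.add measurable_snd))
  have hbd : ∀ ψ : Hilb d, eLpNorm (moyal Θ f ψ) 2 (volume : Measure (Space d)) ≤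
      (∫⁻ y, ‖G y‖ₑ) * eLpNorm ψ 2 (volume : Measure (Space d)) := fun ψ => by
    rw [show (moyal Θ f ψ) = _ from funext fun x => hGB ψ x]
    exact kernel_bound G B (Lp.stronglyMeasurable ψ)
  have hmem : ∀ ψ : Hilb d, MemLp (moyal Θ f ψ) 2 (volume : Measure (Space d)) := fun ψ =>
    ⟨(hmeas ψ).aestronglyMeasurable,
      (hbd ψ).trans_lt (ENNReal.mul_lt_top hG1.lt_top (Lp.memLp ψ).2)⟩
  have hshift : ∀ (ψ φ : Space d → Fock d) (x : Space d), ψ =ᵐ[volume] φ →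
      (fun y => ψ (x + y)) =ᵐ[volume] fun y => φ (x + y) := fun ψ φ x h =>
    (measurePreserving_add_left (volume : Measure (Space d)) x).quasiMeasurePreserving.ae_eq_comp h
  have hint : ∀ (ψ : Hilb d) (x : Space d), Integrable fun y => m x y • ψ (x + y) := fun ψ x => by
    have := ((Lp.memLp ψ).comp_measurePreserving
      (measurePreserving_add_left (volume : Measure (Space d)) x)).smul (r := 1) (hmx x)
    exact memLp_one_iff_integrable.1 this
  let L : Hilb d →ₗ[ℂ] Hilb d :=
    { toFun := fun ψ => (hmem ψ).toLp
      map_add' := fun ψ φ => by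
        rw [← MemLp.toLp_add]
        congr 1
        funext x
        simp only [Pi.add_apply, hGB]
        rw [← integral_add (hint ψ x) (hint φ x)]
        refine integral_congr_ae ?_
        filter_upwards [hshift _ _ x (Lp.coeFn_add ψ φ)] with y hy
        simp only [Pi.add_apply] at hy
        rw [hy, smul_add]
      map_smul' := fun a ψ => by
        rw [RingHom.id_apply, ← MemLp.toLp_const_smul]
        congr 1
        funext x
        simp only [Pi.smul_apply, hGB]
        rw [← integral_smul]
        refine integral_congr_ae ?_
        filter_upwards [hshift _ _ x (Lp.coeFn_smul a ψ)] with y hy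
        simp only [Pi.smul_apply] at hy
        rw [hy, smul_comm] }
  refine ⟨L.mkContinuous (∫⁻ y, ‖G y‖ₑ).toReal fun ψ => ?_, fun ψ => (hmem ψ).coeFn_toLp⟩
  change ‖(hmem ψ).toLp‖ ≤ _
  rw [Lp.norm_toLp, Lp.norm_def, ← ENNReal.toReal_mul]
  exact ENNReal.toReal_mono (ENNReal.mul_ne_top hG1 (Lp.memLp ψ).2.ne) (hbd ψ)

open scoped Classical in
/-- The operator `L_⋆(f)` of left Moyal multiplication `ψ ↦ f ⋆ ψ` on `L²(ℝ^d) ⊗ Λ(ℂ^d)`. It exists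
for invertible `Θ`, see `exists_isLeftMoyal`; the other branch is a default value. -/
def leftMoyal {d : ℕ} (Θ : Matrix (Fin d) (Fin d) ℝ) (f : 𝓢(Space d, ℂ)) : Hilb d →L[ℂ] Hilb d :=
  if h : ∃ T : Hilb d →L[ℂ] Hilb d, IsLeftMoyal Θ f T then h.choose else 0

end MoyalOscillator

end

noncomputable section

namespace MoyalOscillator

section Abstract

set_option linter.unusedSectionVars false

variable {H : Type*} [NormedAddCommGroup H] [InnerProductSpace ℂ H] [CompleteSpace H]

/-! ### Essential self-adjointness from a total set of eigenvectors of the square -/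

/-! Self-adjointness. The canonical commutation and anticommutation relations give D² = ∑ a*_μ a_μ +
2Ω·(fermion or hole number) on Schwartz functions (`diracSchwartz_sq`). Hence the Hermite functions
a*⋯a* exp(-Ω‖x‖²/2) e_S are eigenvectors of D² with eigenvalue 2Ω(n + number). They are total,
because polynomials times the Gaussian determine the Fourier transform of the Gaussian times a given
L² function. A symmetric operator whose square has a total set of eigenvectors is essentially
self-adjoint (`isSelfAdjoint_closure`).

Heat operator. Coherent states, that is Gaussians of the ground state width centred at a phase space
point (q, p), are joint eigenvectors of the a_μ, so their Hermite coefficients are explicit and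
exp(-tD²) acts on those with q = 0 by p ↦ exp(-2Ωt) p up to a scalar (`heat_coherent`). Comparing
matrix elements then gives a diagonal representation (`heat_eq_integral`): exp(-tD²) is a finite sum
over S of integrals of w_t(q,p) |q,p⟩⟨q,p| with a positive Gaussian weight w_t. The exponents of w_t
are proportional to exp(2Ωt) - 1, so for small t it spreads over |q|, |p| ≲ t^{-1/2}.

Trace norm. A rank-one operator |u⟩⟨v| has trace norm ‖u‖‖v‖, so ‖L(f) exp(-tD²)‖₁ is at most a
constant times ∫ w_t(q,p) ‖L(f)|q,p⟩‖ (`traceBound_comp_heat`). The whole phase space has dimension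
2d and alone would cost t^{-d}. The Schwartz function f removes d of these directions: with B =
(Θ/2)⁻¹, f ⋆ |q,p⟩ is a Fourier transform of a Schwartz function in a Gaussian window, and it decays
faster than any needed power of 1 + ‖p - Bq‖ (`exists_norm_leftMoyal_coherent_le`). The remaining
Gaussian integral over q gives t^{-d/2} for t ≤ 1. For t ≥ 1 the total mass of w_t is bounded and
boundedness of L(f) suffices, since t^{d/2} ≥ 1. -/

theorem dense_of_forall_inner_eq_zero (W : Submodule ℂ H)
    (h : ∀ y : H, (∀ w ∈ W, ⟪w, y⟫_ℂ = 0) → y = 0) : Dense (W : Set H) := by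
  rw [Submodule.dense_iff_topologicalClosure_eq_top, Submodule.topologicalClosure_eq_top_iff,
    Submodule.eq_bot_iff]
  exact fun y hy => h y fun w hw => (Submodule.mem_orthogonal _ _).1 hy w hw

/-- `V` consists of eigenvectors of `A²` with nonnegative eigenvalues. -/
def SqEigen (A : H →ₗ.[ℂ] H) (v : H) : Prop :=
  ∃ (hv : v ∈ A.domain) (hAv : A ⟨v, hv⟩ ∈ A.domain) (l : ℝ), 0 ≤ l ∧ A ⟨_, hAv⟩ = (l : ℂ) • v

/-- If A²v = l v then (A + ic)(A - ic)v = (l + 1)v, as c² = 1. Since l + 1 ≠ 0, every such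
eigenvector lies in the range of A + ic, so that range is dense. This is the vanishing of the
deficiency spaces. -/
theorem eq_zero_of_orthogonal_shift {A : H →ₗ.[ℂ] H}
    (htot : ∀ y : H, (∀ v, SqEigen A v → ⟪v, y⟫_ℂ = 0) → y = 0) (c : ℝ) (hc : c ^ 2 = 1) (y : H)
    (hy : ∀ u : A.domain, ⟪A u + (Complex.I * c) • (u : H), y⟫_ℂ = 0) : y = 0 := by
  refine htot y fun v hv => ?_
  obtain ⟨hv, hAv, l, hl, h⟩ := hv
  have h1 := hy (⟨_, hAv⟩ - (Complex.I * c) • ⟨v, hv⟩)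
  rw [LinearPMap.map_sub, LinearPMap.map_smul, h] at h1
  have h2 : (l : ℂ) • v - (Complex.I * c) • A ⟨v, hv⟩ + (Complex.I * c) •
      (((⟨_, hAv⟩ - (Complex.I * c) • ⟨v, hv⟩ : A.domain)) : H) = ((l + 1 : ℝ) : ℂ) • v := by
    have hc' : (c : ℂ) ^ 2 = 1 := by exact_mod_cast hc
    have e : (Complex.I * c) * (Complex.I * c) = -1 := by
      linear_combination (c : ℂ) ^ 2 * Complex.I_sq - hc'
    simp only [Submodule.coe_sub, Submodule.coe_smul, smul_sub, smul_smul, e]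
    push_cast
    module
  rw [h2, inner_smul_left] at h1
  refine (mul_eq_zero.1 h1).resolve_left ?_
  rw [Complex.conj_ofReal]
  exact_mod_cast (by positivity : l + 1 ≠ 0)

theorem norm_sq_add_smul_of_symm {A : H →ₗ.[ℂ] H} (hsym : A.IsFormalAdjoint A) (x : A.domain) :
    ‖A x + Complex.I • (x : H)‖ ^ 2 = ‖A x‖ ^ 2 + ‖(x : H)‖ ^ 2 := by
  have h1 : (⟪A x, (x : H)⟫_ℂ).im = 0 := by
    have h2 := inner_conj_symm (𝕜 := ℂ) (A x) (x : H)
    rw [← hsym x x] at h2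
    exact Complex.conj_eq_iff_im.1 h2
  rw [@norm_add_sq ℂ, inner_smul_right, norm_smul]
  simp [h1]

/-- A symmetric operator whose square has a total set of eigenvectors is essentially
self-adjoint. -/
theorem isSelfAdjoint_closure {A : H →ₗ.[ℂ] H} (hsym : A.IsFormalAdjoint A)
    (htot : ∀ y : H, (∀ v, SqEigen A v → ⟪v, y⟫_ℂ = 0) → y = 0) : IsSelfAdjoint A.closure := by
  have hd : Dense (A.domain : Set H) := dense_of_forall_inner_eq_zero _ fun y hy =>
    htot y fun v ⟨hv, _⟩ => hy v hv
  -- A symmetric operator is contained in its adjoint, which is closed.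
  have hcl : A.IsClosable :=
    (LinearPMap.adjoint_isClosed hd).isClosable.leIsClosable (hsym.le_adjoint hd)
  have hgr : ∀ p : H × H, p ∈ A.closure.graph ↔ p ∈ closure (A.graph : Set (H × H)) := by
    intro p
    rw [← hcl.graph_closure_eq_closure_graph]
    rfl
  have hmemA : ∀ u : A.domain, ((u : H), A u) ∈ A.graph := A.mem_graph
  have hs1 : ∀ p ∈ closure (A.graph : Set (H × H)), ∀ u : A.domain,
      ⟪p.2, (u : H)⟫_ℂ = ⟪p.1, A u⟫_ℂ := by
    intro p hp u
    have hC : IsClosed {p : H × H | ⟪p.2, (u : H)⟫_ℂ = ⟪p.1, A u⟫_ℂ} :=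
      isClosed_eq (by fun_prop) (by fun_prop)
    refine closure_minimal ?_ hC hp
    rintro ⟨a, b⟩ hab
    obtain ⟨w, h1, h2⟩ := (LinearPMap.mem_graph_iff A).1 hab
    simp only at h1 h2
    subst h1 h2
    exact (hsym w u : _)
  have hs2 : ∀ p ∈ closure (A.graph : Set (H × H)), ∀ q ∈ closure (A.graph : Set (H × H)),
      ⟪p.2, q.1⟫_ℂ = ⟪p.1, q.2⟫_ℂ := by
    intro p hp q hq
    have hC : IsClosed {q : H × H | ⟪p.2, q.1⟫_ℂ = ⟪p.1, q.2⟫_ℂ} :=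
      isClosed_eq (by fun_prop) (by fun_prop)
    refine closure_minimal ?_ hC hq
    rintro ⟨a, b⟩ hab
    obtain ⟨w, h1, h2⟩ := (LinearPMap.mem_graph_iff A).1 hab
    simp only at h1 h2
    subst h1 h2
    exact hs1 p hp w
  have hdB : Dense (A.closure.domain : Set H) := hd.mono A.le_closure.1
  have hsymB : A.closure.IsFormalAdjoint A.closure := fun x y =>
    hs2 _ ((hgr _).1 (A.closure.mem_graph x)) _ ((hgr _).1 (A.closure.mem_graph y))
  have hle : A.closure ≤ A.closure.adjoint := hsymB.le_adjoint hdB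
  rw [LinearPMap.isSelfAdjoint_def]
  refine le_antisymm (LinearPMap.le_of_le_graph ?_) hle
  rintro ⟨y, w⟩ hyw
  obtain ⟨y', rfl, rfl⟩ := (LinearPMap.mem_graph_iff _).1 hyw
  set w := A.closure.adjoint y'
  have hadj : ∀ u : A.domain, ⟪w, (u : H)⟫_ℂ = ⟪(y' : H), A u⟫_ℂ := fun u => by
    have h := LinearPMap.adjoint_isFormalAdjoint hdB y' ⟨u, A.le_closure.1 u.2⟩
    have e : A.closure ⟨u, A.le_closure.1 u.2⟩ = A u := (A.le_closure.2 rfl).symm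
    rw [e] at h
    exact h
  -- To put y' in the domain of the closure, (closure of A + i) a = w + i y' is solved by
  -- approximation: the range of A + i is dense, and ‖(A + i)x‖² = ‖Ax‖² + ‖x‖² makes the
  -- approximate solutions Cauchy.
  let W : Submodule ℂ H := LinearMap.range (A.toFun + Complex.I • A.domain.subtype)
  have hW : Dense (W : Set H) := dense_of_forall_inner_eq_zero _ fun z hz =>
    eq_zero_of_orthogonal_shift htot 1 (by norm_num) z fun u =>
      hz _ ⟨u, by simp [LinearPMap.toFun_eq_coe]⟩
  obtain ⟨s, hsW, hs⟩ := mem_closure_iff_seq_limit.1 (hW (w + Complex.I • (y' : H)))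
  choose x hx using hsW
  have hx' : ∀ n, A (x n) + Complex.I • (x n : H) = s n := hx
  have hcau : CauchySeq fun n => (x n : H) := by
    have h1 := hs.cauchySeq
    rw [Metric.cauchySeq_iff'] at h1 ⊢
    intro ε hε
    obtain ⟨N, hN⟩ := h1 ε hε
    refine ⟨N, fun n hn => lt_of_le_of_lt ?_ (hN n hn)⟩
    rw [dist_eq_norm, dist_eq_norm]
    have h2 := norm_sq_add_smul_of_symm hsym (x n - x N)
    have h3 : A (x n - x N) + Complex.I • ((x n - x N : A.domain) : H) = s n - s N := by
      rw [LinearPMap.map_sub, ← hx', ← hx', Submodule.coe_sub, smul_sub]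
      abel
    rw [h3, Submodule.coe_sub] at h2
    exact le_of_sq_le_sq (by nlinarith [sq_nonneg ‖A (x n - x N)‖]) (norm_nonneg _)
  obtain ⟨a, ha⟩ := cauchySeq_tendsto_of_complete hcau
  have hA : Filter.Tendsto (fun n => A (x n)) Filter.atTop
      (nhds (w + Complex.I • (y' : H) - Complex.I • a)) := by
    have : (fun n => A (x n)) = fun n => s n - Complex.I • (x n : H) := by
      funext n; rw [← hx' n]; simp
    rw [this]
    exact hs.sub (ha.const_smul _)
  have hmem : (a, w + Complex.I • (y' : H) - Complex.I • a) ∈ closure (A.graph : Set (H × H)) :=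
    mem_closure_of_tendsto (ha.prodMk_nhds hA) (Filter.Eventually.of_forall fun n => hmemA (x n))
  -- The difference y' - a is orthogonal to the range of A - i, which is dense as well; so y' is the
  -- solution a itself.
  have hya : (y' : H) - a = 0 := by
    refine eq_zero_of_orthogonal_shift htot (-1) (by norm_num) _ fun u => ?_
    have h1 := hadj u
    have h2 := hs1 _ hmem u
    simp only [inner_add_left, inner_sub_left, inner_smul_left, Complex.conj_I] at h2
    have h3 : ⟪(y' : H) - a, A u + (Complex.I * ((-1 : ℝ) : ℂ)) • (u : H)⟫_ℂ = 0 := by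
      simp only [inner_add_right, inner_sub_left, inner_smul_right, Complex.ofReal_neg,
        Complex.ofReal_one]
      linear_combination -h1 + h2
    rw [← inner_conj_symm, h3, map_zero]
  have hya' : a = (y' : H) := (sub_eq_zero.1 hya).symm
  rw [hya', add_sub_cancel_right] at hmem
  exact (hgr _).2 hmem

/-! ### The heat operator on eigenvectors -/

theorem aeval_apply_eigen (a : H →L[ℂ] H) {v : H} {r : ℝ} (hv : a v = (r : ℂ) • v)
    (p : Polynomial ℝ) : (Polynomial.aeval a p) v = ((p.eval r : ℝ) : ℂ) • v := by
  induction p using Polynomial.induction_on' with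
  | add p q hp hq =>
    rw [map_add, _root_.add_apply, hp, hq, Polynomial.eval_add, Complex.ofReal_add,
      add_smul]
  | monomial n c =>
    have hpow : ∀ n : ℕ, (a ^ n) v = ((r ^ n : ℝ) : ℂ) • v := fun n => by
      induction n with
      | zero => simp
      | succ n ih =>
        rw [pow_succ', mul_apply_eq_comp, ih, map_smul, hv, smul_smul]
        push_cast
        rw [pow_succ]
    rw [Polynomial.aeval_monomial, mul_apply_eq_comp, hpow, Polynomial.eval_monomial,
      map_smul, Algebra.algebraMap_eq_smul_one]
    simp only [_root_.smul_apply, one_apply_eq_self]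
    rw [← Complex.coe_smul, smul_smul]
    push_cast
    rw [mul_comm]

/-- For polynomials this is algebra. In general f is approximated uniformly by polynomials
(Weierstrass), and the functional calculus is contractive for the sup norm on the spectrum. -/
theorem cfc_apply_eigen {a : H →L[ℂ] H} (ha : IsSelfAdjoint a) {f : ℝ → ℝ} (hf : Continuous f)
    {v : H} {r : ℝ} (hv : a v = (r : ℂ) • v) : cfc f a v = ((f r : ℝ) : ℂ) • v := by
  -- The interval must contain both the spectrum and r; taking r into the maximum also covers v = 0,
  -- where r need not be spectral.
  set M : ℝ := max ‖a‖ |r|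
  have hsp : ∀ x ∈ spectrum ℝ a, x ∈ Set.Icc (-M) M := fun x hx => by
    have h := spectrum.norm_le_norm_mul_of_mem hx
    have h1 : ‖(1 : H →L[ℂ] H)‖ ≤ 1 := ContinuousLinearMap.norm_id_le
    have h2 : |x| ≤ M := by
      refine le_trans ?_ (le_max_left _ _)
      calc |x| = ‖x‖ := rfl
        _ ≤ _ := h
        _ ≤ ‖a‖ * 1 := by gcongr
        _ = _ := mul_one _
    exact abs_le.1 h2
  have hr : r ∈ Set.Icc (-M) M := abs_le.1 (le_max_right _ _)
  refine eq_of_sub_eq_zero (norm_le_zero_iff.1 (le_of_forall_pos_le_add fun ε hε => ?_))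
  obtain ⟨p, hp⟩ := exists_polynomial_near_of_continuousOn (-M) M f hf.continuousOn
    (ε / (2 * (‖v‖ + 1))) (by positivity)
  have h1 : ‖cfc f a - Polynomial.aeval a p‖ ≤ ε / (2 * (‖v‖ + 1)) := by
    rw [← cfc_polynomial p a, ← cfc_sub f (fun x => p.eval x) a hf.continuousOn
      p.continuous.continuousOn]
    refine norm_cfc_le (by positivity) fun x hx => ?_
    rw [Real.norm_eq_abs, abs_sub_comm]
    exact (hp x (hsp x hx)).le
  have h2 : cfc f a v - ((f r : ℝ) : ℂ) • v =
      (cfc f a - Polynomial.aeval a p) v + ((p.eval r - f r : ℝ) : ℂ) • v := by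
    rw [_root_.sub_apply, aeval_apply_eigen a hv]
    push_cast
    module
  have h3 : ‖((p.eval r - f r : ℝ) : ℂ)‖ ≤ ε / (2 * (‖v‖ + 1)) := by
    rw [Complex.norm_real]
    exact (hp r hr).le
  rw [h2, zero_add]
  calc _ ≤ ‖(cfc f a - Polynomial.aeval a p) v‖ + ‖((p.eval r - f r : ℝ) : ℂ) • v‖ :=
        norm_add_le _ _
    _ ≤ ε / (2 * (‖v‖ + 1)) * ‖v‖ + ε / (2 * (‖v‖ + 1)) * ‖v‖ := by
        refine add_le_add ((ContinuousLinearMap.le_opNorm _ _).trans (by gcongr)) ?_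
        rw [norm_smul]
        gcongr
    _ ≤ ε := by
        have hv0 := norm_nonneg v
        have e : ε / (2 * (‖v‖ + 1)) * ‖v‖ + ε / (2 * (‖v‖ + 1)) * ‖v‖ = ε * (‖v‖ / (‖v‖ + 1)) := by
          field_simp
          ring
        rw [e]
        exact mul_le_of_le_one_right hε.le ((div_le_one (by positivity)).2 (by linarith))

/-- On r > 0 the function is exp(t) · exp(-t/r), a rescaling of the standard smooth function
exp(-1/s) extended by 0. Continuity matters because `cfc` has a default value for discontinuous
functions. -/
theorem continuous_heatFun {t : ℝ} (ht : 0 < t) : Continuous (heatFun t) := by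
  have : heatFun t = fun r => Real.exp t * expNegInvGlue (r / t) := by
    funext r
    unfold heatFun expNegInvGlue
    by_cases hr : 0 < r
    · have h : ¬ r / t ≤ 0 := not_le.2 (by positivity)
      rw [if_pos hr, if_neg h, ← Real.exp_add]
      congr 1
      field_simp
      ring
    · have h : r / t ≤ 0 := div_nonpos_of_nonpos_of_nonneg (not_lt.1 hr) ht.le
      rw [if_neg hr, if_pos h, mul_zero]
  rw [this]
  have h := expNegInvGlue.contDiff (n := 0)
  exact continuous_const.mul (h.continuous.comp (continuous_id.div_const t))

theorem isResolventSq_resolventSq {D : H →ₗ.[ℂ] H} (hD : IsSelfAdjoint D) :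
    IsResolventSq D (resolventSq D) := by
  unfold resolventSq
  rw [dif_pos (exists_isResolventSq hD)]
  exact (exists_isResolventSq hD).choose_spec

theorem isSelfAdjoint_resolventSq {D : H →ₗ.[ℂ] H} (hD : IsSelfAdjoint D) :
    IsSelfAdjoint (resolventSq D) := by
  rw [ContinuousLinearMap.isSelfAdjoint_iff_isSymmetric]
  intro x x'
  obtain ⟨h1, h2, h3⟩ := (isResolventSq_resolventSq hD x _).1 rfl
  obtain ⟨h1', h2', h3'⟩ := (isResolventSq_resolventSq hD x' _).1 rfl
  change ⟪resolventSq D x, x'⟫_ℂ = ⟪x, resolventSq D x'⟫_ℂ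
  have e1 := inner_symm_of_isSelfAdjoint hD ⟨_, h2⟩ ⟨_, h1'⟩
  have e2 := inner_symm_of_isSelfAdjoint hD ⟨_, h1⟩ ⟨_, h2'⟩
  simp only at e1 e2
  conv_lhs => rw [← h3']
  conv_rhs => rw [← h3]
  rw [inner_add_left, inner_add_right, e1, ← e2]

/-- An eigenvector of D² with eigenvalue l is one of (1 + D²)⁻¹ with eigenvalue 1/(1 + l), which
`heatFun t` sends to exp(-tl). -/
theorem heat_apply_eigen {D : H →ₗ.[ℂ] H} (hD : IsSelfAdjoint D) {t : ℝ} (ht : 0 < t) {v : H}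
    {l : ℝ} (hl : 0 ≤ l) (h1 : v ∈ D.domain) (h2 : D ⟨v, h1⟩ ∈ D.domain)
    (h3 : D ⟨_, h2⟩ = (l : ℂ) • v) : heat D t v = ((Real.exp (-t * l) : ℝ) : ℂ) • v := by
  have hl1 : (0 : ℝ) < 1 + l := by positivity
  have hl2 : ((1 + l : ℝ) : ℂ) ≠ 0 := by exact_mod_cast hl1.ne'
  have hR : resolventSq D v = (((1 + l)⁻¹ : ℝ) : ℂ) • v := by
    have h := (isResolventSq_resolventSq hD (((1 + l : ℝ) : ℂ) • v) v).2
      ⟨h1, h2, by rw [h3]; push_cast; module⟩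
    rw [map_smul] at h
    rw [← h, smul_smul, h, Complex.ofReal_inv, inv_mul_cancel₀ hl2, one_smul] 
  have h := cfc_apply_eigen (isSelfAdjoint_resolventSq hD) (continuous_heatFun ht) hR
  unfold heat
  rw [h]
  congr 2
  rw [heatFun, if_pos (by positivity)]
  congr 1
  simp

/-! ### Trace norm estimates -/

/-- `|Tr (K T)| ≤ B` for all contractions `K`, the trace being computed on finite parts of
orthonormal bases. -/
def TraceBound (T : H →L[ℂ] H) (B : ℝ) : Prop :=
  ∀ K : H →L[ℂ] H, ‖K‖ ≤ 1 → ∀ (w : Set H) (e : HilbertBasis w ℂ H) (s : Finset w),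
    ‖∑ i ∈ s, ⟪e i, K (T (e i))⟫_ℂ‖ ≤ B

theorem TraceBound.sum {ι : Type*} (s : Finset ι) {T : ι → H →L[ℂ] H} {B : ι → ℝ}
    (h : ∀ i ∈ s, TraceBound (T i) (B i)) : TraceBound (∑ i ∈ s, T i) (∑ i ∈ s, B i) := by
  intro K hK w e u
  have : ∑ i ∈ u, ⟪e i, K ((∑ j ∈ s, T j) (e i))⟫_ℂ =
      ∑ j ∈ s, ∑ i ∈ u, ⟪e i, K (T j (e i))⟫_ℂ := by
    rw [Finset.sum_comm]
    refine Finset.sum_congr rfl fun i _ => ?_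
    rw [← inner_sum, ← map_sum, _root_.sum_apply]
  rw [this]
  exact (norm_sum_le _ _).trans (Finset.sum_le_sum fun j hj => h j hj K hK w e u)

theorem TraceBound.mono {T : H →L[ℂ] H} {B B' : ℝ} (h : TraceBound T B) (hB : B ≤ B') :
    TraceBound T B' := fun K hK w e u => (h K hK w e u).trans hB

/-- A substitute for the polar decomposition |T| = U*T: with a = T*T, take K = (a + ε)^{-1/2} T*.
Then KK* = a/(a + ε) ≤ 1, and |T| - KT is the function √x - x/√(x + ε) of a, which lies between 0
and √ε. -/
theorem exists_contraction_near_abs (T : H →L[ℂ] H) {ε : ℝ} (hε : 0 < ε) :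
    ∃ K : H →L[ℂ] H, ‖K‖ ≤ 1 ∧ ‖CFC.abs T - K * T‖ ≤ Real.sqrt ε := by
  set a : H →L[ℂ] H := star T * T with ha_def
  have ha : 0 ≤ a := star_mul_self_nonneg T
  have hsa : IsSelfAdjoint a := ha.isSelfAdjoint
  have hsp : ∀ x ∈ spectrum ℝ a, 0 ≤ x := fun x hx => spectrum_nonneg_of_nonneg ha hx
  -- The absolute value only serves to make g continuous on all of ℝ; the spectrum of a is
  -- nonnegative.
  let g : ℝ → ℝ := fun x => (Real.sqrt (|x| + ε))⁻¹
  have hpos : ∀ x : ℝ, 0 < Real.sqrt (|x| + ε) := fun x => Real.sqrt_pos.2 (by positivity)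
  have hg : Continuous g := Continuous.inv₀ (by fun_prop) fun x => (hpos x).ne'
  have hgs : IsSelfAdjoint (cfc g a) := cfc_predicate g a
  refine ⟨cfc g a * star T, ?_, ?_⟩
  · have h1 : (cfc g a * star T) * star (cfc g a * star T) = cfc (fun x => g x * x * g x) a := by
      rw [star_mul, star_star, hgs.star_eq, cfc_mul (fun x => g x * x) g a (by fun_prop)
        hg.continuousOn, cfc_mul g (fun x => x) a hg.continuousOn (by fun_prop), cfc_id' ℝ a]
      simp only [mul_assoc, ha_def]
    have h2 : ‖(cfc g a * star T) * star (cfc g a * star T)‖ ≤ 1 := by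
      rw [h1]
      refine norm_cfc_le zero_le_one fun x hx => ?_
      have hx0 := hsp x hx
      have e : g x * x * g x = x / (x + ε) := by
        simp only [g, abs_of_nonneg hx0]
        rw [mul_comm _ x, mul_assoc, ← mul_inv, Real.mul_self_sqrt (by positivity)]
        rfl
      rw [e, Real.norm_of_nonneg (by positivity)]
      exact div_le_one_of_le₀ (by linarith) (by positivity)
    rw [CStarRing.norm_self_mul_star] at h2
    nlinarith [norm_nonneg (cfc g a * star T)]
  · have h1 : cfc g a * star T * T = cfc (fun x => g x * x) a := by
      rw [cfc_mul g (fun x => x) a hg.continuousOn (by fun_prop), cfc_id' ℝ a, mul_assoc]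
    have h2 : CFC.abs T = cfc Real.sqrt a := by
      rw [CFC.abs, CFC.sqrt_eq_real_sqrt _ ha, cfcₙ_eq_cfc]
    rw [h1, h2, ← cfc_sub _ _ a (by fun_prop) (by fun_prop)]
    refine norm_cfc_le (Real.sqrt_nonneg _) fun x hx => ?_
    have hx0 := hsp x hx
    simp only [g, abs_of_nonneg hx0]
    set r := Real.sqrt (x + ε)
    have hr : 0 < r := Real.sqrt_pos.2 (by positivity)
    have hr2 : r ^ 2 = x + ε := Real.sq_sqrt (by positivity)
    have hs2 : Real.sqrt x ^ 2 = x := Real.sq_sqrt hx0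
    have hs0 := Real.sqrt_nonneg x
    have he2 : Real.sqrt ε ^ 2 = ε := Real.sq_sqrt hε.le
    have he0 := Real.sqrt_nonneg ε
    have hsr : Real.sqrt x ≤ r := Real.sqrt_le_sqrt (by linarith)
    have her : Real.sqrt ε ≤ r := Real.sqrt_le_sqrt (by linarith)
    rw [Real.norm_eq_abs, abs_le]
    have e : Real.sqrt x - r⁻¹ * x = (Real.sqrt x * (r - Real.sqrt x)) / r := by
      field_simp
      linear_combination hs2
    rw [e]
    constructor
    · exact (neg_nonpos.2 he0).trans (div_nonneg (mul_nonneg hs0 (by linarith)) hr.le)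
    · rw [div_le_iff₀ hr]
      nlinarith

/-- On a finite part of a basis |T| may be replaced by KT with a contraction K, at a cost of ε per
basis vector; ε is chosen after the finite set. Unlike the trace norm, `TraceBound` is visibly
subadditive and compatible with integrals. -/
theorem TraceBound.traceNorm_le {T : H →L[ℂ] H} {B : ℝ} (h : TraceBound T B) :
    traceNorm T ≤ ENNReal.ofReal B := by
  refine iSup_le fun w => iSup_le fun e => ?_
  rw [ENNReal.tsum_eq_iSup_sum]
  refine iSup_le fun s => ?_
  have hpos : ∀ x : H, 0 ≤ RCLike.re ⟪x, CFC.abs T x⟫_ℂ := fun x =>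
    ((ContinuousLinearMap.nonneg_iff_isPositive _).1 (CFC.abs_nonneg T)).re_inner_nonneg_right x
  rw [← ENNReal.ofReal_sum_of_nonneg fun i _ => hpos _]
  refine ENNReal.ofReal_le_ofReal ?_
  have key : ∀ ε : ℝ, 0 < ε →
      ∑ i ∈ s, RCLike.re ⟪e i, CFC.abs T (e i)⟫_ℂ ≤ B + s.card * ε := fun ε hε => by
    obtain ⟨K, hK, hKT⟩ := exists_contraction_near_abs T (ε := ε ^ 2) (by positivity)
    rw [Real.sqrt_sq hε.le] at hKT
    have h1 : ∀ i, RCLike.re ⟪e i, CFC.abs T (e i)⟫_ℂ ≤ RCLike.re ⟪e i, K (T (e i))⟫_ℂ + ε := by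
      intro i
      have h2 : CFC.abs T (e i) = K (T (e i)) + (CFC.abs T - K * T) (e i) := by
        simp
      have hn : ‖e i‖ = 1 := e.orthonormal.1 i
      rw [h2, inner_add_right, map_add]
      gcongr
      refine (RCLike.re_le_norm _).trans ((norm_inner_le_norm _ _).trans ?_)
      rw [hn, one_mul]
      refine (ContinuousLinearMap.le_opNorm _ _).trans ?_
      rw [hn, mul_one]
      exact hKT
    refine (Finset.sum_le_sum fun i _ => h1 i).trans ?_
    rw [Finset.sum_add_distrib, Finset.sum_const, nsmul_eq_mul, ← map_sum]
    gcongr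
    exact (RCLike.re_le_norm _).trans (h K hK w e s)
  refine le_of_forall_pos_le_add fun ε hε => (key (ε / (s.card + 1)) (by positivity)).trans ?_
  gcongr
  rw [mul_div_assoc', div_le_iff₀ (by positivity)]
  nlinarith

/-- Cauchy–Schwarz and Bessel. This is the trace bound for a rank-one operator, uniform in the
finite set. -/
theorem norm_sum_inner_mul_inner_le {ι : Type*} {e : ι → H} (he : Orthonormal ℂ e) (s : Finset ι)
    (x y : H) : ‖∑ i ∈ s, ⟪y, e i⟫_ℂ * ⟪e i, x⟫_ℂ‖ ≤ ‖x‖ * ‖y‖ := by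
  have hx := he.sum_inner_products_le (s := s) x
  have hy := he.sum_inner_products_le (s := s) y
  refine (norm_sum_le _ _).trans ?_
  refine le_of_sq_le_sq ?_ (by positivity)
  calc (∑ i ∈ s, ‖⟪y, e i⟫_ℂ * ⟪e i, x⟫_ℂ‖) ^ 2
      = (∑ i ∈ s, ‖⟪e i, x⟫_ℂ‖ * ‖⟪e i, y⟫_ℂ‖) ^ 2 := by
        congr 1
        refine Finset.sum_congr rfl fun i _ => ?_
        rw [norm_mul, mul_comm, norm_inner_symm y]
    _ ≤ (∑ i ∈ s, ‖⟪e i, x⟫_ℂ‖ ^ 2) * ∑ i ∈ s, ‖⟪e i, y⟫_ℂ‖ ^ 2 :=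
        Finset.sum_mul_sq_le_sq_mul_sq _ _ _
    _ ≤ ‖x‖ ^ 2 * ‖y‖ ^ 2 := by gcongr
    _ = _ := by ring

/-! ### Integrals of rank-one operators -/

theorem inner_integral_rankOne {Z : Type*} [MeasurableSpace Z] {μ : Measure Z} {u v : Z → H}
    (hint : Integrable (fun z => InnerProductSpace.rankOne ℂ (u z) (v z)) μ) (K : H →L[ℂ] H)
    (x y : H) :
    Integrable (fun z => ⟪v z, x⟫_ℂ * ⟪y, K (u z)⟫_ℂ) μ ∧
    ⟪y, K ((∫ z, InnerProductSpace.rankOne ℂ (u z) (v z) ∂μ) x)⟫_ℂ =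
      ∫ z, ⟪v z, x⟫_ℂ * ⟪y, K (u z)⟫_ℂ ∂μ := by
  let Λ : (H →L[ℂ] H) →L[ℂ] ℂ := (innerSL ℂ y) ∘L K ∘L (ContinuousLinearMap.apply ℂ H x)
  have hΛ : ∀ z, Λ (InnerProductSpace.rankOne ℂ (u z) (v z)) = ⟪v z, x⟫_ℂ * ⟪y, K (u z)⟫_ℂ :=
    fun z => by simp [Λ]
  have h1 := Λ.integral_comp_comm hint
  have h2 := Λ.integrable_comp hint
  simp only [hΛ] at h1 h2
  exact ⟨h2, h1.symm⟩

/-- The integral converges in operator norm, so matrix elements pass under it; the finite sum over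
the basis is then estimated pointwise in z by the rank-one bound. -/
theorem traceBound_comp_integral {Z : Type*} [MeasurableSpace Z] {μ : Measure Z} {u v : Z → H}
    (hint : Integrable (fun z => InnerProductSpace.rankOne ℂ (u z) (v z)) μ) (T : H →L[ℂ] H)
    {g : Z → ℝ} (hg : Integrable g μ) (hgT : ∀ z, ‖T (u z)‖ * ‖v z‖ ≤ g z) :
    TraceBound (T ∘L ∫ z, InnerProductSpace.rankOne ℂ (u z) (v z) ∂μ) (∫ z, g z ∂μ) := by
  intro K hK w e s
  have h1 := fun i => inner_integral_rankOne hint (K ∘L T) (e i) (e i)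
  simp only [ContinuousLinearMap.comp_apply] at h1 ⊢
  rw [Finset.sum_congr rfl fun i _ => (h1 i).2, ← integral_finsetSum _ fun i _ => (h1 i).1]
  refine norm_integral_le_of_norm_le hg (Filter.Eventually.of_forall fun z => ?_)
  refine (norm_sum_inner_mul_inner_le e.orthonormal s _ _).trans (le_trans ?_ (hgT z))
  gcongr
  exact (K.le_opNorm _).trans (mul_le_of_le_one_left (norm_nonneg _) hK)

end Abstract

/-! ### The canonical anticommutation relations -/

/-- The sign of the Jordan–Wigner string. -/
def jwSign {d : ℕ} (μ : Fin d) (S : Finset (Fin d)) : ℂ := (-1) ^ (S.filter (· < μ)).card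

theorem jwSign_mul_self {d : ℕ} (μ : Fin d) (S : Finset (Fin d)) :
    jwSign μ S * jwSign μ S = 1 := by
  rw [jwSign, ← mul_pow]; simp

theorem jwSign_insert_of_le {d : ℕ} {μ ν : Fin d} (S : Finset (Fin d)) (h : μ ≤ ν) :
    jwSign μ (insert ν S) = jwSign μ S := by
  rw [jwSign, Finset.filter_insert, if_neg (not_lt.2 h), jwSign]

theorem jwSign_insert_of_lt {d : ℕ} {μ ν : Fin d} {S : Finset (Fin d)} (h : ν < μ) (hν : ν ∉ S) :
    jwSign μ (insert ν S) = -jwSign μ S := by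
  rw [jwSign, Finset.filter_insert, if_pos h, Finset.card_insert_of_notMem (by simp [hν]), pow_succ,
    jwSign, mul_neg_one]

theorem jwSign_erase_of_le {d : ℕ} {μ ν : Fin d} (S : Finset (Fin d)) (h : μ ≤ ν) :
    jwSign μ (S.erase ν) = jwSign μ S := by
  by_cases hν : ν ∈ S
  · conv_rhs => rw [← Finset.insert_erase hν, jwSign_insert_of_le _ h]
  · rw [Finset.erase_eq_of_notMem hν]

theorem jwSign_erase_of_lt {d : ℕ} {μ ν : Fin d} {S : Finset (Fin d)} (h : ν < μ) (hν : ν ∈ S) :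
    jwSign μ (S.erase ν) = -jwSign μ S := by
  conv_rhs => rw [← Finset.insert_erase hν, jwSign_insert_of_lt h (Finset.notMem_erase _ _)]
  rw [neg_neg]

theorem bStar_apply {d : ℕ} (μ : Fin d) (x : Fock d) (S : Finset (Fin d)) :
    bStar μ x S = if μ ∈ S then jwSign μ S * x (S.erase μ) else 0 := by
  rw [bStar, Matrix.ofLp_toEuclideanCLM, Matrix.mulVec, dotProduct]
  simp only [Matrix.of_apply]
  split_ifs with h
  · rw [Finset.sum_eq_single (S.erase μ)]
    · rw [if_pos ⟨Finset.notMem_erase _ _, (Finset.insert_erase h).symm⟩, ← jwSign,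
        jwSign_erase_of_le _ le_rfl]
    · intro T _ hT
      rw [if_neg, zero_mul]
      rintro ⟨h1, rfl⟩
      exact hT (Finset.erase_insert h1).symm
    · simp
  · refine Finset.sum_eq_zero fun T _ => ?_
    rw [if_neg, zero_mul]
    rintro ⟨h1, rfl⟩
    exact h (Finset.mem_insert_self _ _)

theorem bAnn_apply {d : ℕ} (μ : Fin d) (x : Fock d) (S : Finset (Fin d)) :
    bAnn μ x S = if μ ∈ S then 0 else jwSign μ S * x (insert μ S) := by
  rw [bAnn, ← ContinuousLinearMap.star_eq_adjoint, bStar, ← map_star, Matrix.ofLp_toEuclideanCLM,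
    Matrix.mulVec, dotProduct]
  simp only [Matrix.star_apply, Matrix.of_apply]
  split_ifs with h
  · refine Finset.sum_eq_zero fun T _ => ?_
    rw [if_neg fun h' => h'.1 h, star_zero, zero_mul]
  · rw [Finset.sum_eq_single (insert μ S)]
    · rw [if_pos ⟨h, rfl⟩, star_pow, star_neg, star_one, ← jwSign]
    · intro T _ hT
      rw [if_neg fun h' => hT h'.2, star_zero, zero_mul]
    · simp

/-- Only the string of the larger index ν counts μ, so exactly one of the two orders picks up an
extra sign. -/
theorem bStar_bStar_aux {d : ℕ} {μ ν : Fin d} (h : μ < ν) (x : Fock d) :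
    bStar μ (bStar ν x) + bStar ν (bStar μ x) = 0 := by
  ext S
  simp only [PiLp.add_apply, bStar_apply, PiLp.zero_apply, Finset.mem_erase]
  by_cases hμ : μ ∈ S <;> by_cases hν : ν ∈ S <;>
    simp only [hμ, hν, h.ne, h.ne', ne_eq, not_false_eq_true, and_true, and_false, if_true, if_false,
      mul_zero, add_zero]
  rw [jwSign_erase_of_lt h hμ, jwSign_erase_of_le _ h.le, Finset.erase_right_comm]
  ring

theorem bStar_bStar {d : ℕ} (μ ν : Fin d) (x : Fock d) :
    bStar μ (bStar ν x) + bStar ν (bStar μ x) = 0 := by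
  rcases lt_trichotomy μ ν with h | rfl | h
  · exact bStar_bStar_aux h x
  · ext S
    simp [bStar_apply]
  · rw [add_comm]; exact bStar_bStar_aux h x

theorem bAnn_bAnn {d : ℕ} (μ ν : Fin d) (x : Fock d) :
    bAnn μ (bAnn ν x) + bAnn ν (bAnn μ x) = 0 := by
  refine ext_inner_left ℂ fun y => ?_
  rw [inner_add_right, bAnn, bAnn, ContinuousLinearMap.adjoint_inner_right,
    ContinuousLinearMap.adjoint_inner_right, ContinuousLinearMap.adjoint_inner_right,
    ContinuousLinearMap.adjoint_inner_right, ← inner_add_left, bStar_bStar, inner_zero_left,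
    inner_zero_right]

theorem bStar_bAnn_of_ne {d : ℕ} {μ ν : Fin d} (h : μ ≠ ν) (x : Fock d) :
    bStar μ (bAnn ν x) + bAnn ν (bStar μ x) = 0 := by
  ext S
  simp only [PiLp.add_apply, bStar_apply, bAnn_apply, PiLp.zero_apply, Finset.mem_erase,
    Finset.mem_insert]
  by_cases hμ : μ ∈ S <;> by_cases hν : ν ∈ S <;>
    simp only [hμ, hν, h, h.symm, ne_eq, not_false_eq_true, and_true, and_false, if_true, if_false,
      mul_zero, add_zero, or_true, or_false]
  rw [Finset.erase_insert_of_ne h.symm]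
  rcases lt_or_gt_of_ne h with h' | h'
  · rw [jwSign_erase_of_lt h' hμ, jwSign_insert_of_le _ h'.le]
    ring
  · rw [jwSign_erase_of_le _ h'.le, jwSign_insert_of_lt h' hν]
    ring

theorem bStar_bAnn_self {d : ℕ} (μ : Fin d) (x : Fock d) (S : Finset (Fin d)) :
    bStar μ (bAnn μ x) S = if μ ∈ S then x S else 0 := by
  rw [bStar_apply]
  split_ifs with h
  · rw [bAnn_apply, if_neg (Finset.notMem_erase _ _), jwSign_erase_of_le _ le_rfl, ← mul_assoc,
      jwSign_mul_self, Finset.insert_erase h, one_mul]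
  · rfl

theorem bAnn_bStar_self {d : ℕ} (μ : Fin d) (x : Fock d) (S : Finset (Fin d)) :
    bAnn μ (bStar μ x) S = if μ ∈ S then 0 else x S := by
  rw [bAnn_apply]
  split_ifs with h
  · rfl
  · rw [bStar_apply, if_pos (Finset.mem_insert_self _ _), jwSign_insert_of_le _ le_rfl, ← mul_assoc,
      jwSign_mul_self, Finset.erase_insert h, one_mul]

theorem bStar_bAnn {d : ℕ} (μ ν : Fin d) (x : Fock d) :
    bStar μ (bAnn ν x) + bAnn ν (bStar μ x) = if μ = ν then x else 0 := by
  split_ifs with h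
  · subst h
    ext S
    rw [PiLp.add_apply, bStar_bAnn_self, bAnn_bStar_self]
    split_ifs <;> simp
  · exact bStar_bAnn_of_ne h x

/-! ### The supersymmetry algebra -/

theorem sum_antisymm_eq_zero {ι R : Type*} [Ring R] [Algebra ℂ R] (s : Finset ι) (F : ι → ι → R)
    (h : ∀ i j, F i j = -F j i) : ∑ i ∈ s, ∑ j ∈ s, F i j = 0 := by
  have h1 : ∑ i ∈ s, ∑ j ∈ s, F i j = -∑ i ∈ s, ∑ j ∈ s, F i j := by
    conv_lhs => rw [Finset.sum_comm]
    simp only [← Finset.sum_neg_distrib]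
    exact Finset.sum_congr rfl fun i _ => Finset.sum_congr rfl fun j _ => h j i
  set X := ∑ i ∈ s, ∑ j ∈ s, F i j
  calc X = (1 / 2 : ℂ) • (X + X) := by module
    _ = 0 := by nth_rewrite 2 [h1]; rw [add_neg_cancel, smul_zero]

/-- The square of a supercharge. -/
theorem sq_supercharge {ι R : Type*} [Fintype ι] [DecidableEq ι] [Ring R] [Algebra ℂ R]
    {a s x y : ι → R} {c c' w : ℂ} (hc : c * c' = 1)
    (hax : ∀ i j, Commute (a i) (x j)) (hay : ∀ i j, Commute (a i) (y j))
    (hsx : ∀ i j, Commute (s i) (x j)) (hsy : ∀ i j, Commute (s i) (y j))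
    (haa : ∀ i j, Commute (a i) (a j)) (hss : ∀ i j, Commute (s i) (s j))
    (has : ∀ i j, a i * s j = s j * a i + if i = j then algebraMap ℂ R w else 0)
    (hxx : ∀ i j, x i * x j = -(x j * x i)) (hyy : ∀ i j, y i * y j = -(y j * y i))
    (hxy : ∀ i j, x i * y j + y j * x i = if i = j then 1 else 0) :
    (∑ i, (c • (a i * x i) + c' • (s i * y i))) * ∑ i, (c • (a i * x i) + c' • (s i * y i)) =
      ∑ i, s i * a i + w • ∑ i, x i * y i := by
  -- Commuting bosons times anticommuting fermions make the summand antisymmetric in i, j.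
  have h1 : ∑ i, ∑ j, (a i * x i) * (a j * x j) = 0 := sum_antisymm_eq_zero _ _ fun i j => by
    rw [(hax j i).symm.mul_mul_mul_comm, (hax i j).symm.mul_mul_mul_comm, hxx, (haa i j).eq,
      mul_neg]
  have h2 : ∑ i, ∑ j, (s i * y i) * (s j * y j) = 0 := sum_antisymm_eq_zero _ _ fun i j => by
    rw [(hsy j i).symm.mul_mul_mul_comm, (hsy i j).symm.mul_mul_mul_comm, hyy, (hss i j).eq,
      mul_neg]
  -- The cross terms equal s_j a_i {x_i, y_j} + [a_i, s_j] x_i y_j, and both brackets are scalar and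
  -- diagonal.
  have h3 : ∀ i j, (a i * x i) * (s j * y j) + (s j * y j) * (a i * x i) =
      if i = j then s i * a i + w • (x i * y i) else 0 := fun i j => by
    rw [(hsx j i).symm.mul_mul_mul_comm, (hay i j).symm.mul_mul_mul_comm, has, add_mul,
      add_right_comm, ← mul_add, hxy]
    split_ifs with h
    · subst h; rw [mul_one, Algebra.smul_def]
    · rw [mul_zero, zero_mul, zero_add]
  have e : (∑ i, (c • (a i * x i) + c' • (s i * y i))) * ∑ i, (c • (a i * x i) + c' • (s i * y i)) =
      (c * c) • ∑ i, ∑ j, (a i * x i) * (a j * x j) +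
      (c' * c') • ∑ i, ∑ j, (s i * y i) * (s j * y j) +
      ∑ i, ∑ j, ((a i * x i) * (s j * y j) + (s j * y j) * (a i * x i)) := by
    simp only [Finset.sum_add_distrib, add_mul, mul_add, ← Finset.smul_sum, smul_mul_smul_comm, hc,
      mul_comm c' c, one_smul, Finset.sum_mul_sum]
    rw [Finset.sum_comm (f := fun i j => s j * y j * (a i * x i))]
    abel
  rw [e, h1, h2, smul_zero, smul_zero, zero_add, zero_add]
  simp only [h3, Finset.sum_ite_eq, Finset.mem_univ, if_true, Finset.sum_add_distrib,
    ← Finset.smul_sum]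

/-! ### Ladder operators on Schwartz functions -/

variable {d : ℕ}

theorem aAnn_apply (Ω : ℝ) (μ : Fin d) (ψ : 𝓢(Space d, Fock d)) (x : Space d) :
    aAnn Ω μ ψ x = fderiv ℝ ψ x (EuclideanSpace.single μ 1) + ((Ω * x μ : ℝ) : ℂ) • ψ x := by
  rw [← mulCoord_apply]; rfl

theorem aStar_apply (Ω : ℝ) (μ : Fin d) (ψ : 𝓢(Space d, Fock d)) (x : Space d) :
    aStar Ω μ ψ x = -fderiv ℝ ψ x (EuclideanSpace.single μ 1) + ((Ω * x μ : ℝ) : ℂ) • ψ x := by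
  rw [← mulCoord_apply]; rfl

theorem onFock_apply (b : Fock d →L[ℂ] Fock d) (ψ : 𝓢(Space d, Fock d)) (x : Space d) :
    onFock b ψ x = b (ψ x) := rfl

theorem fderiv_clm_comp_schwartz {F G : Type*} [NormedAddCommGroup F] [NormedSpace ℂ F]
    [NormedAddCommGroup G] [NormedSpace ℂ G] (b : F →L[ℂ] G) (ψ : 𝓢(Space d, F)) (x v : Space d) :
    fderiv ℝ (fun y => b (ψ y)) x v = b (fderiv ℝ ψ x v) := by
  have h := ((b.restrictScalars ℝ).hasFDerivAt (x := ψ x)).comp x (ψ.hasFDerivAt x)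
  have h' : HasFDerivAt (fun y => b (ψ y)) ((b.restrictScalars ℝ).comp (fderiv ℝ ψ x)) x := h
  rw [h'.fderiv]
  rfl

theorem commute_aAnn_onFock (Ω : ℝ) (μ : Fin d) (b : Fock d →L[ℂ] Fock d) :
    Commute (aAnn Ω μ) (onFock b) := by
  ext ψ x : 2
  change aAnn Ω μ (onFock b ψ) x = onFock b (aAnn Ω μ ψ) x
  rw [onFock_apply, aAnn_apply, aAnn_apply, map_add, map_smul]
  congr 1
  exact fderiv_clm_comp_schwartz b ψ x _

theorem commute_aStar_onFock (Ω : ℝ) (μ : Fin d) (b : Fock d →L[ℂ] Fock d) :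
    Commute (aStar Ω μ) (onFock b) := by
  ext ψ x : 2
  change aStar Ω μ (onFock b ψ) x = onFock b (aStar Ω μ ψ) x
  rw [onFock_apply, aStar_apply, aStar_apply, map_add, map_smul, map_neg]
  congr 2
  exact fderiv_clm_comp_schwartz b ψ x _

/-- The partial derivative on Schwartz functions. -/
def pDeriv (μ : Fin d) : 𝓢(Space d, Fock d) →L[ℂ] 𝓢(Space d, Fock d) :=
  LineDeriv.lineDerivOpCLM ℂ 𝓢(Space d, Fock d) (EuclideanSpace.single μ (1 : ℝ))

theorem pDeriv_apply (μ : Fin d) (ψ : 𝓢(Space d, Fock d)) (x : Space d) :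
    pDeriv μ ψ x = fderiv ℝ ψ x (EuclideanSpace.single μ 1) := rfl

theorem aAnn_eq (Ω : ℝ) (μ : Fin d) : aAnn Ω μ = pDeriv μ + mulCoord Ω μ := rfl

theorem aStar_eq (Ω : ℝ) (μ : Fin d) : aStar Ω μ = -pDeriv μ + mulCoord Ω μ := rfl

theorem commute_pDeriv (μ ν : Fin d) : Commute (pDeriv μ) (pDeriv ν) := by
  ext ψ x : 2
  have key : ∀ v w : Space d, fderiv ℝ (fun y => fderiv ℝ ψ y w) x v =
      fderiv ℝ (fderiv ℝ ψ) x v w := fun v w => by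
    have h := (fderivCLM ℝ (Space d) (Fock d) ψ).hasFDerivAt x
    have h' : HasFDerivAt (fderiv ℝ ψ) (fderiv ℝ (fderiv ℝ ψ) x) x := h
    rw [(h'.clm_apply (hasFDerivAt_const w x)).fderiv]
    simp
  change fderiv ℝ (fun y => fderiv ℝ ψ y (EuclideanSpace.single ν 1)) x
      (EuclideanSpace.single μ 1) =
    fderiv ℝ (fun y => fderiv ℝ ψ y (EuclideanSpace.single μ 1)) x (EuclideanSpace.single ν 1)
  rw [key, key]
  exact second_derivative_symmetric (f' := fderiv ℝ ψ) (fun y => ψ.hasFDerivAt y)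
    ((fderivCLM ℝ (Space d) (Fock d) ψ).hasFDerivAt x) _ _

theorem commute_mulCoord (Ω : ℝ) (μ ν : Fin d) :
    Commute (mulCoord (d := d) Ω μ) (mulCoord Ω ν) := by
  ext ψ x : 2
  change mulCoord Ω μ (mulCoord Ω ν ψ) x = mulCoord Ω ν (mulCoord Ω μ ψ) x
  simp only [mulCoord_apply]
  rw [smul_comm]

theorem pDeriv_mulCoord (Ω : ℝ) (μ ν : Fin d) :
    pDeriv μ * mulCoord Ω ν = mulCoord Ω ν * pDeriv μ +
      if μ = ν then algebraMap ℂ (𝓢(Space d, Fock d) →L[ℂ] 𝓢(Space d, Fock d)) Ω else 0 := by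
  ext ψ x : 2
  have h1 : HasFDerivAt (fun y : Space d => ((Ω * y ν : ℝ) : ℂ))
      (Complex.ofRealCLM ∘L (Ω • EuclideanSpace.proj (𝕜 := ℝ) ν : Space d →L[ℝ] ℝ)) x :=
    (Complex.ofRealCLM ∘L (Ω • EuclideanSpace.proj (𝕜 := ℝ) ν : Space d →L[ℝ] ℝ)).hasFDerivAt
  have h2 := h1.smul (ψ.hasFDerivAt x)
  have h3 : (mulCoord Ω ν ψ : Space d → Fock d) = fun y => ((Ω * y ν : ℝ) : ℂ) • ψ y :=
    funext fun y => mulCoord_apply Ω ν ψ y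
  have h4 : HasFDerivAt (mulCoord Ω ν ψ) (((Ω * x ν : ℝ) : ℂ) • fderiv ℝ ψ x +
      (Complex.ofRealCLM ∘L (Ω • EuclideanSpace.proj (𝕜 := ℝ) ν : Space d →L[ℝ] ℝ)).smulRight
        (ψ x)) x := h3 ▸ h2
  change pDeriv μ (mulCoord Ω ν ψ) x = _
  rw [pDeriv_apply, h4.fderiv]
  have h5 : (mulCoord Ω ν * pDeriv μ) ψ x =
      ((Ω * x ν : ℝ) : ℂ) • fderiv ℝ ψ x (EuclideanSpace.single μ 1) := mulCoord_apply Ω ν _ x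
  change _ = (mulCoord Ω ν * pDeriv μ) ψ x +
    (if μ = ν then algebraMap ℂ (𝓢(Space d, Fock d) →L[ℂ] 𝓢(Space d, Fock d)) Ω else 0) ψ x
  rw [h5]
  split_ifs with h
  · subst h
    simp [Algebra.algebraMap_eq_smul_one]
  · simp [Ne.symm h]

theorem commute_aAnn (Ω : ℝ) (μ ν : Fin d) : Commute (aAnn (d := d) Ω μ) (aAnn Ω ν) := by
  have h1 := pDeriv_mulCoord Ω μ ν
  have h2 := pDeriv_mulCoord Ω ν μ
  rw [aAnn_eq, aAnn_eq, commute_iff_eq, add_mul, mul_add, mul_add, add_mul, mul_add, mul_add, h1, h2,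
    (commute_pDeriv μ ν).eq, (commute_mulCoord Ω μ ν).eq]
  simp only [eq_comm (a := ν)]
  abel

theorem commute_aStar (Ω : ℝ) (μ ν : Fin d) : Commute (aStar (d := d) Ω μ) (aStar Ω ν) := by
  have h1 := pDeriv_mulCoord Ω μ ν
  have h2 := pDeriv_mulCoord Ω ν μ
  rw [aStar_eq, aStar_eq, commute_iff_eq, add_mul, mul_add, mul_add, add_mul, mul_add, mul_add,
    neg_mul, neg_mul, neg_mul, neg_mul, mul_neg, mul_neg, mul_neg, mul_neg, h1, h2,
    (commute_pDeriv μ ν).eq, (commute_mulCoord Ω μ ν).eq]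
  simp only [eq_comm (a := ν)]
  abel

theorem aAnn_mul_aStar (Ω : ℝ) (μ ν : Fin d) :
    aAnn Ω μ * aStar Ω ν = aStar Ω ν * aAnn Ω μ +
      if μ = ν then algebraMap ℂ (𝓢(Space d, Fock d) →L[ℂ] 𝓢(Space d, Fock d)) (2 * Ω) else 0 := by
  have h1 := pDeriv_mulCoord Ω μ ν
  have h2 := pDeriv_mulCoord Ω ν μ
  rw [aAnn_eq, aStar_eq, add_mul, mul_add, mul_add, add_mul, mul_add, mul_add,
    neg_mul, neg_mul, mul_neg, mul_neg, h1, h2,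
    (commute_pDeriv μ ν).eq, (commute_mulCoord Ω μ ν).eq]
  simp only [eq_comm (a := ν)]
  split_ifs
  · rw [two_mul, map_add]
    abel
  · abel

/-! ### The two Dirac operators in a common notation, and their squares -/

/-- The internal part of the Dirac operators: `b_μ*` for `D₁` and `b_μ` for `D₂`. -/
def raising (j : Fin 2) (μ : Fin d) : Fock d →L[ℂ] Fock d := if j = 0 then bStar μ else bAnn μ

/-- The adjoints of the operators `raising`. -/
def lowering (j : Fin 2) (μ : Fin d) : Fock d →L[ℂ] Fock d := if j = 0 then bAnn μ else bStar μ

/-- The phase in the Dirac operators. -/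
def phase (j : Fin 2) : ℂ := if j = 0 then 1 else Complex.I

theorem phase_mul_conj (j : Fin 2) : phase j * (starRingEnd ℂ) (phase j) = 1 := by
  unfold phase; split_ifs <;> simp

theorem diracSchwartz_eq (Ω : ℝ) (j : Fin 2) :
    diracSchwartz d Ω j = ∑ μ, (phase j • (aAnn Ω μ * onFock (raising j μ)) +
      (starRingEnd ℂ) (phase j) • (aStar Ω μ * onFock (lowering j μ))) := by
  fin_cases j
  · simp [diracSchwartz, raising, lowering, phase, charge₁, chargeStar₁, Finset.sum_add_distrib,
      ContinuousLinearMap.mul_def]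
  · simp [diracSchwartz, raising, lowering, phase, charge₂, chargeStar₂, Finset.sum_add_distrib,
      ContinuousLinearMap.mul_def, Finset.smul_sum, sub_eq_add_neg]

theorem adjoint_raising (j : Fin 2) (μ : Fin d) :
    ContinuousLinearMap.adjoint (raising j μ) = lowering j μ := by
  unfold raising lowering bAnn; split_ifs <;> simp

theorem diracSchwartz_sq (Ω : ℝ) (j : Fin 2) :
    diracSchwartz d Ω j * diracSchwartz d Ω j = ∑ μ, aStar Ω μ * aAnn Ω μ +
      (2 * Ω : ℂ) • ∑ μ, onFock (raising j μ) * onFock (lowering j μ) := by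
  rw [diracSchwartz_eq]
  refine sq_supercharge (phase_mul_conj j) (fun _ _ => commute_aAnn_onFock _ _ _)
    (fun _ _ => commute_aAnn_onFock _ _ _) (fun _ _ => commute_aStar_onFock _ _ _)
    (fun _ _ => commute_aStar_onFock _ _ _) (commute_aAnn Ω) (commute_aStar Ω)
    (aAnn_mul_aStar Ω) (fun μ ν => ?_) (fun μ ν => ?_) fun μ ν => ?_
  · rw [eq_neg_iff_add_eq_zero]
    ext ψ x : 2
    change raising j μ (raising j ν (ψ x)) + raising j ν (raising j μ (ψ x)) = 0
    unfold raising; split_ifs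
    · exact bStar_bStar _ _ _
    · exact bAnn_bAnn _ _ _
  · rw [eq_neg_iff_add_eq_zero]
    ext ψ x : 2
    change lowering j μ (lowering j ν (ψ x)) + lowering j ν (lowering j μ (ψ x)) = 0
    unfold lowering; split_ifs
    · exact bAnn_bAnn _ _ _
    · exact bStar_bStar _ _ _
  · ext ψ x : 2
    have h : raising j μ (lowering j ν (ψ x)) + lowering j ν (raising j μ (ψ x)) =
        if μ = ν then ψ x else 0 := by
      unfold raising lowering; split_ifs with h1 h2 h2
      · rw [bStar_bAnn, if_pos h2]
      · rw [bStar_bAnn, if_neg h2]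
      · rw [add_comm, bStar_bAnn, if_pos h2.symm]
      · rw [add_comm, bStar_bAnn, if_neg (Ne.symm h2)]
    change raising j μ (lowering j ν (ψ x)) + lowering j ν (raising j μ (ψ x)) = _
    rw [h]
    split_ifs <;> rfl

/-! ### Symmetry -/

theorem inner_embed (ψ φ : 𝓢(Space d, Fock d)) :
    ⟪embed d ψ, embed d φ⟫_ℂ = ∫ x, ⟪ψ x, φ x⟫_ℂ :=
  inner_toL2_toL2_eq ψ φ volume

theorem inner_embed_pDeriv (μ : Fin d) (ψ φ : 𝓢(Space d, Fock d)) :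
    ⟪embed d (pDeriv μ ψ), embed d φ⟫_ℂ = -⟪embed d ψ, embed d (pDeriv μ φ)⟫_ℂ := by
  rw [inner_embed, inner_embed, eq_neg_iff_add_eq_zero, add_comm, ← eq_neg_iff_add_eq_zero]
  exact integral_bilinear_lineDerivOp_right_eq_neg_left ψ φ
    (isBoundedBilinearMap_inner (𝕜 := ℂ) (E := Fock d)).toContinuousLinearMap
    (EuclideanSpace.single μ 1)

theorem inner_embed_mulCoord (Ω : ℝ) (μ : Fin d) (ψ φ : 𝓢(Space d, Fock d)) :
    ⟪embed d (mulCoord Ω μ ψ), embed d φ⟫_ℂ = ⟪embed d ψ, embed d (mulCoord Ω μ φ)⟫_ℂ := by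
  rw [inner_embed, inner_embed]
  congr 1
  funext x
  rw [mulCoord_apply, mulCoord_apply, inner_smul_left, inner_smul_right, Complex.conj_ofReal]

theorem inner_embed_aAnn (Ω : ℝ) (μ : Fin d) (ψ φ : 𝓢(Space d, Fock d)) :
    ⟪embed d (aAnn Ω μ ψ), embed d φ⟫_ℂ = ⟪embed d ψ, embed d (aStar Ω μ φ)⟫_ℂ := by
  rw [aAnn_eq, aStar_eq]
  simp only [_root_.add_apply, _root_.neg_apply, map_add, map_neg, inner_add_left, inner_add_right,
    inner_neg_right, inner_embed_pDeriv, inner_embed_mulCoord]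

theorem inner_embed_aStar (Ω : ℝ) (μ : Fin d) (ψ φ : 𝓢(Space d, Fock d)) :
    ⟪embed d (aStar Ω μ ψ), embed d φ⟫_ℂ = ⟪embed d ψ, embed d (aAnn Ω μ φ)⟫_ℂ := by
  rw [← inner_conj_symm, ← inner_embed_aAnn, inner_conj_symm]

theorem inner_embed_onFock (b : Fock d →L[ℂ] Fock d) (ψ φ : 𝓢(Space d, Fock d)) :
    ⟪embed d (onFock b ψ), embed d φ⟫_ℂ =
      ⟪embed d ψ, embed d (onFock (ContinuousLinearMap.adjoint b) φ)⟫_ℂ := by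
  rw [inner_embed, inner_embed]
  congr 1
  funext x
  rw [onFock_apply, onFock_apply, ContinuousLinearMap.adjoint_inner_right]

theorem inner_embed_dirac (Ω : ℝ) (j : Fin 2) (ψ φ : 𝓢(Space d, Fock d)) :
    ⟪embed d (diracSchwartz d Ω j ψ), embed d φ⟫_ℂ =
      ⟪embed d ψ, embed d (diracSchwartz d Ω j φ)⟫_ℂ := by
  have h1 : ∀ μ, ContinuousLinearMap.adjoint (lowering j μ : Fock d →L[ℂ] Fock d) = raising j μ :=
    fun μ => by rw [← adjoint_raising, ContinuousLinearMap.adjoint_adjoint]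
  rw [diracSchwartz_eq]
  simp only [_root_.sum_apply, map_sum, sum_inner, inner_sum, _root_.add_apply, _root_.smul_apply,
    map_add, map_smul, inner_add_left, inner_add_right, inner_smul_left, inner_smul_right,
    Complex.conj_conj]
  refine Finset.sum_congr rfl fun μ _ => ?_
  have e1 : ⟪embed d ((aAnn Ω μ * onFock (raising j μ)) ψ), embed d φ⟫_ℂ =
      ⟪embed d ψ, embed d ((aStar Ω μ * onFock (lowering j μ)) φ)⟫_ℂ := by
    rw [(commute_aStar_onFock Ω μ (lowering j μ)).eq, mul_apply_eq_comp, mul_apply_eq_comp,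
      inner_embed_aAnn, inner_embed_onFock, adjoint_raising]
  have e2 : ⟪embed d ((aStar Ω μ * onFock (lowering j μ)) ψ), embed d φ⟫_ℂ =
      ⟪embed d ψ, embed d ((aAnn Ω μ * onFock (raising j μ)) φ)⟫_ℂ := by
    rw [(commute_aAnn_onFock Ω μ (raising j μ)).eq, mul_apply_eq_comp, mul_apply_eq_comp,
      inner_embed_aStar, inner_embed_onFock, h1]
  rw [e1, e2, add_comm]

/-! ### Gaussians and coherent states as Schwartz functions -/

/-- Combines 1 + s ≤ 2(1 + s²) with uⁿ/n! ≤ exp u at u = c(1 + s²). -/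
theorem one_add_pow_mul_exp_neg_sq_le {c : ℝ} (hc : 0 < c) (n : ℕ) {s : ℝ} (hs : 0 ≤ s) :
    (1 + s) ^ n * Real.exp (-(c * s ^ 2)) ≤ 2 ^ n * n.factorial * (c ^ n)⁻¹ * Real.exp c := by
  have h1 : (1 + s) ^ n ≤ 2 ^ n * (1 + s ^ 2) ^ n := by
    rw [← mul_pow]
    gcongr
    nlinarith [sq_nonneg (1 - s)]
  have h2 := Real.pow_div_factorial_le_exp (x := c * (1 + s ^ 2)) (by positivity) n
  rw [div_le_iff₀ (by positivity), mul_pow] at h2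
  have h3 : (1 + s ^ 2) ^ n ≤ (c ^ n)⁻¹ * (Real.exp (c * (1 + s ^ 2)) * n.factorial) := by
    rw [le_inv_mul_iff₀ (by positivity)]
    exact h2
  calc _ ≤ 2 ^ n * ((c ^ n)⁻¹ * (Real.exp (c * (1 + s ^ 2)) * n.factorial)) *
        Real.exp (-(c * s ^ 2)) := by gcongr; exact h1.trans (by gcongr)
    _ = 2 ^ n * n.factorial * (c ^ n)⁻¹ * (Real.exp (c * (1 + s ^ 2)) * Real.exp (-(c * s ^ 2))) := by
        ring
    _ = _ := by
        rw [← Real.exp_add]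
        congr 2
        ring

/-- The Faà di Bruno bound estimates each derivative of the Gaussian by a polynomial times the
Gaussian. The construction is real first, because there every derivative of the outer exponential is
its own value; the isometric embedding of ℝ in ℂ transfers the decay. -/
theorem exists_gaussian {c : ℝ} (hc : 0 < c) :
    ∃ g : 𝓢(Space d, ℂ), ∀ x, g x = Complex.exp (-(c * ‖x‖ ^ 2 : ℝ)) := by
  have hs : Function.HasTemperateGrowth fun x : Space d => -(c * ‖x‖ ^ 2) := by
    have := (Function.hasTemperateGrowth_norm_sq (H := Space d))
    fun_prop
  let g : 𝓢(Space d, ℝ) :=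
    { toFun := fun x => Real.exp (-(c * ‖x‖ ^ 2))
      smooth' := Real.contDiff_exp.comp hs.1
      decay' := fun k n => by
        obtain ⟨l, C, hC, h⟩ := hs.norm_iteratedFDeriv_le_uniform n
        have hb : ∀ x : Space d, ‖iteratedFDeriv ℝ n (fun x => Real.exp (-(c * ‖x‖ ^ 2))) x‖ ≤
            n.factorial * Real.exp (-(c * ‖x‖ ^ 2)) * ((1 + C) * (1 + ‖x‖) ^ l) ^ n := fun x => by
          refine norm_iteratedFDeriv_comp_le (g := Real.exp) Real.contDiff_exp hs.1
            (mod_cast le_top) x (fun i _ => ?_) fun i hi hin => ?_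
          · rw [norm_iteratedFDeriv_eq_norm_iteratedDeriv, iteratedDeriv_eq_iterate,
              Real.iter_deriv_exp, Real.norm_of_nonneg (Real.exp_nonneg _)]
          -- Using 1 + C instead of C makes the base at least 1, so that it is below its i-th power
          -- for every i ≥ 1.
          · have h1 : 1 ≤ (1 + C) * (1 + ‖x‖) ^ l :=
              one_le_mul_of_one_le_of_one_le (by linarith)
                (one_le_pow₀ (by linarith [norm_nonneg x]))
            refine (h i hin x).trans (le_trans ?_ (le_self_pow₀ h1 (by lia)))
            gcongr
            linarith
        refine ⟨n.factorial * (1 + C) ^ n * (2 ^ (k + l * n) * (k + l * n).factorial *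
          (c ^ (k + l * n))⁻¹ * Real.exp c), fun x => ?_⟩
        calc _ ≤ (1 + ‖x‖) ^ k * (n.factorial * Real.exp (-(c * ‖x‖ ^ 2)) *
              ((1 + C) * (1 + ‖x‖) ^ l) ^ n) := by
              gcongr
              · linarith
              · exact hb x
          _ = n.factorial * (1 + C) ^ n * ((1 + ‖x‖) ^ (k + l * n) *
              Real.exp (-(c * ‖x‖ ^ 2))) := by
              rw [mul_pow, ← pow_mul, pow_add]
              ring
          _ ≤ _ := mul_le_mul_of_nonneg_left
              (one_add_pow_mul_exp_neg_sq_le hc _ (norm_nonneg x)) (by positivity) }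
  have hr : Function.HasTemperateGrowth fun x : Space d => ((g x : ℝ) : ℂ) := by
    have := g.hasTemperateGrowth
    fun_prop
  refine ⟨{ toFun := fun x => ((g x : ℝ) : ℂ), smooth' := hr.1, decay' := fun k n => ?_ }, fun x => ?_⟩
  · obtain ⟨C, hC⟩ := g.decay' k n
    refine ⟨C, fun x => (le_of_eq ?_).trans (hC x)⟩
    congr 1
    exact Complex.ofRealLI.norm_iteratedFDeriv_comp_left g.smooth'.contDiffAt (mod_cast le_top)
  · change ((Real.exp (-(c * ‖x‖ ^ 2)) : ℝ) : ℂ) = _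
    rw [Complex.ofReal_exp, Complex.ofReal_neg]

theorem hasTemperateGrowth_cexp_I_mul (p : Space d) :
    Function.HasTemperateGrowth fun x : Space d => Complex.exp (Complex.I * (⟪p, x⟫_ℝ : ℝ)) := by
  have h1 : Function.HasTemperateGrowth fun s : ℝ => Complex.exp (Complex.I * (s : ℂ)) := by
    have hit : ∀ n : ℕ, iteratedDeriv n (fun s : ℝ => Complex.exp (Complex.I * (s : ℂ))) =
        fun s : ℝ => Complex.I ^ n * Complex.exp (Complex.I * (s : ℂ)) := fun n => by
      induction n with
      | zero => simp
      | succ n ih =>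
        rw [iteratedDeriv_succ, ih]
        funext s
        have h := (((Complex.ofRealCLM.hasDerivAt (x := s)).const_mul Complex.I).cexp).const_mul
          (Complex.I ^ n)
        simp only [Complex.ofRealCLM_apply, Complex.ofReal_one, mul_one] at h
        rw [h.deriv, pow_succ]
        ring
    refine ⟨?_, fun n => ⟨0, 1, fun s => ?_⟩⟩
    · exact Complex.contDiff_exp.comp (contDiff_const.mul Complex.ofRealCLM.contDiff)
    · rw [norm_iteratedFDeriv_eq_norm_iteratedDeriv, hit, norm_mul, norm_pow, Complex.norm_I,
        Complex.norm_exp]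
      simp
  exact h1.comp (Function.hasTemperateGrowth_inner_right p)

/-! ### Coherent states as eigenvectors of the annihilation operators -/

/-- The Gaussian `exp (-c ‖x‖²)`, `c > 0`, as a Schwartz function. -/
def gaussian (d : ℕ) {c : ℝ} (hc : 0 < c) : 𝓢(Space d, ℂ) := (exists_gaussian hc).choose

theorem gaussian_apply {c : ℝ} (hc : 0 < c) (x : Space d) :
    gaussian d hc x = Complex.exp (-(c * ‖x‖ ^ 2 : ℝ)) := (exists_gaussian hc).choose_spec x

/-- The coherent state `exp (i ⟨p, x⟩) exp (-Ω ‖x - q‖² / 2) e_S` (not normalized). -/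
def coherent {Ω : ℝ} (hΩ : 0 < Ω) (q p : Space d) (S : Finset (Fin d)) : 𝓢(Space d, Fock d) :=
  postcompCLM (ContinuousLinearMap.toSpanSingleton ℂ (EuclideanSpace.single S (1 : ℂ)))
    (smulLeftCLM ℂ (fun x : Space d => Complex.exp (Complex.I * (⟪p, x⟫_ℝ : ℝ)))
      (compSubConstCLM ℂ q (gaussian d (half_pos hΩ))))

/-- The scalar part of a coherent state. -/
def cohFun (Ω : ℝ) (q p x : Space d) : ℂ :=
  Complex.exp (Complex.I * (⟪p, x⟫_ℝ : ℝ) - (Ω / 2 * ‖x - q‖ ^ 2 : ℝ))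

theorem coherent_apply {Ω : ℝ} (hΩ : 0 < Ω) (q p : Space d) (S : Finset (Fin d)) (x : Space d) :
    coherent hΩ q p S x = cohFun Ω q p x • EuclideanSpace.single S (1 : ℂ) := by
  rw [coherent, postcompCLM_apply, smulLeftCLM_apply_apply (hasTemperateGrowth_cexp_I_mul p),
    compSubConstCLM_apply, gaussian_apply, smul_eq_mul, ← Complex.exp_add,
    ContinuousLinearMap.toSpanSingleton_apply, cohFun]
  congr 2

theorem hasFDerivAt_cohFun (Ω : ℝ) (q p x : Space d) :
    HasFDerivAt (cohFun Ω q p) (cohFun Ω q p x • (Complex.I • (Complex.ofRealCLM ∘L innerSL ℝ p) -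
      (Ω : ℂ) • (Complex.ofRealCLM ∘L innerSL ℝ (x - q)))) x := by
  have h1 : HasFDerivAt (fun x : Space d => ((⟪p, x⟫_ℝ : ℝ) : ℂ))
      (Complex.ofRealCLM ∘L innerSL ℝ p) x :=
    (Complex.ofRealCLM ∘L innerSL ℝ p).hasFDerivAt
  have h2 : HasFDerivAt (fun x : Space d => Ω / 2 * ‖x - q‖ ^ 2) (Ω • innerSL ℝ (x - q)) x := by
    have h := ((hasFDerivAt_id x).sub_const q).norm_sq.const_mul (Ω / 2)
    refine h.congr_fderiv ?_
    ext v
    simp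
    ring
  have h3 : HasFDerivAt (fun x : Space d => ((Ω / 2 * ‖x - q‖ ^ 2 : ℝ) : ℂ))
      (Complex.ofRealCLM ∘L (Ω • innerSL ℝ (x - q))) x :=
    (Complex.ofRealCLM.hasFDerivAt).comp x h2
  have h4 := ((h1.const_mul Complex.I).sub h3).cexp
  refine h4.congr_fderiv ?_
  ext v
  simp [cohFun]

/-- The derivative brings down i p_μ - Ω(x_μ - q_μ), and the term Ω x_μ in a_μ cancels the
dependence on x. -/
theorem aAnn_coherent {Ω : ℝ} (hΩ : 0 < Ω) (μ : Fin d) (q p : Space d) (S : Finset (Fin d)) :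
    aAnn Ω μ (coherent hΩ q p S) =
      (Complex.I * p μ + Ω * q μ : ℂ) • coherent hΩ q p S := by
  ext x : 1
  have h0 : (coherent hΩ q p S : Space d → Fock d) =
      fun x => cohFun Ω q p x • EuclideanSpace.single S (1 : ℂ) :=
    funext fun x => coherent_apply hΩ q p S x
  have h1 : HasFDerivAt (coherent hΩ q p S) _ x :=
    h0 ▸ (hasFDerivAt_cohFun Ω q p x).smul_const (EuclideanSpace.single S (1 : ℂ))
  rw [aAnn_apply, h1.fderiv, _root_.smul_apply, coherent_apply, ContinuousLinearMap.smulRight_apply,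
    smul_smul, smul_smul, ← add_smul]
  congr 1
  simp [PiLp.inner_apply]
  ring

/-! ### Inner products of coherent states -/

theorem integral_gaussian_cexp {b : ℝ} (hb : 0 < b) (c : ℂ) (w : Space d) :
    ∫ v : Space d, Complex.exp (-(b : ℂ) * ‖v‖ ^ 2 + c * (⟪w, v⟫_ℝ : ℝ)) =
      (((Real.pi / b) ^ ((d : ℝ) / 2) : ℝ) : ℂ) * Complex.exp (c ^ 2 * ‖w‖ ^ 2 / (4 * b)) := by
  rw [GaussianFourier.integral_cexp_neg_mul_sq_norm_add (by simpa using hb),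
    Complex.ofReal_cpow (by positivity), finrank_euclideanSpace_fin]
  push_cast
  rfl

/-- The scalar overlap of two coherent states. -/
def overlap (Ω : ℝ) (q p q' p' : Space d) : ℂ :=
  (((Real.pi / Ω) ^ ((d : ℝ) / 2) : ℝ) : ℂ) *
    Complex.exp (-(Ω / 4 * ‖q - q'‖ ^ 2 + ‖p' - p‖ ^ 2 / (4 * Ω) : ℝ) +
      Complex.I * (⟪p' - p, (1 / 2 : ℝ) • (q + q')⟫_ℝ : ℝ))

theorem integral_cohFun {Ω : ℝ} (hΩ : 0 < Ω) (q p q' p' : Space d) :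
    ∫ x, (starRingEnd ℂ) (cohFun Ω q p x) * cohFun Ω q' p' x = overlap Ω q p q' p' := by
  have hint : ∀ y : Space d,
      (starRingEnd ℂ) (cohFun Ω q p (y + (1 / 2 : ℝ) • (q + q'))) *
        cohFun Ω q' p' (y + (1 / 2 : ℝ) • (q + q')) =
      Complex.exp (-(Ω / 4 * ‖q - q'‖ ^ 2 : ℝ) +
        Complex.I * (⟪p' - p, (1 / 2 : ℝ) • (q + q')⟫_ℝ : ℝ)) *
      Complex.exp (-(Ω : ℂ) * ‖y‖ ^ 2 + Complex.I * (⟪p' - p, y⟫_ℝ : ℝ)) := fun y => by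
    -- Parallelogram law around the midpoint of q and q': it leaves a centred Gaussian in y times a
    -- constant.
    have h1 : ‖y + (1 / 2 : ℝ) • (q + q') - q‖ ^ 2 + ‖y + (1 / 2 : ℝ) • (q + q') - q'‖ ^ 2 =
        2 * ‖y‖ ^ 2 + 1 / 2 * ‖q - q'‖ ^ 2 := by
      have e1 : y + (1 / 2 : ℝ) • (q + q') - q = y - (1 / 2 : ℝ) • (q - q') := by module
      have e2 : y + (1 / 2 : ℝ) • (q + q') - q' = y + (1 / 2 : ℝ) • (q - q') := by module
      rw [e1, e2, norm_sub_sq_real, norm_add_sq_real, norm_smul]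
      norm_num
      ring
    rw [cohFun, cohFun, ← Complex.exp_conj, ← Complex.exp_add, ← Complex.exp_add]
    congr 1
    simp only [map_sub, map_mul, Complex.conj_I, Complex.conj_ofReal, inner_sub_left,
      inner_add_right]
    have h1' := congrArg (fun r : ℝ => (r : ℂ)) h1
    push_cast at h1' ⊢
    linear_combination (-(Ω : ℂ) / 2) * h1'
  rw [← integral_add_right_eq_self _ ((1 / 2 : ℝ) • (q + q'))]
  simp only [hint]
  rw [integral_const_mul, integral_gaussian_cexp hΩ, overlap, mul_left_comm, ← Complex.exp_add]
  congr 2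
  rw [Complex.I_sq]
  push_cast
  ring

theorem inner_coherent {Ω : ℝ} (hΩ : 0 < Ω) (q p q' p' : Space d) (S S' : Finset (Fin d)) :
    ⟪embed d (coherent hΩ q p S), embed d (coherent hΩ q' p' S')⟫_ℂ =
      if S = S' then overlap Ω q p q' p' else 0 := by
  rw [inner_embed]
  simp only [coherent_apply, inner_smul_left, inner_smul_right]
  split_ifs with h
  · subst h
    rw [← integral_cohFun hΩ]
    congr 1
    funext x
    simp [mul_comm]
  · have : ⟪(EuclideanSpace.single S (1 : ℂ) : Fock d), EuclideanSpace.single S' 1⟫_ℂ = 0 := by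
      rw [EuclideanSpace.inner_single_left, PiLp.single_apply, if_neg h, mul_zero]
    simp only [this, mul_zero, integral_zero]

theorem overlap_self (Ω : ℝ) (q p : Space d) :
    overlap Ω q p q p = (((Real.pi / Ω) ^ ((d : ℝ) / 2) : ℝ) : ℂ) := by
  simp [overlap]

theorem continuous_overlap (Ω : ℝ) (q p : Space d) :
    Continuous fun z : Space d × Space d => overlap Ω q p z.1 z.2 := by
  unfold overlap
  fun_prop

theorem norm_sq_embed_coherent {Ω : ℝ} (hΩ : 0 < Ω) (q p : Space d) (S : Finset (Fin d)) :
    ‖embed d (coherent hΩ q p S)‖ ^ 2 = (Real.pi / Ω) ^ ((d : ℝ) / 2) := by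
  have h := inner_coherent hΩ q p q p S S
  rw [if_pos rfl, overlap_self, inner_self_eq_norm_sq_to_K] at h
  exact Complex.ofReal_injective (by push_cast; exact h)

/-- All coherent states have the same norm, so the squared distance of two of them is determined by
the real part of their overlap, which is explicit and continuous. -/
theorem continuous_coherent {Ω : ℝ} (hΩ : 0 < Ω) (S : Finset (Fin d)) :
    Continuous fun z : Space d × Space d => embed d (coherent hΩ z.1 z.2 S) := by
  rw [continuous_iff_continuousAt]
  intro z₀
  rw [ContinuousAt, tendsto_iff_norm_sub_tendsto_zero]
  have h1 : ∀ z : Space d × Space d,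
      ‖embed d (coherent hΩ z.1 z.2 S) - embed d (coherent hΩ z₀.1 z₀.2 S)‖ =
      Real.sqrt (2 * (Real.pi / Ω) ^ ((d : ℝ) / 2) -
        2 * (overlap Ω z₀.1 z₀.2 z.1 z.2).re) := fun z => by
    rw [← Real.sqrt_sq (norm_nonneg (_ - _)), norm_sub_rev, @norm_sub_sq ℂ, inner_coherent,
      if_pos rfl, norm_sq_embed_coherent, norm_sq_embed_coherent]
    congr 1
    change _ - 2 * (overlap Ω z₀.1 z₀.2 z.1 z.2).re + _ = _
    ring
  simp only [h1]
  have hc : Continuous fun z : Space d × Space d => Real.sqrt (2 * (Real.pi / Ω) ^ ((d : ℝ) / 2) -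
        2 * (overlap Ω z₀.1 z₀.2 z.1 z.2).re) := by
    have := Complex.continuous_re.comp (continuous_overlap Ω z₀.1 z₀.2)
    simp only [Function.comp_def] at this
    fun_prop
  have h2 := hc.tendsto z₀
  rw [overlap_self, Complex.ofReal_re, sub_self, Real.sqrt_zero] at h2
  exact h2

/-! ### Hermite functions -/

/-- The Hermite functions `a*_{μ₁} ⋯ a*_{μₙ} exp (-Ω ‖x‖² / 2) e_S` (not normalized). -/
def hermite {Ω : ℝ} (hΩ : 0 < Ω) (S : Finset (Fin d)) : List (Fin d) → 𝓢(Space d, Fock d)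
  | [] => coherent hΩ 0 0 S
  | μ :: l => aStar Ω μ (hermite hΩ S l)

theorem hermite_cons {Ω : ℝ} (hΩ : 0 < Ω) (S : Finset (Fin d)) (μ : Fin d) (l : List (Fin d)) :
    hermite hΩ S (μ :: l) = aStar Ω μ (hermite hΩ S l) := rfl

theorem aAnn_hermite_nil {Ω : ℝ} (hΩ : 0 < Ω) (S : Finset (Fin d)) (μ : Fin d) :
    aAnn Ω μ (hermite hΩ S []) = 0 := by
  rw [hermite, aAnn_coherent]
  simp

theorem aAnn_hermite_cons {Ω : ℝ} (hΩ : 0 < Ω) (S : Finset (Fin d)) (μ ν : Fin d)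
    (l : List (Fin d)) : aAnn Ω μ (hermite hΩ S (ν :: l)) =
      aStar Ω ν (aAnn Ω μ (hermite hΩ S l)) +
        if μ = ν then (2 * Ω : ℂ) • hermite hΩ S l else 0 := by
  have h := DFunLike.congr_fun (aAnn_mul_aStar (d := d) Ω μ ν) (hermite hΩ S l)
  rw [mul_apply_eq_comp, _root_.add_apply, mul_apply_eq_comp] at h
  rw [hermite_cons, h]
  congr 1
  split_ifs
  · rw [Algebra.algebraMap_eq_smul_one]; rfl
  · rfl

/-- Each creation operator raises the eigenvalue of ∑ a*_μ a_μ by 2Ω, and the Gaussian is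
annihilated by every a_μ. -/
theorem number_hermite {Ω : ℝ} (hΩ : 0 < Ω) (S : Finset (Fin d)) (l : List (Fin d)) :
    ∑ μ, aStar Ω μ (aAnn Ω μ (hermite hΩ S l)) = (2 * Ω * l.length : ℂ) • hermite hΩ S l := by
  induction l with
  | nil => simp [aAnn_hermite_nil]
  | cons ν l ih =>
    have h1 : ∀ μ, aStar Ω μ (aAnn Ω μ (hermite hΩ S (ν :: l))) =
        aStar Ω ν (aStar Ω μ (aAnn Ω μ (hermite hΩ S l))) +
          if μ = ν then (2 * Ω : ℂ) • hermite hΩ S (ν :: l) else 0 := fun μ => by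
      have h2 := DFunLike.congr_fun (commute_aStar (d := d) Ω μ ν).eq (aAnn Ω μ (hermite hΩ S l))
      rw [mul_apply_eq_comp, mul_apply_eq_comp] at h2
      rw [aAnn_hermite_cons, map_add, h2]
      congr 1
      split_ifs with h
      · rw [map_smul, h, hermite_cons]
      · rw [map_zero]
    simp only [h1, Finset.sum_add_distrib, ← map_sum, ih, Finset.sum_ite_eq', Finset.mem_univ,
      if_true, map_smul, ← hermite_cons, ← add_smul, List.length_cons]
    congr 1
    push_cast
    ring

/-- The number of fermions for `D₁`, of holes for `D₂`. -/
def fermionNumber (j : Fin 2) (S : Finset (Fin d)) : ℕ :=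
  ∑ μ : Fin d, if (μ ∈ S ↔ j = 0) then 1 else 0

theorem raising_lowering_single (j : Fin 2) (μ : Fin d) (S : Finset (Fin d)) :
    raising j μ (lowering j μ (EuclideanSpace.single S (1 : ℂ))) =
      (if (μ ∈ S ↔ j = 0) then 1 else 0 : ℂ) • EuclideanSpace.single S (1 : ℂ) := by
  ext T
  have h : ∀ P : Prop, [Decidable P] → (P ↔ (μ ∈ T ↔ j = 0)) →
      (if P then (EuclideanSpace.single S (1 : ℂ) : Fock d) T else 0) =
      (if (μ ∈ S ↔ j = 0) then 1 else 0 : ℂ) * (EuclideanSpace.single S (1 : ℂ) : Fock d) T := by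
    intro P _ hP
    rw [PiLp.single_apply]
    by_cases hT : T = S
    · subst hT
      simp [hP]
    · simp [hT]
  rw [PiLp.smul_apply, smul_eq_mul]
  unfold raising lowering
  by_cases hj : j = 0
  · rw [if_pos hj, if_pos hj, bStar_bAnn_self]
    exact h _ (by simp [hj])
  · rw [if_neg hj, if_neg hj, bAnn_bStar_self, ← h (μ ∉ T) (by simp [hj]), ite_not]

theorem onFock_hermite (b : Fock d →L[ℂ] Fock d) {Ω : ℝ} (hΩ : 0 < Ω) (S : Finset (Fin d)) {c : ℂ}
    (hb : b (EuclideanSpace.single S (1 : ℂ)) = c • EuclideanSpace.single S (1 : ℂ))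
    (l : List (Fin d)) : onFock b (hermite hΩ S l) = c • hermite hΩ S l := by
  induction l with
  | nil =>
    ext x : 1
    rw [onFock_apply, hermite, coherent_apply, map_smul, hb, _root_.smul_apply, coherent_apply,
      smul_comm]
  | cons μ l ih =>
    have h := DFunLike.congr_fun (commute_aStar_onFock Ω μ b).eq (hermite hΩ S l)
    rw [mul_apply_eq_comp, mul_apply_eq_comp] at h
    rw [hermite_cons, ← h, ih, map_smul]

theorem diracSchwartz_sq_hermite {Ω : ℝ} (hΩ : 0 < Ω) (j : Fin 2) (S : Finset (Fin d))
    (l : List (Fin d)) :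
    diracSchwartz d Ω j (diracSchwartz d Ω j (hermite hΩ S l)) =
      ((2 * Ω * (l.length + fermionNumber j S : ℕ) : ℝ) : ℂ) • hermite hΩ S l := by
  have h := DFunLike.congr_fun (diracSchwartz_sq (d := d) Ω j) (hermite hΩ S l)
  rw [mul_apply_eq_comp, _root_.add_apply, _root_.sum_apply, _root_.smul_apply,
    _root_.sum_apply] at h
  rw [h]
  have h1 : ∀ μ, (onFock (raising j μ) * onFock (lowering j μ)) (hermite hΩ S l) =
      (if (μ ∈ S ↔ j = 0) then 1 else 0 : ℂ) • hermite hΩ S l := fun μ =>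
    onFock_hermite (raising j μ * lowering j μ) hΩ S (raising_lowering_single j μ S) l
  simp only [h1, mul_apply_eq_comp, number_hermite, ← Finset.sum_smul, smul_smul, ← add_smul]
  congr 1
  have h2 : ((fermionNumber j S : ℕ) : ℂ) = ∑ μ : Fin d, if (μ ∈ S ↔ j = 0) then 1 else 0 := by
    rw [fermionNumber, Nat.cast_sum]
    exact Finset.sum_congr rfl fun μ _ => by split_ifs <;> simp
  push_cast
  rw [h2]
  ring

/-! ### Hermite functions and coherent states are total -/

/-- Each a*_μ moves to the other side as a_μ, where it acts on the coherent state as a scalar. -/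
theorem inner_hermite_coherent {Ω : ℝ} (hΩ : 0 < Ω) (S S' : Finset (Fin d)) (l : List (Fin d))
    (q p : Space d) :
    ⟪embed d (hermite hΩ S l), embed d (coherent hΩ q p S')⟫_ℂ =
      (l.map fun μ => Complex.I * p μ + Ω * q μ : List ℂ).prod *
        if S = S' then overlap Ω 0 0 q p else 0 := by
  induction l with
  | nil => simp [hermite, inner_coherent]
  | cons μ l ih =>
    rw [hermite_cons, inner_embed_aStar, aAnn_coherent, map_smul, inner_smul_right, ih,
      List.map_cons, List.prod_cons, mul_assoc]

theorem aAnn_hermite_mem {Ω : ℝ} (hΩ : 0 < Ω) (S : Finset (Fin d)) (μ : Fin d)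
    (l : List (Fin d)) :
    aAnn Ω μ (hermite hΩ S l) ∈ Submodule.span ℂ (Set.range (hermite hΩ S)) := by
  induction l with
  | nil => rw [aAnn_hermite_nil]; exact Submodule.zero_mem _
  | cons ν l ih =>
    rw [aAnn_hermite_cons]
    refine Submodule.add_mem _ ?_ ?_
    · have h : ∀ v ∈ Submodule.span ℂ (Set.range (hermite hΩ S)),
          aStar Ω ν v ∈ Submodule.span ℂ (Set.range (hermite hΩ S)) := fun v hv => by
        induction hv using Submodule.span_induction with
        | mem x hx =>
          obtain ⟨l, rfl⟩ := hx
          exact Submodule.subset_span ⟨ν :: l, rfl⟩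
        | zero => rw [map_zero]; exact Submodule.zero_mem _
        | add x y _ _ hx hy => rw [map_add]; exact Submodule.add_mem _ hx hy
        | smul a x _ hx => rw [map_smul]; exact Submodule.smul_mem _ _ hx
      exact h _ ih
    · split_ifs
      · exact Submodule.smul_mem _ _ (Submodule.subset_span ⟨l, rfl⟩)
      · exact Submodule.zero_mem _

/-- Multiplication by Ω x_μ is (a_μ + a*_μ)/2. Hence the span of the Hermite functions contains
every polynomial times the Gaussian. -/
theorem mulCoord_mem {Ω : ℝ} (hΩ : 0 < Ω) (S : Finset (Fin d)) (μ : Fin d)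
    {v : 𝓢(Space d, Fock d)} (hv : v ∈ Submodule.span ℂ (Set.range (hermite hΩ S))) :
    mulCoord Ω μ v ∈ Submodule.span ℂ (Set.range (hermite hΩ S)) := by
  induction hv using Submodule.span_induction with
  | mem x hx =>
    obtain ⟨l, rfl⟩ := hx
    have : mulCoord Ω μ (hermite hΩ S l) =
        (1 / 2 : ℂ) • (aAnn Ω μ (hermite hΩ S l) + hermite hΩ S (μ :: l)) := by
      rw [hermite_cons, aAnn_eq, aStar_eq, _root_.add_apply, _root_.add_apply, _root_.neg_apply]
      module
    rw [this]
    exact Submodule.smul_mem _ _ (Submodule.add_mem _ (aAnn_hermite_mem hΩ S μ l)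
      (Submodule.subset_span ⟨μ :: l, rfl⟩))
  | zero => rw [map_zero]; exact Submodule.zero_mem _
  | add x y _ _ hx hy => rw [map_add]; exact Submodule.add_mem _ hx hy
  | smul a x _ hx => rw [map_smul]; exact Submodule.smul_mem _ _ hx

theorem exists_mem_span_hermite {Ω : ℝ} (hΩ : 0 < Ω) (S : Finset (Fin d)) (k : Space d) (n : ℕ) :
    ∃ v ∈ Submodule.span ℂ (Set.range (hermite hΩ S)),
      ∀ x, v x = ((⟪k, x⟫_ℝ : ℝ) : ℂ) ^ n • coherent hΩ 0 0 S x := by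
  induction n with
  | zero => exact ⟨_, Submodule.subset_span ⟨[], rfl⟩, fun x => by simp [hermite]⟩
  | succ n ih =>
    obtain ⟨v, hv, h⟩ := ih
    refine ⟨∑ μ, ((k μ / Ω : ℝ) : ℂ) • mulCoord Ω μ v, Submodule.sum_mem _ fun μ _ =>
      Submodule.smul_mem _ _ (mulCoord_mem hΩ S μ hv), fun x => ?_⟩
    have hk : ((⟪k, x⟫_ℝ : ℝ) : ℂ) = ∑ μ, ((k μ / Ω : ℝ) : ℂ) * ((Ω * x μ : ℝ) : ℂ) := by
      rw [PiLp.inner_apply, Complex.ofReal_sum]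
      refine Finset.sum_congr rfl fun μ _ => ?_
      rw [← Complex.ofReal_mul]
      congr 1
      simp
      field_simp
    simp only [_root_.sum_apply, _root_.smul_apply, mulCoord_apply, h, smul_smul,
      ← Finset.sum_smul]
    congr 1
    rw [pow_succ', hk, Finset.sum_mul]
    simp only [mul_assoc]

theorem inner_embed_eq_integral (ψ : 𝓢(Space d, Fock d)) (f : Hilb d) :
    ⟪embed d ψ, f⟫_ℂ = ∫ x, ⟪ψ x, f x⟫_ℂ := by
  rw [L2.inner_def]
  refine integral_congr_ae ?_
  filter_upwards [ψ.coeFn_toLp 2 (volume : Measure (Space d))] with x hx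
  change ⟪(ψ.toLp 2 volume) x, f x⟫_ℂ = _
  rw [hx]

theorem inner_single_fock (c : ℂ) (S : Finset (Fin d)) (v : Fock d) :
    ⟪c • (EuclideanSpace.single S (1 : ℂ) : Fock d), v⟫_ℂ = (starRingEnd ℂ) c * v S := by
  rw [inner_smul_left, EuclideanSpace.inner_single_left, map_one, one_mul]

theorem memLp_component (f : Hilb d) (S : Finset (Fin d)) :
    MemLp (fun x => f x S) 2 (volume : Measure (Space d)) :=
  (Lp.memLp f).continuousLinearMap_comp (EuclideanSpace.proj (𝕜 := ℂ) S)

theorem memLp_cohFun {Ω : ℝ} (hΩ : 0 < Ω) (q p : Space d) :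
    MemLp (cohFun Ω q p) 2 (volume : Measure (Space d)) := by
  have h := ((coherent hΩ q p ∅).memLp 2 (volume : Measure (Space d))).continuousLinearMap_comp
    (EuclideanSpace.proj (𝕜 := ℂ) (∅ : Finset (Fin d)))
  refine h.ae_eq (Filter.Eventually.of_forall fun x => ?_)
  simp only [coherent_apply]
  simp

theorem norm_cohFun (Ω : ℝ) (q p x : Space d) :
    ‖cohFun Ω q p x‖ = Real.exp (-(Ω / 2 * ‖x - q‖ ^ 2)) := by
  rw [cohFun, Complex.norm_exp, Complex.sub_re, Complex.ofReal_re]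
  simp

/-- The bound exp|s| ≤ exp s + exp(-s) and completion of the square give Gaussians recentred at
±k/Ω, still in L². This dominates the exponential series below. -/
theorem integrable_exp_abs_inner_mul {Ω : ℝ} (hΩ : 0 < Ω) (k : Space d) (f : Hilb d)
    (S : Finset (Fin d)) :
    Integrable fun x => Real.exp |⟪k, x⟫_ℝ| * ‖cohFun Ω 0 0 x‖ * ‖f x S‖ := by
  have h1 : ∀ q : Space d, Integrable fun x => ‖cohFun Ω q 0 x‖ * ‖f x S‖ := fun q =>
    (memLp_cohFun hΩ q 0).norm.integrable_mul (memLp_component f S).norm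
  have h2 := ((h1 (Ω⁻¹ • k)).add (h1 (-(Ω⁻¹ • k)))).const_mul (Real.exp (‖k‖ ^ 2 / (2 * Ω)))
  have hcoh : Continuous (cohFun (d := d) Ω 0 0) := by unfold cohFun; fun_prop
  refine h2.mono' ?_ (Filter.Eventually.of_forall fun x => ?_)
  · refine AEStronglyMeasurable.mul ?_ (memLp_component f S).1.norm
    exact Continuous.aestronglyMeasurable (by fun_prop)
  · have key : ∀ s : ℝ, s ^ 2 = 1 → Real.exp (s * ⟪k, x⟫_ℝ) * ‖cohFun Ω 0 0 x‖ =
        Real.exp (‖k‖ ^ 2 / (2 * Ω)) * ‖cohFun Ω (s • Ω⁻¹ • k) 0 x‖ := fun s hs => by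
      rw [norm_cohFun, norm_cohFun, ← Real.exp_add, ← Real.exp_add, sub_zero,
        norm_sub_sq_real, norm_smul, norm_smul, inner_smul_right, inner_smul_right,
        real_inner_comm]
      congr 1
      have : ‖s‖ ^ 2 = 1 := by rw [Real.norm_eq_abs, sq_abs, hs]
      rw [mul_pow, this, norm_inv, Real.norm_of_nonneg hΩ.le]
      field_simp
      ring
    have h3 := key 1 (by norm_num)
    have h4 := key (-1) (by norm_num)
    rw [one_smul, one_mul] at h3
    rw [neg_one_smul, neg_one_mul] at h4
    rw [Real.norm_of_nonneg (by positivity), Pi.add_apply, mul_add, ← mul_assoc, ← mul_assoc, ← h3,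
      ← h4]
    rcases abs_cases ⟪k, x⟫_ℝ with h | h <;> rw [h.1]
    · exact le_add_of_nonneg_right (by positivity)
    · exact le_add_of_nonneg_left (by positivity)

theorem cohFun_zero_eq (Ω : ℝ) (k x : Space d) :
    cohFun Ω 0 k x = Complex.exp (Complex.I * (⟪k, x⟫_ℝ : ℝ)) * cohFun Ω 0 0 x := by
  rw [cohFun, cohFun, ← Complex.exp_add]
  congr 1
  simp [sub_eq_add_neg]

/-- Expanding exp(-i⟨k, x⟩) in its power series turns the inner product into a sum of pairings of f
with polynomials times the Gaussian, all of them zero; dominated convergence justifies the exchange.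
-/
theorem inner_coherent_eq_zero_of_hermite {Ω : ℝ} (hΩ : 0 < Ω) (S : Finset (Fin d)) (f : Hilb d)
    (h : ∀ l, ⟪embed d (hermite hΩ S l), f⟫_ℂ = 0) (k : Space d) :
    ⟪embed d (coherent hΩ 0 k S), f⟫_ℂ = 0 := by
  have h1 : ∀ v ∈ Submodule.span ℂ (Set.range (hermite hΩ S)), ⟪embed d v, f⟫_ℂ = 0 :=
    fun v hv => by
      induction hv using Submodule.span_induction with
      | mem x hx => obtain ⟨l, rfl⟩ := hx; exact h l
      | zero => rw [map_zero, inner_zero_left]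
      | add x y _ _ hx hy => rw [map_add, inner_add_left, hx, hy, add_zero]
      | smul a x _ hx => rw [map_smul, inner_smul_left, hx, mul_zero]
  let F : ℕ → Space d → ℂ := fun n x =>
    (-Complex.I * (⟪k, x⟫_ℝ : ℝ)) ^ n / n.factorial *
      ((starRingEnd ℂ) (cohFun Ω 0 0 x) * f x S)
  have h2 : ∀ n, ∫ x, F n x = 0 := fun n => by
    obtain ⟨v, hv, hvx⟩ := exists_mem_span_hermite hΩ S k n
    have h3 := h1 v hv
    rw [inner_embed_eq_integral] at h3
    have h4 : ∀ x, F n x = (-Complex.I) ^ n / n.factorial * ⟪v x, f x⟫_ℂ := fun x => by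
      rw [hvx, coherent_apply, smul_smul, inner_single_fock, map_mul, map_pow, Complex.conj_ofReal]
      simp only [F, mul_pow]
      ring
    simp only [h4, integral_const_mul, h3, mul_zero]
  have hcoh : Continuous (cohFun (d := d) Ω 0 0) := by unfold cohFun; fun_prop
  have h5 : HasSum (fun n => ∫ x, F n x)
      (∫ x, Complex.exp (-Complex.I * (⟪k, x⟫_ℝ : ℝ)) *
        ((starRingEnd ℂ) (cohFun Ω 0 0 x) * f x S)) := by
    have hexp : ∀ x : Space d, HasSum (fun n : ℕ => |⟪k, x⟫_ℝ| ^ n / n.factorial)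
        (Real.exp |⟪k, x⟫_ℝ|) := fun x => by
      rw [Real.exp_eq_exp_ℝ]
      exact NormedSpace.expSeries_div_hasSum_exp (𝔸 := ℝ) |⟪k, x⟫_ℝ|
    refine hasSum_integral_of_dominated_convergence
      (bound := fun n x => |⟪k, x⟫_ℝ| ^ n / n.factorial * (‖cohFun Ω 0 0 x‖ * ‖f x S‖))
      (fun n => ?_) (fun n => Filter.Eventually.of_forall fun x => ?_)
      (Filter.Eventually.of_forall fun x => ((hexp x).mul_right _).summable) ?_
      (Filter.Eventually.of_forall fun x => ?_)
    · refine AEStronglyMeasurable.mul ?_ (AEStronglyMeasurable.mul ?_ (memLp_component f S).1)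
      · exact Continuous.aestronglyMeasurable (by fun_prop)
      · exact Continuous.aestronglyMeasurable (Complex.continuous_conj.comp hcoh)
    · simp only [F]
      rw [norm_mul, norm_mul, norm_div, norm_pow, norm_mul, norm_neg, Complex.norm_I, one_mul,
        Complex.norm_real, RCLike.norm_conj, Complex.norm_natCast, Real.norm_eq_abs]
    · have : (fun x => ∑' n : ℕ, |⟪k, x⟫_ℝ| ^ n / n.factorial * (‖cohFun Ω 0 0 x‖ * ‖f x S‖)) =
          fun x => Real.exp |⟪k, x⟫_ℝ| * ‖cohFun Ω 0 0 x‖ * ‖f x S‖ := funext fun x => by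
        rw [((hexp x).mul_right _).tsum_eq, mul_assoc]
      rw [this]
      exact integrable_exp_abs_inner_mul hΩ k f S
    · have := NormedSpace.expSeries_div_hasSum_exp (𝔸 := ℂ) (-Complex.I * (⟪k, x⟫_ℝ : ℝ))
      rw [← Complex.exp_eq_exp_ℂ] at this
      exact this.mul_right _
  have h6 : HasSum (fun n => ∫ x, F n x) 0 := by simp only [h2]; exact hasSum_zero
  rw [inner_embed_eq_integral, ← h5.unique h6]
  congr 1
  funext x
  rw [coherent_apply, inner_single_fock, cohFun_zero_eq, map_mul, ← Complex.exp_conj, map_mul,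
    Complex.conj_I, Complex.conj_ofReal, mul_assoc]

/-- An integrable function with vanishing Fourier transform vanishes almost everywhere. -/
theorem ae_eq_zero_of_integral_cexp_mul {g : Space d → ℂ} (hg : Integrable g)
    (h : ∀ k : Space d, ∫ x, Complex.exp (Complex.I * (⟪k, x⟫_ℝ : ℝ)) * g x = 0) :
    g =ᵐ[volume] 0 := by
  have hF : ∀ w : Space d, FourierTransform.fourier g w = 0 := fun w => by
    rw [Real.fourier_eq', ← h (-(2 * Real.pi) • w)]
    congr 1
    funext x
    rw [smul_eq_mul, inner_smul_left, real_inner_comm x w]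
    congr 2
    simp
    ring
  refine ae_eq_zero_of_integral_contDiff_smul_eq_zero hg.locallyIntegrable fun u hu hcu => ?_
  have hu' : HasCompactSupport fun x => (u x : ℂ) := hcu.comp_left Complex.ofReal_zero
  let φ : 𝓢(Space d, ℂ) := hu'.toSchwartzMap (Complex.ofRealCLM.contDiff.comp hu)
  let ψ : 𝓢(Space d, ℂ) := FourierTransformInv.fourierInv φ
  have h1 : (FourierTransform.fourier (ψ : Space d → ℂ)) = φ := by
    rw [← fourier_coe]
    simp [ψ]
  -- Every test function is the Fourier transform of some Schwartz ψ, and the transform can be moved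
  -- from ψ onto g.
  have h2 : ∫ ξ, FourierTransform.fourier (ψ : Space d → ℂ) ξ • g ξ =
      ∫ x, ψ x • FourierTransform.fourier g x := by
    have := VectorFourier.integral_fourierIntegral_smul_eq_flip (L := innerₗ (Space d))
      Real.continuous_fourierChar continuous_inner (ψ.integrable (μ := volume)) hg
    rwa [flip_innerₗ] at this
  rw [h1] at h2
  simp only [hF, smul_zero, integral_zero] at h2
  rw [← h2]
  congr 1

/-- The hypothesis is the vanishing of the Fourier transform of the Gaussian times each component of
f, and the Gaussian has no zeros. -/
theorem eq_zero_of_inner_coherent {Ω : ℝ} (hΩ : 0 < Ω) (f : Hilb d)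
    (h : ∀ (S : Finset (Fin d)) (k : Space d), ⟪embed d (coherent hΩ 0 k S), f⟫_ℂ = 0) : f = 0 := by
  have h1 : ∀ S : Finset (Fin d), ∀ᵐ x ∂(volume : Measure (Space d)), f x S = 0 := fun S => by
    let g : Space d → ℂ := fun x => (starRingEnd ℂ) (cohFun Ω 0 0 x) * f x S
    have hg : Integrable g := (memLp_cohFun hΩ 0 0).star.integrable_mul (memLp_component f S)
    have hz := ae_eq_zero_of_integral_cexp_mul hg fun k => by
      have h2 := h S (-k)
      rw [inner_embed_eq_integral] at h2
      rw [← h2]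
      congr 1
      funext x
      rw [coherent_apply, inner_single_fock, cohFun_zero_eq, map_mul, ← Complex.exp_conj, map_mul,
        Complex.conj_I, Complex.conj_ofReal, mul_assoc, inner_neg_left, Complex.ofReal_neg,
        neg_mul_neg]
    filter_upwards [hz] with x hx
    refine (mul_eq_zero.1 hx).resolve_left ?_
    exact (map_ne_zero _).2 (Complex.exp_ne_zero _)
  rw [Lp.eq_zero_iff_ae_eq_zero]
  filter_upwards [ae_all_iff.2 h1] with x hx
  ext S
  exact hx S

theorem eq_zero_of_inner_hermite {Ω : ℝ} (hΩ : 0 < Ω) (f : Hilb d)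
    (h : ∀ (S : Finset (Fin d)) (l : List (Fin d)), ⟪embed d (hermite hΩ S l), f⟫_ℂ = 0) : f = 0 :=
  eq_zero_of_inner_coherent hΩ f fun S => inner_coherent_eq_zero_of_hermite hΩ S f (h S)

/-! ### Self-adjointness of the Dirac operators and their heat operators -/

theorem diracCore_embed (Ω : ℝ) (j : Fin 2) (ψ : 𝓢(Space d, Fock d))
    (h : embed d ψ ∈ (diracCore d Ω j).domain) :
    diracCore d Ω j ⟨embed d ψ, h⟩ = embed d (diracSchwartz d Ω j ψ) := by
  change embed d (diracSchwartz d Ω j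
    ((LinearEquiv.ofInjective (embed d) (embed_injective d)).symm ⟨embed d ψ, h⟩)) = _
  congr 2
  rw [LinearEquiv.symm_apply_eq]
  rfl

theorem diracCore_isFormalAdjoint (Ω : ℝ) (j : Fin 2) :
    (diracCore d Ω j).IsFormalAdjoint (diracCore d Ω j) := by
  rintro ⟨_, ψ, rfl⟩ ⟨_, φ, rfl⟩
  have h := inner_embed_dirac Ω j ψ φ
  rw [← diracCore_embed Ω j ψ ⟨ψ, rfl⟩, ← diracCore_embed Ω j φ ⟨φ, rfl⟩] at h
  exact h

theorem sqEigen_hermite {Ω : ℝ} (hΩ : 0 < Ω) (j : Fin 2) (S : Finset (Fin d))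
    (l : List (Fin d)) : SqEigen (diracCore d Ω j) (embed d (hermite hΩ S l)) := by
  have h1 : embed d (hermite hΩ S l) ∈ (diracCore d Ω j).domain := ⟨_, rfl⟩
  have h2 : diracCore d Ω j ⟨_, h1⟩ ∈ (diracCore d Ω j).domain := by
    rw [diracCore_embed]; exact ⟨_, rfl⟩
  refine ⟨h1, h2, 2 * Ω * (l.length + fermionNumber j S : ℕ), by positivity, ?_⟩
  rw [← map_smul, ← diracSchwartz_sq_hermite, ← diracCore_embed Ω j _ ⟨_, rfl⟩]
  exact congrArg (diracCore d Ω j) (Subtype.ext (diracCore_embed _ _ _ _))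

theorem isSelfAdjoint_dirac {Ω : ℝ} (hΩ : 0 < Ω) (j : Fin 2) : IsSelfAdjoint (dirac d Ω j) :=
  isSelfAdjoint_closure (diracCore_isFormalAdjoint Ω j) fun y hy =>
    eq_zero_of_inner_hermite hΩ y fun S l => hy _ (sqEigen_hermite hΩ j S l)

theorem heat_hermite {Ω : ℝ} (hΩ : 0 < Ω) (j : Fin 2) {t : ℝ} (ht : 0 < t) (S : Finset (Fin d))
    (l : List (Fin d)) : heat (dirac d Ω j) t (embed d (hermite hΩ S l)) =
      ((Real.exp (-t * (2 * Ω * (l.length + fermionNumber j S : ℕ))) : ℝ) : ℂ) •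
        embed d (hermite hΩ S l) := by
  have hle : diracCore d Ω j ≤ dirac d Ω j := LinearPMap.le_closure _
  have h0 : ∀ ψ : 𝓢(Space d, Fock d), embed d ψ ∈ (dirac d Ω j).domain := fun ψ => hle.1 ⟨ψ, rfl⟩
  have h1 : ∀ ψ (h : embed d ψ ∈ (dirac d Ω j).domain),
      dirac d Ω j ⟨embed d ψ, h⟩ = embed d (diracSchwartz d Ω j ψ) := fun ψ h => by
    rw [← diracCore_embed Ω j ψ ⟨ψ, rfl⟩]
    exact (hle.2 rfl).symm
  refine heat_apply_eigen (isSelfAdjoint_dirac hΩ j) ht (by positivity) (h0 _)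
    (by rw [h1]; exact h0 _) ?_
  have h2 := h1 (diracSchwartz d Ω j (hermite hΩ S l)) (h0 _)
  rw [diracSchwartz_sq_hermite, map_smul] at h2
  rw [← h2]
  exact congrArg (dirac d Ω j) (Subtype.ext (h1 _ _))

theorem adjoint_heat {H : Type*} [NormedAddCommGroup H] [InnerProductSpace ℂ H] [CompleteSpace H]
    (D : H →ₗ.[ℂ] H) (t : ℝ) : ContinuousLinearMap.adjoint (heat D t) = heat D t :=
  (cfc_predicate (heatFun t) (resolventSq D) : IsSelfAdjoint _)

/-! ### The heat operators as integrals of projections onto coherent states -/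

/-- The Hermite coefficients of level n are homogeneous of degree n in k, up to the factor
exp(-‖k‖²/(4Ω)). The heat operator multiplies them by rⁿ, r = exp(-2Ωt), and by a fermionic factor,
which amounts to k ↦ rk together with a correction of the Gaussian factor. -/
theorem heat_coherent {Ω : ℝ} (hΩ : 0 < Ω) (j : Fin 2) {t : ℝ} (ht : 0 < t) (S : Finset (Fin d))
    (k : Space d) : heat (dirac d Ω j) t (embed d (coherent hΩ 0 k S)) =
      ((Real.exp (-t * (2 * Ω * fermionNumber j S)) *
        Real.exp (-((1 - Real.exp (-(2 * Ω * t)) ^ 2) * ‖k‖ ^ 2 / (4 * Ω))) : ℝ) : ℂ) •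
        embed d (coherent hΩ 0 (Real.exp (-(2 * Ω * t)) • k) S) := by
  rw [← sub_eq_zero]
  refine eq_zero_of_inner_hermite hΩ _ fun S' l => ?_
  set r := Real.exp (-(2 * Ω * t)) with hr
  have h1 : ((Real.exp (-t * (2 * Ω * (l.length + fermionNumber j S' : ℕ))) : ℝ) : ℂ) =
      (r : ℂ) ^ l.length * (Real.exp (-t * (2 * Ω * fermionNumber j S')) : ℝ) := by
    rw [← Complex.ofReal_pow, ← Complex.ofReal_mul, hr, ← Real.exp_nat_mul, ← Real.exp_add]
    congr 2
    push_cast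
    ring
  have h2 : (l.map fun μ => Complex.I * ((r • k : Space d) μ : ℝ) + Ω * ((0 : Space d) μ : ℝ) :
        List ℂ).prod =
      (r : ℂ) ^ l.length *
        (l.map fun μ => Complex.I * (k μ : ℝ) + Ω * ((0 : Space d) μ : ℝ) : List ℂ).prod := by
    induction l with
    | nil => simp
    | cons μ l ih =>
      simp only [List.map_cons, List.prod_cons, List.length_cons, pow_succ] at ih ⊢
      -- The identity `h1` mentions l, so the induction carries it along and asks for it again at
      -- the tail.
      rw [ih (by
        rw [← Complex.ofReal_pow, ← Complex.ofReal_mul, hr, ← Real.exp_nat_mul, ← Real.exp_add]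
        congr 2
        push_cast
        ring)]
      simp
      ring
  rw [inner_sub_right, ← ContinuousLinearMap.adjoint_inner_left, adjoint_heat,
    heat_hermite hΩ j ht, inner_smul_left, inner_smul_right, Complex.conj_ofReal, h1,
    inner_hermite_coherent, inner_hermite_coherent, h2]
  split_ifs with h
  · subst h
    have h3 : overlap Ω 0 0 0 k = (Real.exp (-((1 - r ^ 2) * ‖k‖ ^ 2 / (4 * Ω))) : ℝ) *
        overlap Ω 0 0 0 (r • k) := by
      rw [overlap, overlap, mul_left_comm, Complex.ofReal_exp, ← Complex.exp_add]
      congr 2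
      simp only [sub_zero, norm_zero, add_zero, smul_zero, inner_zero_right, norm_smul, mul_pow]
      rw [Real.norm_eq_abs, sq_abs]
      push_cast
      field_simp
      ring
    rw [h3]
    push_cast
    ring
  · ring

/-- The normalization of the weight in the coherent state expansion of the heat operator. -/
def heatConst (d : ℕ) (Ω t : ℝ) : ℝ :=
  ((Real.pi / Ω) ^ ((d : ℝ) / 2) * (Real.pi / (Real.exp (2 * Ω * t) * Ω / 2)) ^ ((d : ℝ) / 2) *
    (Real.pi / (Real.exp (2 * Ω * t) / (2 * Ω))) ^ ((d : ℝ) / 2))⁻¹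

theorem heatConst_pos (d : ℕ) {Ω : ℝ} (hΩ : 0 < Ω) (t : ℝ) : 0 < heatConst d Ω t := by
  unfold heatConst
  positivity

/-- The weight in the coherent state expansion of the heat operator. -/
def heatWeight (Ω t : ℝ) (z : Space d × Space d) : ℝ :=
  heatConst d Ω t * (Real.exp (-((Real.exp (2 * Ω * t) - 1) * Ω / 2) * ‖z.1‖ ^ 2) *
    Real.exp (-((Real.exp (2 * Ω * t) - 1) / (2 * Ω)) * ‖z.2‖ ^ 2))

theorem heatWeight_nonneg {Ω : ℝ} (hΩ : 0 < Ω) (t : ℝ) (z : Space d × Space d) :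
    0 ≤ heatWeight Ω t z :=
  mul_nonneg (heatConst_pos d hΩ t).le (by positivity)

theorem continuous_heatWeight (Ω t : ℝ) : Continuous (heatWeight (d := d) Ω t) := by
  unfold heatWeight
  fun_prop

theorem integrable_exp_neg_mul_sq_norm {b : ℝ} (hb : 0 < b) :
    Integrable fun x : Space d => Real.exp (-b * ‖x‖ ^ 2) := by
  have h := (GaussianFourier.integrable_cexp_neg_mul_sq_norm_add (V := Space d) (b := b)
    (by simpa using hb) 0 0).norm
  refine h.congr (Filter.Eventually.of_forall fun x => ?_)
  simp only [zero_mul, add_zero]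
  rw [Complex.norm_exp]
  congr 1
  rw [← Complex.ofReal_pow, ← Complex.ofReal_neg, ← Complex.ofReal_mul, Complex.ofReal_re]

theorem exp_sub_one_pos {Ω t : ℝ} (hΩ : 0 < Ω) (ht : 0 < t) : 0 < Real.exp (2 * Ω * t) - 1 :=
  sub_pos.2 (Real.one_lt_exp_iff.2 (by positivity))

theorem integrable_heatWeight {Ω t : ℝ} (hΩ : 0 < Ω) (ht : 0 < t) :
    Integrable (heatWeight (d := d) Ω t) := by
  have hγ := exp_sub_one_pos hΩ ht
  exact ((integrable_exp_neg_mul_sq_norm (by positivity)).mul_prod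
    (integrable_exp_neg_mul_sq_norm (by positivity))).const_mul _

theorem continuous_rankOne {H Z : Type*} [NormedAddCommGroup H] [InnerProductSpace ℂ H]
    [TopologicalSpace Z] {u v : Z → H} (hu : Continuous u) (hv : Continuous v) :
    Continuous fun z => InnerProductSpace.rankOne ℂ (u z) (v z) :=
  (ContinuousLinearMap.smulRightL ℂ H H).continuous₂.comp
    (((innerSL ℂ).continuous.comp hv).prodMk hu)

theorem integrable_rankOne_coherent {Ω t : ℝ} (hΩ : 0 < Ω) (ht : 0 < t) (S : Finset (Fin d)) :
    Integrable fun z : Space d × Space d => InnerProductSpace.rankOne ℂ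
      ((heatWeight Ω t z : ℂ) • embed d (coherent hΩ z.1 z.2 S))
      (embed d (coherent hΩ z.1 z.2 S)) := by
  have hc := continuous_coherent hΩ S
  have hw := continuous_heatWeight (d := d) Ω t
  refine ((integrable_heatWeight hΩ ht).mul_const ((Real.pi / Ω) ^ ((d : ℝ) / 2))).mono'
    ?_ (Filter.Eventually.of_forall fun z => le_of_eq ?_)
  · refine Continuous.aestronglyMeasurable ?_
    exact continuous_rankOne ((Complex.continuous_ofReal.comp hw).smul hc) hc
  · rw [InnerProductSpace.norm_rankOne, norm_smul, Complex.norm_real,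
      Real.norm_of_nonneg (heatWeight_nonneg hΩ t z), mul_assoc, ← sq, norm_sq_embed_coherent]

theorem integral_heatWeight_mul_overlap {Ω t : ℝ} (hΩ : 0 < Ω) (k k' : Space d) :
    ∫ z : Space d × Space d, overlap Ω z.1 z.2 0 k * (heatWeight Ω t z * overlap Ω 0 k' z.1 z.2) =
      (((Real.pi / Ω) ^ ((d : ℝ) / 2) : ℝ) : ℂ) *
        Complex.exp ((Real.exp (-(2 * Ω * t)) * ⟪k, k'⟫_ℝ / (2 * Ω) -
          (‖k‖ ^ 2 + ‖k'‖ ^ 2) / (4 * Ω) : ℝ)) := by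
  set E := Real.exp (2 * Ω * t) with hE
  have hE0 : 0 < E := Real.exp_pos _
  have hr : Real.exp (-(2 * Ω * t)) = E⁻¹ := Real.exp_neg _
  set N : ℝ := (Real.pi / Ω) ^ ((d : ℝ) / 2) with hN
  -- The two overlaps add Ω/2 and 1/(2Ω) to the exponents of the weight, turning E - 1 into E. In
  -- the phases z.2 cancels, so the integrals over position and momentum separate.
  have hfac : ∀ z : Space d × Space d,
      overlap Ω z.1 z.2 0 k * (heatWeight Ω t z * overlap Ω 0 k' z.1 z.2) =
      ((N ^ 2 * heatConst d Ω t : ℝ) * Complex.exp (-((‖k‖ ^ 2 + ‖k'‖ ^ 2) / (4 * Ω) : ℝ))) *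
      (Complex.exp (-((E * Ω / 2 : ℝ) : ℂ) * ‖z.1‖ ^ 2 + (Complex.I / 2) * (⟪k - k', z.1⟫_ℝ : ℝ)) *
      Complex.exp (-((E / (2 * Ω) : ℝ) : ℂ) * ‖z.2‖ ^ 2 +
        ((1 / (2 * Ω) : ℝ) : ℂ) * (⟪k + k', z.2⟫_ℝ : ℝ))) := fun z => by
    rw [overlap, overlap, heatWeight, ← hN, ← hE]
    push_cast
    have e : ∀ a b c w x y n h : ℂ, n * Complex.exp a * (h * (Complex.exp b * Complex.exp c) *
        (n * Complex.exp w)) = n ^ 2 * h * Complex.exp (a + b + c + w) := fun a b c w x y n h => by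
      simp only [Complex.exp_add]; ring
    rw [e _ _ _ _ 0 0, mul_assoc, mul_assoc, ← Complex.exp_add, ← Complex.exp_add]
    rw [mul_assoc]
    congr 3
    have h1 : ‖k - z.2‖ ^ 2 = ‖k‖ ^ 2 - 2 * ⟪k, z.2⟫_ℝ + ‖z.2‖ ^ 2 := norm_sub_sq_real _ _
    have h2 : ‖z.2 - k'‖ ^ 2 = ‖z.2‖ ^ 2 - 2 * ⟪k', z.2⟫_ℝ + ‖k'‖ ^ 2 := by
      rw [norm_sub_sq_real, real_inner_comm]
    have h1' := congrArg (fun r : ℝ => (r : ℂ)) h1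
    have h2' := congrArg (fun r : ℝ => (r : ℂ)) h2
    push_cast at h1' h2'
    rw [h1', h2']
    have hΩ' : (Ω : ℂ) ≠ 0 := by exact_mod_cast hΩ.ne'
    simp only [sub_zero, zero_sub, norm_neg, add_zero, zero_add, inner_smul_right, inner_sub_left,
      inner_add_left]
    push_cast
    field_simp
    ring
  simp only [hfac]
  rw [integral_const_mul, Measure.volume_eq_prod,
    integral_prod_mul (fun q : Space d => Complex.exp (-((E * Ω / 2 : ℝ) : ℂ) * ‖q‖ ^ 2 +
      (Complex.I / 2) * (⟪k - k', q⟫_ℝ : ℝ))) (fun p : Space d =>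
      Complex.exp (-((E / (2 * Ω) : ℝ) : ℂ) * ‖p‖ ^ 2 +
        ((1 / (2 * Ω) : ℝ) : ℂ) * (⟪k + k', p⟫_ℝ : ℝ))),
    integral_gaussian_cexp (by positivity), integral_gaussian_cexp (by positivity)]
  set c₁ : ℝ := (Real.pi / (E * Ω / 2)) ^ ((d : ℝ) / 2) with hc₁
  set c₂ : ℝ := (Real.pi / (E / (2 * Ω))) ^ ((d : ℝ) / 2) with hc₂
  have hconst : N ^ 2 * heatConst d Ω t * (c₁ * c₂) = N := by
    rw [heatConst, ← hE, ← hN, ← hc₁, ← hc₂]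
    have h1 : 0 < N := by rw [hN]; positivity
    have h2 : 0 < c₁ := by rw [hc₁]; positivity
    have h3 : 0 < c₂ := by rw [hc₂]; positivity
    field_simp
  have e : ∀ a b c n x y : ℂ, n * Complex.exp a * (x * Complex.exp b * (y * Complex.exp c)) =
      (n * (x * y)) * Complex.exp (a + b + c) := fun a b c n x y => by
    simp only [Complex.exp_add]; ring
  rw [e, ← Complex.ofReal_mul, ← Complex.ofReal_mul, hconst]
  congr 2
  have h1 : ‖k - k'‖ ^ 2 = ‖k‖ ^ 2 - 2 * ⟪k, k'⟫_ℝ + ‖k'‖ ^ 2 := norm_sub_sq_real _ _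
  have h2 : ‖k + k'‖ ^ 2 = ‖k‖ ^ 2 + 2 * ⟪k, k'⟫_ℝ + ‖k'‖ ^ 2 := norm_add_sq_real _ _
  have h1' := congrArg (fun r : ℝ => (r : ℂ)) h1
  have h2' := congrArg (fun r : ℝ => (r : ℂ)) h2
  push_cast at h1' h2'
  rw [h1', h2', div_pow, Complex.I_sq, hr]
  have hΩ' : (Ω : ℂ) ≠ 0 := by exact_mod_cast hΩ.ne'
  have hE' : (E : ℂ) ≠ 0 := by exact_mod_cast hE0.ne'
  push_cast
  field_simp
  ring

theorem eq_of_inner_coherent {Ω : ℝ} (hΩ : 0 < Ω) {X Y : Hilb d →L[ℂ] Hilb d}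
    (h : ∀ (S S' : Finset (Fin d)) (k k' : Space d),
      ⟪embed d (coherent hΩ 0 k' S'), X (embed d (coherent hΩ 0 k S))⟫_ℂ =
      ⟪embed d (coherent hΩ 0 k' S'), Y (embed d (coherent hΩ 0 k S))⟫_ℂ) : X = Y := by
  have h1 : ∀ S k, (X - Y) (embed d (coherent hΩ 0 k S)) = 0 := fun S k =>
    eq_zero_of_inner_coherent hΩ _ fun S' k' => by
      rw [_root_.sub_apply, inner_sub_right, h, sub_self]
  have h2 : ContinuousLinearMap.adjoint (X - Y) = 0 := by
    ext1 y
    refine eq_zero_of_inner_coherent hΩ _ fun S k => ?_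
    rw [ContinuousLinearMap.adjoint_inner_right, h1, inner_zero_left]
  rw [← sub_eq_zero, ← ContinuousLinearMap.adjoint_adjoint (X - Y), h2, map_zero]

/-- The Glauber P-representation of the heat operator. Both sides are compared only on coherent
states at position 0, which are already total, and there all integrals are Gaussian. -/
theorem heat_eq_integral {Ω t : ℝ} (hΩ : 0 < Ω) (ht : 0 < t) (j : Fin 2) :
    heat (dirac d Ω j) t = ∑ S : Finset (Fin d),
      ((Real.exp (-t * (2 * Ω * fermionNumber j S)) : ℝ) : ℂ) •
      ∫ z : Space d × Space d, InnerProductSpace.rankOne ℂ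
        ((heatWeight Ω t z : ℂ) • embed d (coherent hΩ z.1 z.2 S))
        (embed d (coherent hΩ z.1 z.2 S)) := by
  refine eq_of_inner_coherent hΩ fun S S' k k' => ?_
  have h1 : ∀ T : Finset (Fin d), ⟪embed d (coherent hΩ 0 k' S'),
      (∫ z : Space d × Space d, InnerProductSpace.rankOne ℂ
        ((heatWeight Ω t z : ℂ) • embed d (coherent hΩ z.1 z.2 T))
        (embed d (coherent hΩ z.1 z.2 T))) (embed d (coherent hΩ 0 k S))⟫_ℂ =
      if S' = T then (if T = S then (((Real.pi / Ω) ^ ((d : ℝ) / 2) : ℝ) : ℂ) *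
        Complex.exp ((Real.exp (-(2 * Ω * t)) * ⟪k, k'⟫_ℝ / (2 * Ω) -
          (‖k‖ ^ 2 + ‖k'‖ ^ 2) / (4 * Ω) : ℝ)) else 0) else 0 := fun T => by
    have h := (inner_integral_rankOne (integrable_rankOne_coherent hΩ ht T) 1
      (embed d (coherent hΩ 0 k S)) (embed d (coherent hΩ 0 k' S'))).2
    simp only [one_apply_eq_self, inner_smul_right, inner_coherent] at h
    refine h.trans ?_
    split_ifs with h1 h2
    · exact integral_heatWeight_mul_overlap hΩ k k'
    · simp
    · simp
    · simp
  rw [heat_coherent hΩ j ht, inner_smul_right, inner_coherent, _root_.sum_apply, inner_sum]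
  simp only [_root_.smul_apply, inner_smul_right, h1]
  simp only [mul_ite, mul_zero, Finset.sum_ite_eq, Finset.mem_univ, if_true]
  split_ifs with h
  · subst h
    rw [Complex.ofReal_mul, mul_assoc]
    congr 1
    rw [overlap, mul_left_comm, Complex.ofReal_exp, ← Complex.exp_add]
    congr 2
    set r := Real.exp (-(2 * Ω * t))
    have h2 : ‖r • k - k'‖ ^ 2 = r ^ 2 * ‖k‖ ^ 2 - 2 * (r * ⟪k, k'⟫_ℝ) + ‖k'‖ ^ 2 := by
      rw [norm_sub_sq_real, norm_smul, inner_smul_left, mul_pow, Real.norm_eq_abs, sq_abs]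
      rfl
    have h2' := congrArg (fun r : ℝ => (r : ℂ)) h2
    push_cast at h2'
    have hΩ' : (Ω : ℂ) ≠ 0 := by exact_mod_cast hΩ.ne'
    simp only [sub_zero, add_zero, smul_zero, inner_zero_right, norm_zero]
    push_cast
    rw [h2']
    field_simp
    ring
  · rfl

/-! ### Decay of Moyal products with coherent states -/

/-- The integral `∫ G(y) g(y + r) exp (-i ⟨ξ, y⟩) dy`. -/
def windowedFourier (G g : 𝓢(Space d, ℂ)) (r ξ : Space d) : ℂ :=
  ∫ y, Complex.exp (-(Complex.I * (⟪ξ, y⟫_ℝ : ℝ))) * G y * g (y + r)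

/-- Integration by parts: multiplying by iξ_μ differentiates the exponential, up to sign, and the
derivative falls on G or on the window. -/
theorem coord_mul_windowedFourier (G g : 𝓢(Space d, ℂ)) (r ξ : Space d) (μ : Fin d) :
    Complex.I * (ξ μ : ℝ) * windowedFourier G g r ξ =
      windowedFourier (∂_{EuclideanSpace.single μ (1 : ℝ)} G) g r ξ +
        windowedFourier G (∂_{EuclideanSpace.single μ (1 : ℝ)} g) r ξ := by
  set v : Space d := EuclideanSpace.single μ (1 : ℝ) with hv
  set e : Space d → ℂ := fun y => Complex.exp (Complex.I * (⟪-ξ, y⟫_ℝ : ℝ)) with he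
  have hee : ∀ y, Complex.exp (-(Complex.I * (⟪ξ, y⟫_ℝ : ℝ))) = e y := fun y => by
    simp [he]
  have hte : e.HasTemperateGrowth := hasTemperateGrowth_cexp_I_mul (-ξ)
  have hG : ∀ (K : 𝓢(Space d, ℂ)) y, smulLeftCLM ℂ e K y = e y * K y := fun K y => by
    rw [smulLeftCLM_apply_apply hte, smul_eq_mul]
  have hg : ∀ (k : 𝓢(Space d, ℂ)) y, compSubConstCLM ℂ (-r) k y = k (y + r) := fun k y => by
    rw [compSubConstCLM_apply, sub_neg_eq_add]
  have hdg : ∂_{v} (compSubConstCLM ℂ (-r) g) = compSubConstCLM ℂ (-r) (∂_{v} g) := by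
    ext y
    rw [hg, lineDerivOp_apply_eq_fderiv, lineDerivOp_apply_eq_fderiv,
      show (compSubConstCLM ℂ (-r) g : Space d → ℂ) = fun y => g (y + r) from funext (hg g),
      fderiv_comp_add_right]
  have hdG : ∂_{v} (smulLeftCLM ℂ e G) = smulLeftCLM ℂ e (∂_{v} G) -
      (Complex.I * (ξ μ : ℝ)) • smulLeftCLM ℂ e G := by
    ext y
    have h1 : HasFDerivAt e (e y • (Complex.I • (Complex.ofRealCLM ∘L innerSL ℝ (-ξ)))) y :=
      ((Complex.ofRealCLM ∘L innerSL ℝ (-ξ)).hasFDerivAt.const_mul Complex.I).cexp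
    have h2 := h1.mul (G.differentiableAt (x := y)).hasFDerivAt
    rw [lineDerivOp_apply_eq_fderiv,
      show (smulLeftCLM ℂ e G : Space d → ℂ) = fun y => e y * G y from funext (hG G)]
    erw [h2.fderiv]
    simp [hG, lineDerivOp_apply_eq_fderiv, hv, EuclideanSpace.inner_single_right]
    ring
  have hint : ∀ K k : 𝓢(Space d, ℂ), Integrable fun y => e y * K y * k (y + r) := fun K k => by
    have h := (pairing (ContinuousLinearMap.mul ℂ ℂ) (smulLeftCLM ℂ e K)
      (compSubConstCLM ℂ (-r) k)).integrable (μ := volume)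
    refine h.congr (Filter.Eventually.of_forall fun y => ?_)
    rw [pairing_apply_apply, ContinuousLinearMap.mul_apply', hG, hg]
  have key := integral_mul_lineDerivOp_right_eq_neg_left (μ := volume)
    (smulLeftCLM ℂ e G) (compSubConstCLM ℂ (-r) g) v
  rw [hdg, hdG] at key
  simp only [hG, hg, sub_apply, smul_apply, smul_eq_mul, sub_mul] at key
  simp only [windowedFourier, hee]
  rw [key, integral_sub (hint _ _) ?_]
  · rw [← integral_const_mul]
    simp only [neg_sub, add_sub_cancel, mul_assoc]
  · simpa only [mul_assoc] using (hint G g).const_mul (Complex.I * (ξ μ : ℝ))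

theorem norm_le_sum_abs_coord (ξ : Space d) : ‖ξ‖ ≤ ∑ μ, |ξ μ| := by
  conv_lhs => rw [← (EuclideanSpace.basisFun (Fin d) ℝ).sum_repr ξ]
  refine (norm_sum_le _ _).trans (Finset.sum_le_sum fun μ _ => ?_)
  rw [norm_smul]
  simp

theorem exists_pow_mul_norm_le (g : 𝓢(Space d, ℂ)) (N : ℕ) :
    ∃ C, 0 ≤ C ∧ ∀ x, (1 + ‖x‖) ^ N * ‖g x‖ ≤ C := by
  have h := fun x => one_add_le_sup_seminorm_apply (𝕜 := ℂ) (m := (N, 0)) le_rfl le_rfl g x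
  simp only [norm_iteratedFDeriv_zero] at h
  exact ⟨_, (by positivity : (0 : ℝ) ≤ (1 + ‖(0 : Space d)‖) ^ N * ‖g 0‖).trans (h 0), h⟩

/-- Every power of 1 + ‖ξ‖ costs one derivative of G or g, hence the induction on M for all pairs at
once. Powers of 1 + ‖r‖ are shared through 1 + ‖r‖ ≤ (1 + ‖y‖)(1 + ‖y + r‖). -/
theorem norm_windowedFourier_le (M N : ℕ) : ∀ G g : 𝓢(Space d, ℂ), ∃ C, 0 ≤ C ∧ ∀ r ξ,
    (1 + ‖r‖) ^ N * (1 + ‖ξ‖) ^ M * ‖windowedFourier G g r ξ‖ ≤ C := by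
  induction M with
  | zero =>
    intro G g
    obtain ⟨C₁, hC₁, h₁⟩ := exists_pow_mul_norm_le g N
    -- The additional d + 1 powers make the integral over y converge.
    obtain ⟨C₂, hC₂, h₂⟩ := exists_pow_mul_norm_le G (N + (d + 1))
    have hint : Integrable fun y : Space d => ((1 + ‖y‖) ^ (d + 1))⁻¹ := by
      have h := integrable_one_add_norm (E := Space d) (μ := volume) (r := ((d + 1 : ℕ) : ℝ))
        (by rw [finrank_euclideanSpace_fin]; push_cast; linarith)
      refine h.congr (Filter.Eventually.of_forall fun y => ?_)
      simp only
      rw [Real.rpow_neg (by positivity), Real.rpow_natCast]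
    refine ⟨∫ y : Space d, C₁ * C₂ * ((1 + ‖y‖) ^ (d + 1))⁻¹,
      integral_nonneg fun y => by positivity, fun r ξ => ?_⟩
    rw [pow_zero, mul_one, windowedFourier]
    have : (1 + ‖r‖) ^ N * ‖∫ y, Complex.exp (-(Complex.I * (⟪ξ, y⟫_ℝ : ℝ))) * G y * g (y + r)‖ =
        ‖∫ y, ((1 + ‖r‖) ^ N : ℝ) •
          (Complex.exp (-(Complex.I * (⟪ξ, y⟫_ℝ : ℝ))) * G y * g (y + r))‖ := by
      rw [integral_smul, norm_smul, Real.norm_of_nonneg (by positivity)]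
    rw [this]
    refine norm_integral_le_of_norm_le (hint.const_mul _) (Filter.Eventually.of_forall fun y => ?_)
    have he : ‖Complex.exp (-(Complex.I * (⟪ξ, y⟫_ℝ : ℝ)))‖ = 1 := by
      rw [Complex.norm_exp]; simp
    rw [norm_smul, norm_mul, norm_mul, he, one_mul, Real.norm_of_nonneg (by positivity)]
    have hr : 1 + ‖r‖ ≤ (1 + ‖y‖) * (1 + ‖y + r‖) := by
      have h : ‖r‖ ≤ ‖y + r‖ + ‖y‖ := by
        calc ‖r‖ = ‖(y + r) - y‖ := by rw [add_sub_cancel_left]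
          _ ≤ _ := norm_sub_le _ _
      nlinarith [norm_nonneg y, norm_nonneg (y + r)]
    have h₂' : (1 + ‖y‖) ^ N * ‖G y‖ ≤ C₂ * ((1 + ‖y‖) ^ (d + 1))⁻¹ := by
      rw [← div_eq_mul_inv, le_div_iff₀ (by positivity)]
      have := h₂ y
      rw [pow_add] at this
      linarith
    calc _ ≤ ((1 + ‖y‖) * (1 + ‖y + r‖)) ^ N * (‖G y‖ * ‖g (y + r)‖) := by gcongr
      _ = ((1 + ‖y + r‖) ^ N * ‖g (y + r)‖) * ((1 + ‖y‖) ^ N * ‖G y‖) := by rw [mul_pow]; ring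
      _ ≤ C₁ * (C₂ * ((1 + ‖y‖) ^ (d + 1))⁻¹) := by gcongr; exact h₁ _
      _ = _ := by ring
  | succ M ih =>
    intro G g
    obtain ⟨C, hC, h⟩ := ih G g
    choose C₁ hC₁ h₁ using fun μ : Fin d => ih (∂_{EuclideanSpace.single μ (1 : ℝ)} G) g
    choose C₂ hC₂ h₂ using fun μ : Fin d => ih G (∂_{EuclideanSpace.single μ (1 : ℝ)} g)
    refine ⟨C + ∑ μ, (C₁ μ + C₂ μ), add_nonneg hC (Finset.sum_nonneg fun μ _ =>
      add_nonneg (hC₁ μ) (hC₂ μ)), fun r ξ => ?_⟩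
    set w := (1 + ‖r‖) ^ N * (1 + ‖ξ‖) ^ M with hw
    have hw0 : 0 ≤ w := by positivity
    have hμ : ∀ μ, w * (|ξ μ| * ‖windowedFourier G g r ξ‖) ≤ C₁ μ + C₂ μ := fun μ => by
      have h3 : |ξ μ| * ‖windowedFourier G g r ξ‖ ≤
          ‖windowedFourier (∂_{EuclideanSpace.single μ (1 : ℝ)} G) g r ξ‖ +
          ‖windowedFourier G (∂_{EuclideanSpace.single μ (1 : ℝ)} g) r ξ‖ := by
        refine le_trans (le_of_eq ?_) (norm_add_le _ _)
        rw [← coord_mul_windowedFourier, norm_mul, norm_mul, Complex.norm_I, one_mul,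
          Complex.norm_real, Real.norm_eq_abs]
      calc _ ≤ w * (_ + _) := by gcongr
        _ = _ := mul_add _ _ _
        _ ≤ _ := add_le_add (h₁ μ r ξ) (h₂ μ r ξ)
    calc _ = w * ((1 + ‖ξ‖) * ‖windowedFourier G g r ξ‖) := by rw [hw, pow_succ]; ring
      _ ≤ w * ((1 + ∑ μ, |ξ μ|) * ‖windowedFourier G g r ξ‖) := by
          gcongr
          exact norm_le_sum_abs_coord ξ
      _ = w * ‖windowedFourier G g r ξ‖ + ∑ μ, w * (|ξ μ| * ‖windowedFourier G g r ξ‖) := by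
          rw [← Finset.mul_sum, ← Finset.sum_mul]; ring
      _ ≤ _ := add_le_add (h r ξ) (Finset.sum_le_sum fun μ _ => hμ μ)

theorem integral_smul_coherent {Ω : ℝ} (hΩ : 0 < Ω) (G : 𝓢(Space d, ℂ)) (x ξ q p : Space d)
    (S : Finset (Fin d)) :
    ‖∫ y, (Complex.exp (-(Complex.I * (⟪ξ, y⟫_ℝ : ℝ))) * G y) • coherent hΩ q p S (x + y)‖ =
      ‖windowedFourier G (gaussian d (half_pos hΩ)) (x - q) (ξ - p)‖ := by
  have h : ∀ y, (Complex.exp (-(Complex.I * (⟪ξ, y⟫_ℝ : ℝ))) * G y) • coherent hΩ q p S (x + y) =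
      (Complex.exp (Complex.I * (⟪p, x⟫_ℝ : ℝ)) *
        (Complex.exp (-(Complex.I * (⟪ξ - p, y⟫_ℝ : ℝ))) * G y *
          gaussian d (half_pos hΩ) (y + (x - q)))) • EuclideanSpace.single S (1 : ℂ) := fun y => by
    rw [coherent_apply, smul_smul, cohFun, gaussian_apply]
    congr 1
    have e : ∀ a b c z g : ℂ, Complex.exp a * (Complex.exp b * g * Complex.exp c) =
      Complex.exp (a + b + c) * g := fun a b c z g => by simp only [Complex.exp_add]; ring
    rw [e _ _ _ 0, mul_right_comm, ← Complex.exp_add]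
    congr 2
    rw [show y + (x - q) = x + y - q by abel]
    simp only [inner_add_right, inner_sub_left]
    push_cast
    ring
  simp only [h]
  rw [integral_smul_const, norm_smul, integral_const_mul, norm_mul, Complex.norm_exp]
  simp [windowedFourier]

/-- At x the product is a windowed Fourier integral that is small unless x is near q and Bx is near
p, which forces p near Bq. The exponent d + 1 is what integrability over p - Bq requires. -/
theorem exists_norm_leftMoyal_coherent_le {Ω : ℝ} (hΩ : 0 < Ω) {Θ : Matrix (Fin d) (Fin d) ℝ}
    (hΘ : IsUnit Θ.det) (f : 𝓢(Space d, ℂ)) :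
    ∃ (B : Space d →L[ℝ] Space d) (C : ℝ), 0 ≤ C ∧ ∀ q p S,
      ‖leftMoyal Θ f (embed d (coherent hΩ q p S))‖ ≤ C * ((1 + ‖p - B q‖) ^ (d + 1))⁻¹ := by
  obtain ⟨G, B, hGB⟩ := moyal_eq hΘ f
  have hT : IsLeftMoyal Θ f (leftMoyal Θ f) := by
    rw [leftMoyal, dif_pos (exists_isLeftMoyal hΘ f)]
    exact (exists_isLeftMoyal hΘ f).choose_spec
  -- Of the 2(d + 1) powers in x - q, half pay for the passage to p - Bq = B(x - q) - (Bx - p), and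
  -- half give square integrability in x.
  obtain ⟨C, hC, hJ⟩ := norm_windowedFourier_le (d + 1) (d + 1 + (d + 1)) G
    (gaussian d (half_pos hΩ))
  let h : Space d → ℝ := fun r => ((1 + ‖r‖) ^ (d + 1))⁻¹
  have hcont : Continuous h := by
    refine Continuous.inv₀ (by fun_prop) fun r => by positivity
  have hmem : MemLp h 2 volume := by
    rw [memLp_two_iff_integrable_sq hcont.aestronglyMeasurable]
    have h1 := integrable_one_add_norm (E := Space d) (μ := volume)
      (r := ((2 * (d + 1) : ℕ) : ℝ)) (by rw [finrank_euclideanSpace_fin]; push_cast; linarith)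
    refine h1.congr (Filter.Eventually.of_forall fun y => ?_)
    simp only [h]
    rw [Real.rpow_neg (by positivity), Real.rpow_natCast, inv_pow, ← pow_mul, mul_comm 2]
  refine ⟨B, (1 + ‖B‖) ^ (d + 1) * C * (eLpNorm h 2 volume).toReal, by positivity,
    fun q p S => ?_⟩
  set c := (1 + ‖B‖) ^ (d + 1) * C * ((1 + ‖p - B q‖) ^ (d + 1))⁻¹ with hc
  have hc0 : 0 ≤ c := by positivity
  have hpt : ∀ x, ‖windowedFourier G (gaussian d (half_pos hΩ)) (x - q) (B x - p)‖ ≤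
      c * h (x - q) := fun x => by
    have h1 := hJ (x - q) (B x - p)
    have h2 : 1 + ‖p - B q‖ ≤ (1 + ‖B‖) * ((1 + ‖x - q‖) * (1 + ‖B x - p‖)) := by
      have h3 : ‖p - B q‖ ≤ ‖B‖ * ‖x - q‖ + ‖B x - p‖ := by
        calc ‖p - B q‖ = ‖B (x - q) - (B x - p)‖ := by rw [map_sub]; congr 1; abel
          _ ≤ ‖B (x - q)‖ + ‖B x - p‖ := norm_sub_le _ _
          _ ≤ _ := by gcongr; exact B.le_opNorm _
      have := norm_nonneg B
      have := norm_nonneg (x - q)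
      have := norm_nonneg (B x - p)
      have : 0 ≤ ‖B‖ * ‖x - q‖ := by positivity
      have : 0 ≤ ‖B‖ * ‖B x - p‖ := by positivity
      have : 0 ≤ ‖x - q‖ * ‖B x - p‖ := by positivity
      have : 0 ≤ ‖B‖ * (‖x - q‖ * ‖B x - p‖) := by positivity
      nlinarith
    have h4 : (1 + ‖p - B q‖) ^ (d + 1) ≤
        (1 + ‖B‖) ^ (d + 1) * ((1 + ‖x - q‖) ^ (d + 1) * (1 + ‖B x - p‖) ^ (d + 1)) := by
      rw [← mul_pow, ← mul_pow]
      gcongr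
    set J := ‖windowedFourier G (gaussian d (half_pos hΩ)) (x - q) (B x - p)‖
    have h5 : (1 + ‖p - B q‖) ^ (d + 1) * (1 + ‖x - q‖) ^ (d + 1) * J ≤
        (1 + ‖B‖) ^ (d + 1) * C := by
      calc _ ≤ ((1 + ‖B‖) ^ (d + 1) * ((1 + ‖x - q‖) ^ (d + 1) * (1 + ‖B x - p‖) ^ (d + 1))) *
            (1 + ‖x - q‖) ^ (d + 1) * J := by gcongr
        _ = (1 + ‖B‖) ^ (d + 1) * ((1 + ‖x - q‖) ^ (d + 1 + (d + 1)) *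
            (1 + ‖B x - p‖) ^ (d + 1) * J) := by rw [pow_add (1 + ‖x - q‖)]; ring
        _ ≤ _ := by gcongr
    have h6 : c * h (x - q) = (1 + ‖B‖) ^ (d + 1) * C /
        ((1 + ‖p - B q‖) ^ (d + 1) * (1 + ‖x - q‖) ^ (d + 1)) := by
      simp only [hc, h]
      field_simp
    rw [h6, le_div_iff₀ (by positivity)]
    linarith
  have hae : ∀ᵐ x ∂(volume : Measure (Space d)),
      ‖leftMoyal Θ f (embed d (coherent hΩ q p S)) x‖ ≤ ‖c * h (x - q)‖ := by
    have hco : embed d (coherent hΩ q p S) =ᵐ[volume] coherent hΩ q p S :=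
      coeFn_toLp _ 2 volume
    filter_upwards [hT (embed d (coherent hΩ q p S))] with x hx
    rw [hx, hGB]
    have h1 : ∀ᵐ y ∂(volume : Measure (Space d)),
        embed d (coherent hΩ q p S) (x + y) = coherent hΩ q p S (x + y) :=
      (measurePreserving_add_left volume x).quasiMeasurePreserving.ae hco
    rw [integral_congr_ae (g := fun y => (Complex.exp (-(Complex.I * (⟪B x, y⟫_ℝ : ℝ))) * G y) •
      coherent hΩ q p S (x + y)) (h1.mono fun y hy => by simp only [hy]), integral_smul_coherent]
    exact (hpt x).trans (le_abs_self _)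
  rw [Lp.norm_def]
  have h1 : eLpNorm (fun x => c * h (x - q)) 2 volume = ENNReal.ofReal c * eLpNorm h 2 volume := by
    have h2 : eLpNorm (h ∘ fun x => x - q) 2 volume = eLpNorm h 2 volume :=
      eLpNorm_comp_measurePreserving hcont.aestronglyMeasurable
        (measurePreserving_sub_right volume q)
    have h3 := eLpNorm_const_smul c (h ∘ fun x => x - q) 2 (volume : Measure (Space d))
    rw [h2, Real.enorm_eq_ofReal hc0] at h3
    exact h3
  have h2 := eLpNorm_mono_ae (p := 2) hae
  rw [h1] at h2
  have h3 := ENNReal.toReal_mono (ENNReal.mul_ne_top ENNReal.ofReal_ne_top hmem.2.ne) h2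
  rw [ENNReal.toReal_mul, ENNReal.toReal_ofReal hc0] at h3
  refine h3.trans (le_of_eq ?_)
  rw [hc]
  ring

/-! ### The trace norm estimate -/

theorem norm_embed_coherent {Ω : ℝ} (hΩ : 0 < Ω) (q p : Space d) (S : Finset (Fin d)) :
    ‖embed d (coherent hΩ q p S)‖ = √((Real.pi / Ω) ^ ((d : ℝ) / 2)) := by
  rw [← norm_sq_embed_coherent hΩ q p S, Real.sqrt_sq (norm_nonneg _)]

theorem traceBound_comp_heat {Ω t : ℝ} (hΩ : 0 < Ω) (ht : 0 < t) (j : Fin 2)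
    (T : Hilb d →L[ℂ] Hilb d) {M : Space d × Space d → ℝ}
    (hM : ∀ z S, ‖T (embed d (coherent hΩ z.1 z.2 S))‖ ≤ M z)
    (hint : Integrable fun z => heatWeight Ω t z * M z) :
    TraceBound (T ∘L heat (dirac d Ω j) t)
      (2 ^ d * (√((Real.pi / Ω) ^ ((d : ℝ) / 2)) * ∫ z, heatWeight Ω t z * M z)) := by
  set N := √((Real.pi / Ω) ^ ((d : ℝ) / 2)) with hN
  let c : Finset (Fin d) → ℝ := fun S => Real.exp (-t * (2 * Ω * fermionNumber j S))
  let I : Finset (Fin d) → (Hilb d →L[ℂ] Hilb d) := fun S =>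
    ∫ z : Space d × Space d, InnerProductSpace.rankOne ℂ
      ((heatWeight Ω t z : ℂ) • embed d (coherent hΩ z.1 z.2 S)) (embed d (coherent hΩ z.1 z.2 S))
  have h1 : T ∘L heat (dirac d Ω j) t = ∑ S, ((c S : ℂ) • T) ∘L I S := by
    rw [heat_eq_integral hΩ ht]
    ext1 x
    simp only [ContinuousLinearMap.comp_apply, _root_.sum_apply, map_sum, _root_.smul_apply,
      map_smul, c, I]
  -- The fermionic factors are simply bounded by 1, so the sum over S contributes 2^d.
  have hc : ∀ S, c S ≤ 1 := fun S => Real.exp_le_one_iff.2 (by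
    have : 0 ≤ t * (2 * Ω * fermionNumber j S) := by positivity
    linarith)
  have h2 := TraceBound.sum Finset.univ fun S _ =>
    traceBound_comp_integral (integrable_rankOne_coherent hΩ ht S) ((c S : ℂ) • T)
      (hint.const_mul N) fun z => by
        rw [_root_.smul_apply, map_smul, norm_smul, norm_smul, Complex.norm_real,
          Complex.norm_real, Real.norm_of_nonneg (heatWeight_nonneg hΩ t z),
          Real.norm_of_nonneg (Real.exp_pos _).le, norm_embed_coherent]
        have hw := heatWeight_nonneg hΩ t z
        have hM' := hM z S
        calc c S * (heatWeight Ω t z * ‖T (embed d (coherent hΩ z.1 z.2 S))‖) * N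
            ≤ 1 * (heatWeight Ω t z * M z) * N := by
              gcongr
              · exact hc S
          _ = _ := by ring
  rw [h1]
  refine h2.mono (le_of_eq ?_)
  rw [integral_const_mul]
  simp

/-! ### Integrals of the weight for large and for small times -/

theorem integral_exp_neg_mul_sq_norm {b : ℝ} (hb : 0 < b) :
    ∫ x : Space d, Real.exp (-b * ‖x‖ ^ 2) = (Real.pi / b) ^ ((d : ℝ) / 2) := by
  rw [GaussianFourier.integral_rexp_neg_mul_sq_norm hb, finrank_euclideanSpace_fin]

theorem integral_heatWeight {Ω t : ℝ} (hΩ : 0 < Ω) (ht : 0 < t) :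
    ∫ z : Space d × Space d, heatWeight Ω t z = heatConst d Ω t *
      ((Real.pi / ((Real.exp (2 * Ω * t) - 1) * Ω / 2)) ^ ((d : ℝ) / 2) *
        (Real.pi / ((Real.exp (2 * Ω * t) - 1) / (2 * Ω))) ^ ((d : ℝ) / 2)) := by
  have hγ := exp_sub_one_pos hΩ ht
  simp only [heatWeight]
  rw [integral_const_mul, Measure.volume_eq_prod,
    integral_prod_mul (fun q : Space d =>
      Real.exp (-((Real.exp (2 * Ω * t) - 1) * Ω / 2) * ‖q‖ ^ 2)) (fun p : Space d =>
      Real.exp (-((Real.exp (2 * Ω * t) - 1) / (2 * Ω)) * ‖p‖ ^ 2)),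
    integral_exp_neg_mul_sq_norm (by positivity), integral_exp_neg_mul_sq_norm (by positivity)]

theorem integral_heatWeight_le_of_one_le {Ω : ℝ} (hΩ : 0 < Ω) :
    ∃ C, 0 ≤ C ∧ ∀ t, 1 ≤ t → ∫ z : Space d × Space d, heatWeight Ω t z ≤ C := by
  have hγ₁ := exp_sub_one_pos hΩ one_pos
  -- The mass of the weight is (π/Ω)^{-d/2} (E/(E - 1))^d with E = exp(2Ωt); the ratio decreases in
  -- t, and K is its value at t = 1.
  set K := Real.exp (2 * Ω * 1) / (Real.exp (2 * Ω * 1) - 1) with hK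
  have hK0 : 0 < K := by positivity
  refine ⟨((Real.pi / Ω) ^ ((d : ℝ) / 2))⁻¹ * (K ^ ((d : ℝ) / 2) * K ^ ((d : ℝ) / 2)),
    by positivity, fun t ht => ?_⟩
  have hγ := exp_sub_one_pos hΩ (one_pos.trans_le ht)
  rw [integral_heatWeight hΩ (one_pos.trans_le ht), heatConst]
  have hE : Real.exp (2 * Ω * 1) ≤ Real.exp (2 * Ω * t) := by gcongr
  set E := Real.exp (2 * Ω * t) with hEt
  have hE0 : 0 < E := Real.exp_pos _
  have hEK : E / (E - 1) ≤ K := by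
    rw [hK, div_le_div_iff₀ hγ hγ₁]
    linarith
  have h1 : Real.pi / ((E - 1) * Ω / 2) ≤ K * (Real.pi / (E * Ω / 2)) := by
    calc _ = E / (E - 1) * (Real.pi / (E * Ω / 2)) := by field_simp
      _ ≤ _ := by gcongr
  have h2 : Real.pi / ((E - 1) / (2 * Ω)) ≤ K * (Real.pi / (E / (2 * Ω))) := by
    calc _ = E / (E - 1) * (Real.pi / (E / (2 * Ω))) := by field_simp
      _ ≤ _ := by gcongr
  have h3 : ∀ {a b : ℝ}, 0 < a → 0 < b → a ≤ K * b →
      a ^ ((d : ℝ) / 2) ≤ K ^ ((d : ℝ) / 2) * b ^ ((d : ℝ) / 2) := fun {a b} ha hb h => by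
    rw [← Real.mul_rpow hK0.le hb.le]
    exact Real.rpow_le_rpow ha.le h (by positivity)
  have h1' := h3 (by positivity) (by positivity) h1
  have h2' := h3 (by positivity) (by positivity) h2
  set b₁ := (Real.pi / (E * Ω / 2)) ^ ((d : ℝ) / 2) with hb₁
  set b₂ := (Real.pi / (E / (2 * Ω))) ^ ((d : ℝ) / 2) with hb₂
  set n := (Real.pi / Ω) ^ ((d : ℝ) / 2) with hn
  have hb₁0 : 0 < b₁ := by positivity
  have hb₂0 : 0 < b₂ := by positivity
  have hn0 : 0 < n := by positivity
  calc _ ≤ (n * b₁ * b₂)⁻¹ * ((K ^ ((d : ℝ) / 2) * b₁) * (K ^ ((d : ℝ) / 2) * b₂)) := by gcongr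
    _ = _ := by field_simp

theorem heatConst_mono {Ω s t : ℝ} (hΩ : 0 < Ω) (hst : s ≤ t) :
    heatConst d Ω s ≤ heatConst d Ω t := by
  have hE : Real.exp (2 * Ω * s) ≤ Real.exp (2 * Ω * t) := by gcongr
  unfold heatConst
  gcongr

/-- The shear (q, p) ↦ (q, p - Bq) preserves Lebesgue measure, so the integral factorizes. -/
theorem integrable_shear {g h : Space d → ℝ} (hg : Integrable g) (hh : Integrable h)
    (B : Space d →L[ℝ] Space d) :
    Integrable (fun z : Space d × Space d => g z.1 * h (z.2 - B z.1)) ∧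
      ∫ z : Space d × Space d, g z.1 * h (z.2 - B z.1) = (∫ q, g q) * ∫ p, h p := by
  have hmp : MeasurePreserving (fun z : Space d × Space d => (z.1, z.2 - B z.1))
      (volume.prod volume) (volume.prod volume) :=
    (MeasurePreserving.id volume).skew_product (g := fun q p => p - B q) (by fun_prop)
      (Filter.Eventually.of_forall fun q => (measurePreserving_sub_right volume (B q)).map_eq)
  have h1 : Integrable (fun z : Space d × Space d => g z.1 * h (z.2 - B z.1))
      (volume.prod volume) := hmp.integrable_comp_of_integrable (hg.mul_prod hh)
  refine ⟨h1, ?_⟩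
  rw [Measure.volume_eq_prod, integral_prod _ h1]
  simp only [integral_const_mul, integral_sub_right_eq_self h, integral_mul_const]

/-- The Gaussian in p is dropped, since h already controls p - Bq; only the Gaussian in q must be
integrated, which yields t^{-d/2} rather than t^{-d}. -/
theorem integral_heatWeight_mul_le_of_le_one {Ω : ℝ} (hΩ : 0 < Ω) (B : Space d →L[ℝ] Space d)
    {h : Space d → ℝ} (hh : Integrable h) (hc : Continuous h) (h0 : ∀ p, 0 ≤ h p) :
    ∃ C, 0 ≤ C ∧ ∀ t, 0 < t → t ≤ 1 →
      Integrable (fun z : Space d × Space d => heatWeight Ω t z * h (z.2 - B z.1)) ∧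
      ∫ z : Space d × Space d, heatWeight Ω t z * h (z.2 - B z.1) ≤ C * t ^ (-(d : ℝ) / 2) := by
  refine ⟨heatConst d Ω 1 * ((Real.pi / Ω ^ 2) ^ ((d : ℝ) / 2) * ∫ p, h p), ?_,
    fun t ht ht1 => ?_⟩
  · have := heatConst_pos d hΩ 1
    have := integral_nonneg (μ := volume) (f := h) h0
    positivity
  have hγ := exp_sub_one_pos hΩ ht
  obtain ⟨hi, hI⟩ := integrable_shear (integrable_exp_neg_mul_sq_norm (d := d)
    (b := (Real.exp (2 * Ω * t) - 1) * Ω / 2) (by positivity)) hh B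
  have hle : ∀ z : Space d × Space d, heatWeight Ω t z * h (z.2 - B z.1) ≤
      heatConst d Ω 1 * (Real.exp (-((Real.exp (2 * Ω * t) - 1) * Ω / 2) * ‖z.1‖ ^ 2) *
        h (z.2 - B z.1)) := fun z => by
    have h1 : Real.exp (-((Real.exp (2 * Ω * t) - 1) / (2 * Ω)) * ‖z.2‖ ^ 2) ≤ 1 := by
      rw [Real.exp_le_one_iff, neg_mul, neg_nonpos]
      positivity
    have h2 := heatConst_mono (d := d) hΩ ht1
    have h3 := (heatConst_pos d hΩ 1).le
    have h4 := h0 (z.2 - B z.1)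
    rw [heatWeight, ← mul_assoc (heatConst d Ω 1)]
    gcongr
    exact mul_le_of_le_one_right (Real.exp_pos _).le h1
  have hint : Integrable (fun z : Space d × Space d => heatWeight Ω t z * h (z.2 - B z.1)) := by
    refine (hi.const_mul (heatConst d Ω 1)).mono' ?_ (Filter.Eventually.of_forall fun z => ?_)
    · exact ((continuous_heatWeight Ω t).mul (hc.comp (by fun_prop))).aestronglyMeasurable
    · rw [Real.norm_of_nonneg (mul_nonneg (heatWeight_nonneg hΩ t z) (h0 _))]
      exact hle z
  refine ⟨hint, (integral_mono hint (hi.const_mul _) hle).trans ?_⟩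
  rw [integral_const_mul, hI, integral_exp_neg_mul_sq_norm (by positivity),
    mul_assoc (heatConst d Ω 1), mul_right_comm ((Real.pi / Ω ^ 2) ^ ((d : ℝ) / 2))]
  -- From exp(2Ωt) - 1 ≥ 2Ωt.
  have h1 : Real.pi / ((Real.exp (2 * Ω * t) - 1) * Ω / 2) ≤ Real.pi / Ω ^ 2 * t⁻¹ := by
    rw [← div_eq_mul_inv, div_div]
    have := Real.add_one_le_exp (2 * Ω * t)
    gcongr
    nlinarith
  have h2 := Real.rpow_le_rpow (by positivity) h1 (by positivity : 0 ≤ (d : ℝ) / 2)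
  rw [Real.mul_rpow (by positivity) (by positivity), Real.inv_rpow ht.le,
    ← Real.rpow_neg ht.le, ← neg_div] at h2
  have := (heatConst_pos d hΩ 1).le
  have := integral_nonneg (μ := volume) (f := h) h0
  gcongr

theorem traceNorm_leftMoyal_comp_heat_le {Ω : ℝ} (hΩ : 0 < Ω) {Θ : Matrix (Fin d) (Fin d) ℝ}
    (hΘ : IsUnit Θ.det) (f : 𝓢(Space d, ℂ)) :
    ∃ C : ℝ, ∀ j : Fin 2, ∀ t : ℝ, 0 < t →
      traceNorm (leftMoyal Θ f ∘L heat (dirac d Ω j) t) ≤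
        ENNReal.ofReal (C * max (t ^ (-(d : ℝ) / 2)) (t ^ ((d : ℝ) / 2))) := by
  obtain ⟨B, C₀, hC₀, hdecay⟩ := exists_norm_leftMoyal_coherent_le hΩ hΘ f
  let h : Space d → ℝ := fun r => C₀ * ((1 + ‖r‖) ^ (d + 1))⁻¹
  have hh : Integrable h := by
    have h1 := integrable_one_add_norm (E := Space d) (μ := volume) (r := ((d + 1 : ℕ) : ℝ))
      (by rw [finrank_euclideanSpace_fin]; push_cast; linarith)
    refine (h1.const_mul C₀).congr (Filter.Eventually.of_forall fun y => ?_)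
    simp only [h]
    rw [Real.rpow_neg (by positivity), Real.rpow_natCast]
  have hhc : Continuous h :=
    continuous_const.mul (Continuous.inv₀ (by fun_prop) fun r => by positivity)
  obtain ⟨C₁, hC₁, hsmall⟩ := integral_heatWeight_mul_le_of_le_one hΩ B hh hhc
    fun p => by positivity
  obtain ⟨C₂, hC₂, hlarge⟩ := integral_heatWeight_le_of_one_le (d := d) hΩ
  set N := √((Real.pi / Ω) ^ ((d : ℝ) / 2)) with hN
  have hN0 : 0 ≤ N := Real.sqrt_nonneg _
  set L := ‖leftMoyal Θ f‖
  have hL : 0 ≤ L := norm_nonneg _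
  refine ⟨2 ^ d * (N * (C₁ + C₂ * (L * N))), fun j t ht => ?_⟩
  rcases le_total t 1 with ht1 | ht1
  · obtain ⟨hint, hI⟩ := hsmall t ht ht1
    have hb := traceBound_comp_heat hΩ ht j (leftMoyal Θ f)
      (M := fun z => h (z.2 - B z.1)) (fun z S => hdecay z.1 z.2 S) hint
    refine (hb.mono ?_).traceNorm_le
    calc _ ≤ 2 ^ d * (N * (C₁ * t ^ (-(d : ℝ) / 2))) := by gcongr
      _ = 2 ^ d * (N * C₁) * t ^ (-(d : ℝ) / 2) := by ring
      _ ≤ _ := by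
        gcongr
        · exact le_add_of_nonneg_right (by positivity)
        · exact le_max_left _ _
  -- For t ≥ 1 the decay of f ⋆ |q,p⟩ is not needed: the operator norm of L(f) and the bounded mass
  -- of the weight suffice.
  · have hb := traceBound_comp_heat hΩ ht j (leftMoyal Θ f) (M := fun _ => L * N)
      (fun z S => by
        rw [hN, ← norm_embed_coherent hΩ z.1 z.2 S]
        exact ContinuousLinearMap.le_opNorm _ _)
      ((integrable_heatWeight hΩ ht).mul_const _)
    refine (hb.mono ?_).traceNorm_le
    rw [integral_mul_const]
    have h1 : 1 ≤ max (t ^ (-(d : ℝ) / 2)) (t ^ ((d : ℝ) / 2)) :=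
      (Real.one_le_rpow ht1 (by positivity)).trans (le_max_right _ _)
    have h2 := hlarge t ht1
    calc _ ≤ 2 ^ d * (N * (C₂ * (L * N))) := by gcongr
      _ ≤ 2 ^ d * (N * (C₁ + C₂ * (L * N))) := by
        gcongr
        exact le_add_of_nonneg_left hC₁
      _ ≤ _ := le_mul_of_one_le_right (by positivity) h1

end MoyalOscillator

end

theorem mainTheorem8 (d : ℕ) (Ω : ℝ) (hΩ : 0 < Ω)
    (Θ : Matrix (Fin d) (Fin d) ℝ) (hΘ_skew : Θ.transpose = -Θ) (hΘ_inv : IsUnit Θ.det) :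
    (∀ j : Fin 2, IsSelfAdjoint (MoyalOscillator.dirac d Ω j)) ∧
    ∀ f : 𝓢(EuclideanSpace ℝ (Fin d), ℂ), ∃ C : ℝ, ∀ j : Fin 2, ∀ t : ℝ, 0 < t →
      MoyalOscillator.traceNorm
          (MoyalOscillator.leftMoyal Θ f ∘L MoyalOscillator.heat (MoyalOscillator.dirac d Ω j) t) ≤
        ENNReal.ofReal (C * max (t ^ (-(d : ℝ) / 2)) (t ^ ((d : ℝ) / 2))) :=
  ⟨MoyalOscillator.isSelfAdjoint_dirac hΩ,
    MoyalOscillator.traceNorm_leftMoyal_comp_heat_le hΩ hΘ_inv⟩
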